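/- Let $\Sigma$ be an ordered alphabet. The run-length encoding of a string $S\in\Sigma^*$ is the sequence $\mathrm{RLE}_S=(a_1,p_1),\dots,(a_n,p_n)$ with $S=a_1^{p_1}\cdots a_n^{p_n}$ in which each $a_i^{p_i}$ is the longest prefix of $a_i^{p_i}\cdots a_n^{p_n}$ of the form $a^p$ with $a\in\Sigma$, $p>0$. The s-factorization of $S$ (LZ77 with self-references) is the factorization $S=f_1\cdots f_m$ into non-empty factors such that $f_i$ is the single character $c$ that follows $f_1\cdots f_{i-1}$ in $S$ if $c$ does not occur in $f_1\cdots f_{i-1}$, and otherwise $f_i$ is the longest prefix of $f_i\cdots f_m$ that occurs at least twice in $f_1\cdots f_i$. The model of computation is the word RAM whose words are large enough to hold the lengths and positions of $S$ (word size $w$ with $|S|<2^w$); space is counted in words, and two input characters can be compared in constant time. There are a single word-RAM program and a constant $C$, both independent of $\Sigma$, $S$ and $w$, such that, given $\mathrm{RLE}_S$ of any string $S\in\Sigma^*$ with $n$ runs, the program computes the s-factorization of $S$, i.e. the list of the lengths $|f_1|,\dots,|f_m|$, in time at most $C\,(n\lfloor\log_2 n\rfloor+1)$ (where $n\log_2 n$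 is read as $0$ for $n=0$) and in space at most $C\,(n+1)$ words. In other words, the s-factorization of $S$ can be computed from $\mathrm{RLE}_S$ off-line in $O(n\log n)$ time and $O(n)$ space. -/

import Mathlib

universe u

namespace RLELZ

/-! ### Strings, run-length encoding, s-factorization

Strings are lists; all positions are counted from `0`. -/

section Strings

variable {α : Type u}

/-- The decompression function: the string `a₁^{p₁} a₂^{p₂} ⋯ aₙ^{pₙ}`. -/
def val (R : List (α × ℕ)) : List α :=
  (R.map fun x => List.replicate x.2 x.1).flatten

/-- `R = (a₁, p₁), …, (aₙ, pₙ)` is the run-length encoding of `S`: the factors `aᵢ^{pᵢ}` concatenate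
to `S`, and each factor is the longest prefix of the remaining string `aᵢ^{pᵢ} ⋯ aₙ^{pₙ}` of the
form `a^p` with `p > 0`. -/
def IsRLE (S : List α) (R : List (α × ℕ)) : Prop :=
  val R = S ∧
    ∀ (i : ℕ) (h : i < R.length),
      0 < R[i].2 ∧ ∀ (b : α) (q : ℕ), List.replicate q b <+: val (R.drop i) → q ≤ R[i].2

/-- `x` occurs in `y` at position `p`. -/
def OccursAt (x y : List α) (p : ℕ) : Prop :=
  ∃ l r : List α, l.length = p ∧ l ++ x ++ r = y

/-- `x` occurs at least twice in `y` (the occurrences may overlap). -/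
def OccursTwice (x y : List α) : Prop :=
  ∃ p q : ℕ, p ≠ q ∧ OccursAt x y p ∧ OccursAt x y q

/-- `f` is the s-factor of the string `u ++ v` that starts after its prefix `u`: if the first
character `c` of `v` does not occur in `u`, it is that character; otherwise it is the longest prefix
`f` of `v` that occurs at least twice in `u ++ f`. -/
def IsSFactor (u v f : List α) : Prop :=
  ∃ (c : α) (v' : List α), v = c :: v' ∧
    ((c ∉ u ∧ f = [c]) ∨
     (c ∈ u ∧ f <+: v ∧ OccursTwice f (u ++ f) ∧
        ∀ g : List α, g <+: v → OccursTwice g (u ++ g) → g.length ≤ f.length))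

/-- `F` is the s-factorization of `S` (the first factor is the first character, because no character
occurs in the empty string). -/
def IsSFactorization (S : List α) (F : List (List α)) : Prop :=
  F.flatten = S ∧
    ∀ (i : ℕ) (h : i < F.length), IsSFactor (F.take i).flatten (F.drop i).flatten F[i]

end Strings

/-! ### The word RAM

Words of `w` bits are natural numbers below `2 ^ w`. A program uses finitely many registers and
finitely many arrays of words; registers and arrays are named by natural numbers. Every instruction
and every evaluation of a branching or loop condition takes one unit of time. The characters of the
input are elements of an arbitrary linearly ordered alphabet, held in a read-only table; a program
can only compare two of them. -/

/-- The binary word operations. -/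
inductive BinOp : Type
  | add | sub | mul | div | mod | and | or | xor | shl | shr

/-- The value of a binary operation on `w`-bit words; arithmetic is modulo `2 ^ w`. -/
def BinOp.eval (w : ℕ) : BinOp → ℕ → ℕ → ℕ
  | .add, x, y => (x + y) % 2 ^ w
  | .sub, x, y => (x + 2 ^ w - y) % 2 ^ w
  | .mul, x, y => (x * y) % 2 ^ w
  | .div, x, y => x / y
  | .mod, x, y => x % y
  | .and, x, y => x &&& y
  | .or, x, y => x ||| y
  | .xor, x, y => x ^^^ y
  | .shl, x, y => (x <<< y) % 2 ^ w
  | .shr, x, y => x >>> y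

/-- Comparisons of two registers. -/
inductive Cond : Type
  | eq (a b : ℕ)
  | ne (a b : ℕ)
  | lt (a b : ℕ)
  | le (a b : ℕ)

/-- Programs, with structured control flow. -/
inductive Cmd : Type
  /-- no operation -/
  | skip
  /-- `reg d := k` -/
  | const (d k : ℕ)
  /-- `reg d := reg a` -/
  | move (d a : ℕ)
  /-- `reg d := o (reg a) (reg b)` -/
  | op (o : BinOp) (d a b : ℕ)
  /-- `reg d := arr[reg i]` -/
  | load (d arr i : ℕ)
  /-- `arr[reg i] := reg a` -/
  | store (arr i a : ℕ)
  /-- `reg d := 1` if the input character number `reg i` is smaller than the input character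
  number `reg j`, and `reg d := 0` otherwise -/
  | charLt (d i j : ℕ)
  /-- sequential composition -/
  | seq (c₁ c₂ : Cmd)
  /-- conditional branch -/
  | ite (b : Cond) (c₁ c₂ : Cmd)
  /-- loop -/
  | while (b : Cond) (c : Cmd)

/-- The registers that occur in a condition. -/
def Cond.regs : Cond → Finset ℕ
  | .eq a b | .ne a b | .lt a b | .le a b => {a, b}

/-- The registers that occur in a program. -/
def Cmd.regs : Cmd → Finset ℕ
  | .skip => ∅
  | .const d _ => {d}
  | .move d a => {d, a}
  | .op _ d a b => {d, a, b}
  | .load d _ i => {d, i}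
  | .store _ i a => {i, a}
  | .charLt d i j => {d, i, j}
  | .seq c₁ c₂ => c₁.regs ∪ c₂.regs
  | .ite b c₁ c₂ => b.regs ∪ (c₁.regs ∪ c₂.regs)
  | .while b c => b.regs ∪ c.regs

/-- The arrays that occur in a program. -/
def Cmd.arrays : Cmd → Finset ℕ
  | .load _ arr _ => {arr}
  | .store arr _ _ => {arr}
  | .seq c₁ c₂ => c₁.arrays ∪ c₂.arrays
  | .ite _ c₁ c₂ => c₁.arrays ∪ c₂.arrays
  | .while _ c => c.arrays
  | _ => ∅

/-- The number of words occupied by a program that works on `n` input characters with arrays of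
`cap` cells each: the character table, the registers, and the arrays. -/
def Cmd.space (P : Cmd) (n cap : ℕ) : ℕ :=
  n + P.regs.card + P.arrays.card * cap

/-- The contents of the registers and of the arrays. -/
@[ext] structure State : Type where
  reg : ℕ → ℕ
  mem : ℕ → ℕ → ℕ

/-- Write the word `v` into register `d`. -/
def State.setReg (s : State) (d v : ℕ) : State :=
  { s with reg := Function.update s.reg d v }

/-- Write the word `v` into cell `i` of the array `arr`. -/
def State.setMem (s : State) (arr i v : ℕ) : State :=
  { s with mem := Function.update s.mem arr (Function.update (s.mem arr) i v) }

/-- The truth of a condition. -/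
def Cond.holds (s : State) : Cond → Prop
  | .eq a b => s.reg a = s.reg b
  | .ne a b => s.reg a ≠ s.reg b
  | .lt a b => s.reg a < s.reg b
  | .le a b => s.reg a ≤ s.reg b

/-- `Exec w T cap c s t s'`: on the machine with `w`-bit words, character table `T` and arrays of
`cap` cells each, the program `c` started in the state `s` halts after `t` steps in the state `s'`,
having accessed neither a cell of an array nor an entry of the character table out of its range. -/
inductive Exec {α : Type u} [LinearOrder α] (w : ℕ) (T : List α) (cap : ℕ) :
    Cmd → State → ℕ → State → Prop
  | skip (s : State) : Exec w T cap .skip s 1 s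
  | const (s : State) (d k : ℕ) : Exec w T cap (.const d k) s 1 (s.setReg d (k % 2 ^ w))
  | move (s : State) (d a : ℕ) : Exec w T cap (.move d a) s 1 (s.setReg d (s.reg a))
  | op (s : State) (o : BinOp) (d a b : ℕ) :
      Exec w T cap (.op o d a b) s 1 (s.setReg d (o.eval w (s.reg a) (s.reg b)))
  | load (s : State) (d arr i : ℕ) (hi : s.reg i < cap) :
      Exec w T cap (.load d arr i) s 1 (s.setReg d (s.mem arr (s.reg i)))
  | store (s : State) (arr i a : ℕ) (hi : s.reg i < cap) :
      Exec w T cap (.store arr i a) s 1 (s.setMem arr (s.reg i) (s.reg a))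
  | charLt (s : State) (d i j : ℕ) (hi : s.reg i < T.length) (hj : s.reg j < T.length) :
      Exec w T cap (.charLt d i j) s 1
        (s.setReg d (if T[s.reg i] < T[s.reg j] then 1 else 0))
  | seq {c₁ c₂ : Cmd} {s s' s'' : State} {t₁ t₂ : ℕ}
      (h₁ : Exec w T cap c₁ s t₁ s') (h₂ : Exec w T cap c₂ s' t₂ s'') :
      Exec w T cap (.seq c₁ c₂) s (t₁ + t₂) s''
  | ite_true {b : Cond} {c₁ c₂ : Cmd} {s s' : State} {t : ℕ} (hb : b.holds s)
      (h : Exec w T cap c₁ s t s') : Exec w T cap (.ite b c₁ c₂) s (t + 1) s'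
  | ite_false {b : Cond} {c₁ c₂ : Cmd} {s s' : State} {t : ℕ} (hb : ¬ b.holds s)
      (h : Exec w T cap c₂ s t s') : Exec w T cap (.ite b c₁ c₂) s (t + 1) s'
  | while_true {b : Cond} {c : Cmd} {s s' s'' : State} {t₁ t₂ : ℕ} (hb : b.holds s)
      (h₁ : Exec w T cap c s t₁ s') (h₂ : Exec w T cap (.while b c) s' t₂ s'') :
      Exec w T cap (.while b c) s (t₁ + t₂ + 1) s''
  | while_false {b : Cond} {c : Cmd} {s : State} (hb : ¬ b.holds s) :
      Exec w T cap (.while b c) s 1 s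

/-- The initial state for the input `R`: register `0` holds the number of runs, array `0` holds their
exponents, and everything else is `0`. -/
def initState {α : Type u} (R : List (α × ℕ)) : State where
  reg := fun r => if r = 0 then R.length else 0
  mem := fun arr i => if arr = 0 then (R.map Prod.snd).getD i 0 else 0

/-- The result of a computation is the list `L`: register `0` holds its length and array `1` holds
its entries. -/
def State.Outputs (s : State) (L : List ℕ) : Prop :=
  s.reg 0 = L.length ∧ ∀ (i : ℕ) (h : i < L.length), s.mem 1 i = L[i]

end RLELZ

open RLELZ

set_option linter.unusedSectionVars false
set_option linter.unusedSimpArgs false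

namespace RLELZ

/-! ### A total-correctness logic with running times for the word RAM -/

-- A position of the string is described by a run `i` and the number `e` of characters from there to
-- the end of that run. Adjacent runs have different characters, so the longest common prefix of the
-- suffixes at `(i, e)` and `(j, e')` is governed by three cases (`lcp_positions`): it is `0` if the
-- characters differ, `min e e'` if they agree and `e ≠ e'`, and `e` plus the longest common prefix
-- of the suffixes beginning with runs `i + 1` and `j + 1` if `e = e'`. The length of an s-factor is
-- the best such match with an earlier position, self-overlap included (`isSFactor_take`). Hence
-- only matches aligned at run ends can exceed `e`, and the candidates are the earlier runs with the
-- same character and exponent at least `e`. Without a candidate, the factor has length `e` inside a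
-- run; at the beginning of a run it is the largest earlier exponent of the character, or `1` for a
-- fresh character. `FactorLen.isSFactor` proves this case distinction.
--
-- The best candidate is found in the order of the runs by their character and then by the encoding
-- after the run. This is not the order of the decompressed suffixes, but longest common prefixes of
-- the decompressed strings are still monotone along it (`lcp_val_le_of_between`). The best
-- candidate is therefore the nearest one on the left or on the right of run `i`. Two segment trees
-- hold the exponents of the runs already passed, one in sorted order and one in reverse; each
-- returns the nearest run with exponent at least `e` in logarithmic time (`runs_treeFind`). The
-- order itself comes from merge sort of the runs followed by prefix doubling, in which each of the
-- logarithmically many rounds is a linear stable bucket distribution (`runs_suffixSort`).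
--
-- Two amortizations bound the factorization loop (`runs_mainLoop`). The match lengths with the two
-- neighbours are computed by comparing run after run; the runs matched completely lie inside the
-- chosen factor, so they are paid for by the runs that the factor passes. There are at most two
-- factors per run: a factor that starts strictly inside a run reaches at least the end of that run,
-- so a factor that does not finish its run starts at the run's beginning. All data fit into a fixed
-- number of arrays with `2 n + 1` cells.

infixr:60 " ;; " => Cmd.seq

/-- Started in `s`, the program `c` halts, and its running time and final state satisfy `Q`. -/
def Runs {α : Type u} [LinearOrder α] (w : ℕ) (T : List α) (cap : ℕ) (c : Cmd) (s : State)
    (Q : ℕ → State → Prop) : Prop :=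
  ∃ t s', Exec w T cap c s t s' ∧ Q t s'

/-- Does the program write to register `r`? -/
def Cmd.writesReg (r : ℕ) : Cmd → Bool
  | .const d _ | .move d _ | .op _ d _ _ | .load d _ _ | .charLt d _ _ => d == r
  | .seq c₁ c₂ | .ite _ c₁ c₂ => c₁.writesReg r || c₂.writesReg r
  | .while _ c => c.writesReg r
  | _ => false

/-- Does the program write to array `a`? -/
def Cmd.writesArr (a : ℕ) : Cmd → Bool
  | .store arr _ _ => arr == a
  | .seq c₁ c₂ | .ite _ c₁ c₂ => c₁.writesArr a || c₂.writesArr a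
  | .while _ c => c.writesArr a
  | _ => false

/-- The registers and arrays to which `c` does not write have the same contents in `s` and `s'`. -/
structure Frame (c : Cmd) (s s' : State) : Prop where
  reg : ∀ r, c.writesReg r = false → s'.reg r = s.reg r
  mem : ∀ a, c.writesArr a = false → s'.mem a = s.mem a

theorem Frame.refl (c : Cmd) (s : State) : Frame c s s := ⟨fun _ _ => rfl, fun _ _ => rfl⟩

theorem Frame.trans {c : Cmd} {s s' s'' : State} (h : Frame c s s') (h' : Frame c s' s'') :
    Frame c s s'' :=
  ⟨fun r hr => (h'.reg r hr).trans (h.reg r hr), fun a ha => (h'.mem a ha).trans (h.mem a ha)⟩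

@[simp] theorem State.reg_setReg (s : State) (d v r : ℕ) :
    (s.setReg d v).reg r = if r = d then v else s.reg r := by
  simp [State.setReg, Function.update_apply]

@[simp] theorem State.mem_setReg (s : State) (d v : ℕ) : (s.setReg d v).mem = s.mem := rfl

@[simp] theorem State.reg_setMem (s : State) (a i v : ℕ) : (s.setMem a i v).reg = s.reg := rfl

@[simp] theorem State.mem_setMem (s : State) (a i v b : ℕ) :
    (s.setMem a i v).mem b = if b = a then Function.update (s.mem a) i v else s.mem b := by
  by_cases h : b = a
  · subst h; simp [State.setMem]
  · simp [State.setMem, h]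

section

variable {α : Type u} [LinearOrder α] {w : ℕ} {T : List α} {cap : ℕ}

/-- The written registers and arrays are computed from the syntax, so for concrete programs and
indices each claim that a cell is unchanged is closed by `rfl`. Specifications then only have to
mention what changes. -/
theorem Exec.frame {c : Cmd} {s s' : State} {t : ℕ} (h : Exec w T cap c s t s') : Frame c s s' := by
  induction h with
  | skip s => exact Frame.refl _ _
  | const s d k => exact ⟨fun r hr => by
      have : r ≠ d := by rintro rfl; simp [Cmd.writesReg] at hr
      simp [this], fun _ _ => rfl⟩
  | move s d a => exact ⟨fun r hr => by
      have : r ≠ d := by rintro rfl; simp [Cmd.writesReg] at hr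
      simp [this], fun _ _ => rfl⟩
  | op s o d a b => exact ⟨fun r hr => by
      have : r ≠ d := by rintro rfl; simp [Cmd.writesReg] at hr
      simp [this], fun _ _ => rfl⟩
  | load s d arr i hi => exact ⟨fun r hr => by
      have : r ≠ d := by rintro rfl; simp [Cmd.writesReg] at hr
      simp [this], fun _ _ => rfl⟩
  | store s arr i a hi =>
    exact ⟨fun _ _ => rfl, fun b hb => by
      have : b ≠ arr := by rintro rfl; simp [Cmd.writesArr] at hb
      simp [this]⟩
  | charLt s d i j hi hj =>
    exact ⟨fun r hr => by
      have : r ≠ d := by rintro rfl; simp [Cmd.writesReg] at hr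
      simp [this], fun _ _ => rfl⟩
  | seq h₁ h₂ ih₁ ih₂ =>
    constructor
    · intro r hr
      simp only [Cmd.writesReg, Bool.or_eq_false_iff] at hr
      exact (ih₂.reg r hr.2).trans (ih₁.reg r hr.1)
    · intro r hr
      simp only [Cmd.writesArr, Bool.or_eq_false_iff] at hr
      exact (ih₂.mem r hr.2).trans (ih₁.mem r hr.1)
  | ite_true hb h ih =>
    constructor
    · intro r hr
      simp only [Cmd.writesReg, Bool.or_eq_false_iff] at hr
      exact ih.reg r hr.1
    · intro r hr
      simp only [Cmd.writesArr, Bool.or_eq_false_iff] at hr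
      exact ih.mem r hr.1
  | ite_false hb h ih =>
    constructor
    · intro r hr
      simp only [Cmd.writesReg, Bool.or_eq_false_iff] at hr
      exact ih.reg r hr.2
    · intro r hr
      simp only [Cmd.writesArr, Bool.or_eq_false_iff] at hr
      exact ih.mem r hr.2
  | while_true hb h₁ h₂ ih₁ ih₂ =>
    exact ⟨fun r hr => (ih₂.reg r hr).trans (ih₁.reg r hr),
      fun r hr => (ih₂.mem r hr).trans (ih₁.mem r hr)⟩
  | while_false hb => exact Frame.refl _ _

theorem Runs.mono {c : Cmd} {s : State} {Q Q' : ℕ → State → Prop} (h : Runs w T cap c s Q)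
    (hQ : ∀ t s', Frame c s s' → Q t s' → Q' t s') : Runs w T cap c s Q' := by
  obtain ⟨t, s', h, hq⟩ := h
  exact ⟨t, s', h, hQ t s' h.frame hq⟩

@[simp] theorem runs_skip {s : State} {Q : ℕ → State → Prop} :
    Runs w T cap .skip s Q ↔ Q 1 s := by
  constructor
  · rintro ⟨t, s', h, hq⟩; cases h; exact hq
  · intro h; exact ⟨_, _, .skip s, h⟩

@[simp] theorem runs_const {s : State} {Q : ℕ → State → Prop} {d k : ℕ} :
    Runs w T cap (.const d k) s Q ↔ Q 1 (s.setReg d (k % 2 ^ w)) := by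
  constructor
  · rintro ⟨t, s', h, hq⟩; cases h; exact hq
  · intro h; exact ⟨_, _, .const s d k, h⟩

@[simp] theorem runs_move {s : State} {Q : ℕ → State → Prop} {d a : ℕ} :
    Runs w T cap (.move d a) s Q ↔ Q 1 (s.setReg d (s.reg a)) := by
  constructor
  · rintro ⟨t, s', h, hq⟩; cases h; exact hq
  · intro h; exact ⟨_, _, .move s d a, h⟩

theorem runs_op {s : State} {Q : ℕ → State → Prop} {o : BinOp} {d a b : ℕ} :
    Runs w T cap (.op o d a b) s Q ↔ Q 1 (s.setReg d (o.eval w (s.reg a) (s.reg b))) := by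
  constructor
  · rintro ⟨t, s', h, hq⟩; cases h; exact hq
  · intro h; exact ⟨_, _, .op s o d a b, h⟩

@[simp] theorem runs_add {s : State} {Q : ℕ → State → Prop} {d a b : ℕ} :
    Runs w T cap (.op .add d a b) s Q ↔ Q 1 (s.setReg d ((s.reg a + s.reg b) % 2 ^ w)) :=
  runs_op

@[simp] theorem runs_sub {s : State} {Q : ℕ → State → Prop} {d a b : ℕ} :
    Runs w T cap (.op .sub d a b) s Q ↔ Q 1 (s.setReg d ((s.reg a + 2 ^ w - s.reg b) % 2 ^ w)) :=
  runs_op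

@[simp] theorem runs_and {s : State} {Q : ℕ → State → Prop} {d a b : ℕ} :
    Runs w T cap (.op .and d a b) s Q ↔ Q 1 (s.setReg d (s.reg a &&& s.reg b)) :=
  runs_op

@[simp] theorem runs_shr {s : State} {Q : ℕ → State → Prop} {d a b : ℕ} :
    Runs w T cap (.op .shr d a b) s Q ↔ Q 1 (s.setReg d (s.reg a >>> s.reg b)) :=
  runs_op

@[simp] theorem runs_load {s : State} {Q : ℕ → State → Prop} {d a i : ℕ} :
    Runs w T cap (.load d a i) s Q ↔ s.reg i < cap ∧ Q 1 (s.setReg d (s.mem a (s.reg i))) := by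
  constructor
  · rintro ⟨t, s', h, hq⟩; cases h; exact ⟨‹_›, hq⟩
  · rintro ⟨hi, h⟩; exact ⟨_, _, .load s d a i hi, h⟩

@[simp] theorem runs_store {s : State} {Q : ℕ → State → Prop} {a i d : ℕ} :
    Runs w T cap (.store a i d) s Q ↔
      s.reg i < cap ∧ Q 1 (s.setMem a (s.reg i) (s.reg d)) := by
  constructor
  · rintro ⟨t, s', h, hq⟩; cases h; exact ⟨‹_›, hq⟩
  · rintro ⟨hi, h⟩; exact ⟨_, _, .store s a i d hi, h⟩

/-- The bounds are hypotheses because the postcondition already contains the table lookups; for this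
reason the rule is applied by hand and is not part of `exec_rules`. -/
theorem runs_charLt {s : State} {Q : ℕ → State → Prop} {d i j : ℕ}
    (hi : s.reg i < T.length) (hj : s.reg j < T.length)
    (h : Q 1 (s.setReg d (if T[s.reg i] < T[s.reg j] then 1 else 0))) :
    Runs w T cap (.charLt d i j) s Q :=
  ⟨_, _, .charLt s d i j hi hj, h⟩

@[simp] theorem runs_seq {s : State} {Q : ℕ → State → Prop} {c₁ c₂ : Cmd} :
    Runs w T cap (.seq c₁ c₂) s Q ↔
      Runs w T cap c₁ s fun t₁ s₁ => Runs w T cap c₂ s₁ fun t₂ s₂ => Q (t₁ + t₂) s₂ := by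
  constructor
  · rintro ⟨t, s', h, hq⟩; cases h with
    | seq h₁ h₂ => exact ⟨_, _, h₁, _, _, h₂, hq⟩
  · rintro ⟨t₁, s₁, h₁, t₂, s₂, h₂, hq⟩; exact ⟨_, _, .seq h₁ h₂, hq⟩

theorem runs_ite {s : State} {Q : ℕ → State → Prop} {b : Cond} {c₁ c₂ : Cmd} :
    Runs w T cap (.ite b c₁ c₂) s Q ↔
      (b.holds s → Runs w T cap c₁ s fun t s' => Q (t + 1) s') ∧
        (¬ b.holds s → Runs w T cap c₂ s fun t s' => Q (t + 1) s') := by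
  constructor
  · rintro ⟨t, s', h, hq⟩
    cases h with
    | ite_true hb h => exact ⟨fun _ => ⟨_, _, h, hq⟩, fun h' => absurd hb h'⟩
    | ite_false hb h => exact ⟨fun h' => absurd h' hb, fun _ => ⟨_, _, h, hq⟩⟩
  · rintro ⟨h₁, h₂⟩
    by_cases hb : b.holds s
    · obtain ⟨t, s', h, hq⟩ := h₁ hb; exact ⟨_, _, .ite_true hb h, hq⟩
    · obtain ⟨t, s', h, hq⟩ := h₂ hb; exact ⟨_, _, .ite_false hb h, hq⟩

@[simp] theorem Cond.holds_eq {s : State} {a b : ℕ} :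
    (Cond.eq a b).holds s ↔ s.reg a = s.reg b := Iff.rfl
@[simp] theorem Cond.holds_ne {s : State} {a b : ℕ} :
    (Cond.ne a b).holds s ↔ s.reg a ≠ s.reg b := Iff.rfl
@[simp] theorem Cond.holds_lt {s : State} {a b : ℕ} :
    (Cond.lt a b).holds s ↔ s.reg a < s.reg b := Iff.rfl
@[simp] theorem Cond.holds_le {s : State} {a b : ℕ} :
    (Cond.le a b).holds s ↔ s.reg a ≤ s.reg b := Iff.rfl

/-- The rules for the evaluation of register and array accesses. -/
theorem state_rules :
    (∀ s d v r, (State.setReg s d v).reg r = if r = d then v else s.reg r) ∧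
    (∀ s d v, (State.setReg s d v).mem = s.mem) ∧
    (∀ s a i v, (State.setMem s a i v).reg = s.reg) ∧
    (∀ s a i v b, (State.setMem s a i v).mem b =
      if b = a then Function.update (s.mem a) i v else s.mem b) ∧
    (∀ s a b, (Cond.eq a b).holds s ↔ s.reg a = s.reg b) ∧
    (∀ s a b, (Cond.ne a b).holds s ↔ s.reg a ≠ s.reg b) ∧
    (∀ s a b, (Cond.lt a b).holds s ↔ s.reg a < s.reg b) ∧
    (∀ s a b, (Cond.le a b).holds s ↔ s.reg a ≤ s.reg b) :=
  ⟨State.reg_setReg, State.mem_setReg, State.reg_setMem, State.mem_setMem, fun _ _ _ => Iff.rfl,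
    fun _ _ _ => Iff.rfl, fun _ _ _ => Iff.rfl, fun _ _ _ => Iff.rfl⟩

/-- The rules of symbolic execution, as one rewriting rule. -/
theorem exec_rules :
    (∀ (s : State) (Q : ℕ → State → Prop) (c₁ c₂ : Cmd), Runs w T cap (.seq c₁ c₂) s Q ↔
      Runs w T cap c₁ s fun t₁ s₁ => Runs w T cap c₂ s₁ fun t₂ s₂ => Q (t₁ + t₂) s₂) ∧
    (∀ (s : State) (Q : ℕ → State → Prop) (b : Cond) (c₁ c₂ : Cmd),
      Runs w T cap (.ite b c₁ c₂) s Q ↔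
      (b.holds s → Runs w T cap c₁ s fun t s' => Q (t + 1) s') ∧
        (¬ b.holds s → Runs w T cap c₂ s fun t s' => Q (t + 1) s')) ∧
    (∀ (s : State) (Q : ℕ → State → Prop), Runs w T cap .skip s Q ↔ Q 1 s) ∧
    (∀ (s : State) (Q : ℕ → State → Prop) (d k : ℕ),
      Runs w T cap (.const d k) s Q ↔ Q 1 (s.setReg d (k % 2 ^ w))) ∧
    (∀ (s : State) (Q : ℕ → State → Prop) (d a : ℕ),
      Runs w T cap (.move d a) s Q ↔ Q 1 (s.setReg d (s.reg a))) ∧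
    (∀ (s : State) (Q : ℕ → State → Prop) (d a b : ℕ),
      Runs w T cap (.op .add d a b) s Q ↔ Q 1 (s.setReg d ((s.reg a + s.reg b) % 2 ^ w))) ∧
    (∀ (s : State) (Q : ℕ → State → Prop) (d a b : ℕ), Runs w T cap (.op .sub d a b) s Q ↔
      Q 1 (s.setReg d ((s.reg a + 2 ^ w - s.reg b) % 2 ^ w))) ∧
    (∀ (s : State) (Q : ℕ → State → Prop) (d a b : ℕ),
      Runs w T cap (.op .and d a b) s Q ↔ Q 1 (s.setReg d (s.reg a &&& s.reg b))) ∧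
    (∀ (s : State) (Q : ℕ → State → Prop) (d a b : ℕ),
      Runs w T cap (.op .shr d a b) s Q ↔ Q 1 (s.setReg d (s.reg a >>> s.reg b))) ∧
    (∀ (s : State) (Q : ℕ → State → Prop) (d a i : ℕ), Runs w T cap (.load d a i) s Q ↔
      s.reg i < cap ∧ Q 1 (s.setReg d (s.mem a (s.reg i)))) ∧
    (∀ (s : State) (Q : ℕ → State → Prop) (a i d : ℕ), Runs w T cap (.store a i d) s Q ↔
      s.reg i < cap ∧ Q 1 (s.setMem a (s.reg i) (s.reg d))) :=
  ⟨fun _ _ _ _ => runs_seq, fun _ _ _ _ _ => runs_ite, fun _ _ => runs_skip,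
    fun _ _ _ _ => runs_const, fun _ _ _ _ => runs_move, fun _ _ _ _ _ => runs_add,
    fun _ _ _ _ _ => runs_sub, fun _ _ _ _ _ => runs_and, fun _ _ _ _ _ => runs_shr,
    fun _ _ _ _ _ => runs_load, fun _ _ _ _ _ => runs_store⟩

/-- Loops, with an invariant that is indexed by a bound for the remaining running time. -/
theorem runs_while {b : Cond} {c : Cmd} {Q : State → Prop} (I : ℕ → State → Prop) {p : ℕ}
    {s₀ : State} (h₀ : I p s₀)
    (hstep : ∀ p s, Frame c s₀ s → I p s → b.holds s →
      Runs w T cap c s fun t s' => ∃ p', t + 1 + p' ≤ p ∧ I p' s')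
    (hend : ∀ p s, Frame c s₀ s → I p s → ¬ b.holds s → 1 ≤ p ∧ Q s) :
    Runs w T cap (.while b c) s₀ fun t s' => t ≤ p ∧ Q s' := by
  have key : ∀ p s, Frame c s₀ s → I p s →
      Runs w T cap (.while b c) s fun t s' => t ≤ p ∧ Q s' := by
    intro p
    -- The bound for the remaining time also serves as termination measure: each iteration lowers it
    -- by at least one.
    induction p using Nat.strong_induction_on with
    | _ p ih =>
      intro s hf hI
      by_cases hb : b.holds s
      · obtain ⟨t, s', hx, p', hp, hI'⟩ := hstep p s hf hI hb
        obtain ⟨t', s'', hx', ht', hq⟩ := ih p' (by omega) s' (hf.trans hx.frame) hI'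
        exact ⟨_, _, .while_true hb hx hx', by omega, hq⟩
      · obtain ⟨hp, hq⟩ := hend p s hf hI hb
        exact ⟨_, _, .while_false hb, hp, hq⟩
  exact key p s₀ (Frame.refl _ _) h₀

theorem sub_mod_two_pow {x y : ℕ} (h : y ≤ x) (hx : x < 2 ^ w) :
    (x + 2 ^ w - y) % 2 ^ w = x - y := by
  rw [show x + 2 ^ w - y = x - y + 2 ^ w by omega, Nat.add_mod_right, Nat.mod_eq_of_lt (by omega)]

/-- `for i := 0` up to (excluding) register `0` `do body`; register `1` holds `1`. -/
def forRange (i : ℕ) (body : Cmd) : Cmd :=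
  .const i 0 ;; .while (.lt i 0) (body ;; .op .add i i 1)

/-- An iteration costs `K` for the body, one for the test and one for the increment; initialization
and the last test cost `2`. The invariant refers to the state in which the counter already has its
new value, so that bodies are specified without the increment. -/
theorem runs_forRange {i n K : ℕ} {body : Cmd} {s₀ : State} (I : ℕ → State → Prop)
    (hn : s₀.reg 0 = n) (h1 : s₀.reg 1 = 1) (hw : n < 2 ^ w)
    (hr0 : body.writesReg 0 = false) (hr1 : body.writesReg 1 = false)
    (hri : body.writesReg i = false) (hi0 : i ≠ 0) (hi1 : i ≠ 1)
    (h₀ : I 0 (s₀.setReg i 0))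
    (hstep : ∀ k s, k < n → s.reg 0 = n → s.reg 1 = 1 → s.reg i = k →
      Frame (forRange i body) s₀ s → I k s →
      Runs w T cap body s fun t s' => t ≤ K ∧ I (k + 1) (s'.setReg i (k + 1))) :
    Runs w T cap (forRange i body) s₀ fun t s' => t ≤ n * (K + 2) + 2 ∧ I n s' := by
  have f0 : (Cmd.writesReg 0 (body ;; .op .add i i 1)) = false := by
    simp [Cmd.writesReg, hr0, hi0]
  have f1 : (Cmd.writesReg 1 (body ;; .op .add i i 1)) = false := by
    simp [Cmd.writesReg, hr1, hi1]
  simp only [forRange, runs_seq, runs_const, Nat.zero_mod]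
  refine Runs.mono (runs_while (Q := I n)
    (fun p s => ∃ k, k ≤ n ∧ p = (n - k) * (K + 2) + 1 ∧ s.reg i = k ∧ I k s)
    (p := n * (K + 2) + 1) ⟨0, by simp, by simp, by simp, h₀⟩ ?_ ?_) ?_
  · rintro p s hf ⟨k, hk, rfl, hik, hI⟩ hb
    have e0 : s.reg 0 = n := by
      rw [hf.reg 0 f0]; simp [hn, hi0.symm]
    have e1 : s.reg 1 = 1 := by
      rw [hf.reg 1 f1]; simp [h1, hi1.symm]
    simp only [Cond.holds_lt, e0, hik] at hb
    rw [runs_seq]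
    refine Runs.mono (hstep k s hb e0 e1 hik ?_ hI) ?_
    · constructor
      · intro r hr
        simp only [forRange, Cmd.writesReg, Bool.or_eq_false_iff] at hr
        rw [hf.reg r (by simp [Cmd.writesReg, hr])]
        have : r ≠ i := by rintro rfl; simp at hr
        simp [this]
      · intro r hr
        simp only [forRange, Cmd.writesArr, Bool.or_eq_false_iff] at hr
        rw [hf.mem r (by simp [Cmd.writesArr, hr])]
        simp
    · rintro t s' hf' ⟨ht, hI'⟩
      have g1 : s'.reg 1 = 1 := by rw [hf'.reg 1 hr1, e1]
      have gi : s'.reg i = k := by rw [hf'.reg i hri, hik]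
      rw [runs_add, g1, gi, Nat.mod_eq_of_lt (by omega)]
      refine ⟨(n - (k + 1)) * (K + 2) + 1, ?_, k + 1, by omega, rfl, by simp, hI'⟩
      have : n - k = (n - (k + 1)) + 1 := by omega
      rw [this]
      ring_nf
      omega
  · rintro p s hf ⟨k, hk, rfl, hik, hI⟩ hb
    have e0 : s.reg 0 = n := by
      rw [hf.reg 0 f0]; simp [hn, hi0.symm]
    simp only [Cond.holds_lt, e0, hik] at hb
    have : k = n := by omega
    subst this
    exact ⟨by omega, hI⟩
  · rintro t s' _ ⟨ht, h⟩
    exact ⟨by omega, h⟩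

end

/-! ### Sorted index sequences, ranks, bucket distribution -/

/-- `f 0, …, f (n - 1)` is a permutation of `0, …, n - 1` with non-decreasing keys. -/
structure SortedBy {κ : Type*} [LinearOrder κ] (key : ℕ → κ) (n : ℕ) (f : ℕ → ℕ) : Prop where
  lt : ∀ t < n, f t < n
  inj : ∀ t < n, ∀ u < n, f t = f u → t = u
  mono : ∀ t u, t ≤ u → u < n → key (f t) ≤ key (f u)

/-- The number of indices with a smaller key. -/
def rankOf {κ : Type*} [LinearOrder κ] (key : ℕ → κ) (n i : ℕ) : ℕ :=
  ((Finset.range n).filter fun j => key j < key i).card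

section

variable {κ κ' : Type*} [LinearOrder κ] [LinearOrder κ'] {key : ℕ → κ} {key' : ℕ → κ'} {n : ℕ}
  {f g : ℕ → ℕ}

theorem rankOf_lt_of_lt {i j : ℕ} (hi : i < n) (h : key i < key j) :
    rankOf key n i < rankOf key n j := by
  apply Finset.card_lt_card
  refine ⟨fun x hx => ?_, fun h' => ?_⟩
  · simp only [Finset.mem_filter] at hx ⊢
    exact ⟨hx.1, hx.2.trans h⟩
  · have := @h' i (by simp [hi, h])
    simp at this

/-- Ranks compress arbitrary keys to numbers below `n` and preserve equality, so equality of long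
keys can be tested on single words. -/
theorem rankOf_eq_iff {i j : ℕ} (hi : i < n) (hj : j < n) :
    rankOf key n i = rankOf key n j ↔ key i = key j := by
  constructor
  · intro h
    rcases lt_trichotomy (key i) (key j) with h' | h' | h'
    · exact absurd h (rankOf_lt_of_lt hi h').ne
    · exact h'
    · exact absurd h (rankOf_lt_of_lt hj h').ne'
  · intro h; simp [rankOf, h]

theorem rankOf_lt {i : ℕ} (hi : i < n) : rankOf key n i < n := by
  calc rankOf key n i < (Finset.range n).card := by
        apply Finset.card_lt_card
        refine ⟨Finset.filter_subset _ _, fun h => ?_⟩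
        have := @h i (by simpa using hi)
        simp at this
    _ = n := by simp

theorem SortedBy.surj (h : SortedBy key n f) {i : ℕ} (hi : i < n) : ∃ t < n, f t = i := by
  have : (Finset.range n).image f = Finset.range n := by
    apply Finset.eq_of_subset_of_card_le
    · intro x hx
      simp only [Finset.mem_image, Finset.mem_range] at hx ⊢
      obtain ⟨t, ht, rfl⟩ := hx
      exact h.lt t ht
    · rw [Finset.card_image_of_injOn]
      intro t ht u hu e
      exact h.inj t (by simpa using ht) u (by simpa using hu) e
  have hi' : i ∈ (Finset.range n).image f := by rw [this]; simpa using hi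
  simpa using hi'

theorem SortedBy.congr_fun (h : SortedBy key n f) (hg : ∀ t < n, g t = f t) :
    SortedBy key n g :=
  ⟨fun t ht => by rw [hg t ht]; exact h.lt t ht,
   fun t ht u hu e => h.inj t ht u hu (by rw [← hg t ht, ← hg u hu, e]),
   fun t u htu hu => by rw [hg t (by omega), hg u hu]; exact h.mono t u htu hu⟩

theorem SortedBy.of_key (h : SortedBy key n f)
    (hk : ∀ i < n, ∀ j < n, key i ≤ key j → key' i ≤ key' j) : SortedBy key' n f :=
  ⟨h.lt, h.inj, fun t u htu hu =>
    hk _ (h.lt t (by omega)) _ (h.lt u hu) (h.mono t u htu hu)⟩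

theorem SortedBy.rankOf_zero (h : SortedBy key n f) : rankOf key n (f 0) = 0 := by
  rw [rankOf, Finset.card_eq_zero, Finset.filter_eq_empty_iff]
  intro x hx
  obtain ⟨t, ht, rfl⟩ := h.surj (by simpa using hx)
  exact (h.mono 0 t (by omega) ht).not_gt

/-- Where the key jumps, the indices with a smaller key are exactly `f 0, …, f t`. A scan thus
obtains all ranks by remembering the position of the last jump. -/
theorem SortedBy.rankOf_succ (h : SortedBy key n f) {t : ℕ} (ht : t + 1 < n)
    (hne : key (f t) ≠ key (f (t + 1))) : rankOf key n (f (t + 1)) = t + 1 := by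
  have hlt : key (f t) < key (f (t + 1)) := (h.mono t (t + 1) (by omega) ht).lt_of_ne hne
  have : ((Finset.range n).filter fun j => key j < key (f (t + 1))) =
      (Finset.range (t + 1)).image f := by
    ext x
    simp only [Finset.mem_filter, Finset.mem_range, Finset.mem_image]
    constructor
    · rintro ⟨hx, hx'⟩
      obtain ⟨u, hu, rfl⟩ := h.surj hx
      refine ⟨u, ?_, rfl⟩
      by_contra hc
      exact absurd hx' (h.mono (t + 1) u (by omega) hu).not_gt
    · rintro ⟨u, hu, rfl⟩
      exact ⟨h.lt u (by omega), (h.mono u t (by omega) (by omega)).trans_lt hlt⟩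
  rw [rankOf, this, Finset.card_image_of_injOn, Finset.card_range]
  intro a ha b hb e
  simp only [Finset.coe_range, Set.mem_Iio] at ha hb
  exact h.inj a (by omega) b (by omega) e

/-- Together with `rankOf_scan_ne` this is one step of the scan. Both lemmas leave the comparison at
`t = 0` free, since keeping the initial `0` and taking the current position then agree. -/
theorem SortedBy.rankOf_scan_eq (h : SortedBy key n f) {t : ℕ} (ht : t < n)
    (he : t ≠ 0 → key (f (t - 1)) = key (f t)) :
    (if t = 0 then 0 else rankOf key n (f (t - 1))) = rankOf key n (f t) := by
  rcases t with _ | t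
  · simp [h.rankOf_zero]
  · simpa using (rankOf_eq_iff (h.lt _ (by omega)) (h.lt _ ht)).2 (he (by omega))

theorem SortedBy.rankOf_scan_ne (h : SortedBy key n f) {t : ℕ} (ht : t < n)
    (he : t ≠ 0 → key (f (t - 1)) ≠ key (f t)) : t = rankOf key n (f t) := by
  rcases t with _ | t
  · simp [h.rankOf_zero]
  · exact (h.rankOf_succ ht (he (by omega))).symm

/-! ### Stable bucket distribution. -/

/-- The cell into which the `t`-th element of `l` goes when `l` is distributed into buckets; the
bucket of `x` begins at `b x`. -/
def slot (b : ℕ → ℕ) (l : List ℕ) (t : ℕ) : ℕ :=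
  b (l.getD t 0) + (l.take t).countP fun y => b y = b (l.getD t 0)

/-- The state of the bucket distribution after the elements of `l` have been processed. -/
structure Dist (b : ℕ → ℕ) (n : ℕ) (l : List ℕ) (ptr tmp : ℕ → ℕ) : Prop where
  ptr : ∀ r < n, ptr r = r + l.countP fun y => b y = r
  tmp : ∀ t < l.length, tmp (slot b l t) = l.getD t 0

theorem slot_append {b : ℕ → ℕ} {l l' : List ℕ} {t : ℕ} (ht : t < l.length) :
    slot b (l ++ l') t = slot b l t := by
  unfold slot
  rw [List.getD_append _ _ _ _ ht, List.take_append_of_le_length ht.le]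

theorem slot_length {b : ℕ → ℕ} {l l' : List ℕ} {i : ℕ} :
    slot b (l ++ i :: l') l.length = b i + l.countP fun y => b y = b i := by
  unfold slot
  simp

/-- The smaller keys and the equal keys are disjoint sets of indices: a bucket that begins at the
rank has room for all its elements before the next bucket begins. -/
theorem rankOf_add_countP_le {l : List ℕ} (hl : l.Perm (List.range n)) (i : ℕ) :
    rankOf key n i + (l.countP fun y => key y = key i) ≤
      ((Finset.range n).filter fun j => key j ≤ key i).card := by
  have h1 : (l.countP fun y => key y = key i) =
      ((Finset.range n).filter fun j => key j = key i).card := by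
    rw [hl.countP_eq, List.countP_eq_length_filter]
    rfl
  rw [h1, rankOf, ← Finset.card_union_of_disjoint]
  · apply Finset.card_le_card
    intro x hx
    simp only [Finset.mem_union, Finset.mem_filter] at hx ⊢
    rcases hx with ⟨a, b⟩ | ⟨a, b⟩
    · exact ⟨a, b.le⟩
    · exact ⟨a, b.le⟩
  · rw [Finset.disjoint_filter]
    intro x _ h h'
    exact h.ne h'

section

variable {l : List ℕ} (hl : l.Perm (List.range n))
include hl

theorem getD_lt_of_perm_range {t : ℕ} (ht : t < n) : l.getD t 0 < n := by
  have : t < l.length := by rw [hl.length_eq]; simpa using ht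
  rw [List.getD_eq_getElem _ _ this]
  simpa using hl.mem_iff.1 (List.getElem_mem this)

theorem slot_lt_card {t : ℕ} (ht : t < n) :
    slot (rankOf key n) l t < ((Finset.range n).filter fun j => key j ≤ key (l.getD t 0)).card := by
  refine lt_of_lt_of_le ?_ (rankOf_add_countP_le hl _)
  unfold slot
  have ht' : t < l.length := by rw [hl.length_eq]; simpa using ht
  have hc : ((l.take t).countP fun y => rankOf key n y = rankOf key n (l.getD t 0)) =
      (l.take t).countP fun y => key y = key (l.getD t 0) := by
    apply List.countP_congr
    intro x hx
    have : x < n := by simpa using hl.mem_iff.1 (List.mem_of_mem_take hx)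
    simp only [decide_eq_true_eq]
    exact rankOf_eq_iff this (getD_lt_of_perm_range hl ht)
  rw [hc]
  have : (l.take (t + 1)).countP (fun y => key y = key (l.getD t 0)) ≤
      l.countP fun y => key y = key (l.getD t 0) := (List.take_sublist _ _).countP_le
  rw [List.take_add_one, List.countP_append] at this
  rw [List.getElem?_eq_getElem ht'] at this
  simp only [Option.toList_some, List.getD_eq_getElem _ _ ht', List.countP_singleton,
    decide_true, if_true] at this ⊢
  omega

/-- Different buckets are disjoint intervals in the order of the keys, and inside a bucket the cells
are assigned in order of arrival. This gives both injectivity and stability. -/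
theorem slot_lt_slot {t u : ℕ} (ht : t < n)
    (h : key (l.getD t 0) < key (l.getD u 0) ∨ key (l.getD t 0) = key (l.getD u 0) ∧ t < u) :
    slot (rankOf key n) l t < slot (rankOf key n) l u := by
  rcases h with h | ⟨h, htu⟩
  · refine (slot_lt_card hl ht).trans_le (le_trans ?_ (Nat.le_add_right _ _))
    exact Finset.card_le_card fun x hx => by
      simp only [Finset.mem_filter] at hx ⊢
      exact ⟨hx.1, hx.2.trans_lt h⟩
  · unfold slot
    have e : rankOf key n (l.getD t 0) = rankOf key n (l.getD u 0) := by simp only [rankOf, h]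
    rw [e]
    have ht' : t < l.length := by rw [hl.length_eq]; simpa using ht
    have h1 : (l.take (t + 1)).countP
          (fun y => rankOf key n y = rankOf key n (l.getD u 0)) ≤
        (l.take u).countP fun y => rankOf key n y = rankOf key n (l.getD u 0) :=
      (List.take_sublist_take_left (by omega)).countP_le
    rw [List.take_add_one, List.countP_append, List.getElem?_eq_getElem ht'] at h1
    rw [List.getD_eq_getElem _ _ ht'] at e
    simp only [Option.toList_some, List.countP_singleton, e, decide_true, if_true] at h1
    omega

theorem slot_inj {t u : ℕ} (ht : t < n) (hu : u < n)
    (h : slot (rankOf key n) l t = slot (rankOf key n) l u) : t = u := by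
  rcases lt_trichotomy (key (l.getD t 0)) (key (l.getD u 0)) with h' | h' | h'
  · exact absurd h (slot_lt_slot hl ht (.inl h')).ne
  · rcases lt_trichotomy t u with h'' | h'' | h''
    · exact absurd h (slot_lt_slot hl ht (.inr ⟨h', h''⟩)).ne
    · exact h''
    · exact absurd h (slot_lt_slot hl hu (.inr ⟨h'.symm, h''⟩)).ne'
  · exact absurd h (slot_lt_slot hl hu (.inl h')).ne'

theorem slot_lt {t : ℕ} (ht : t < n) : slot (rankOf key n) l t < n := by
  refine (slot_lt_card hl ht).trans_le ?_
  refine (Finset.card_le_card (Finset.filter_subset _ _)).trans ?_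
  simp

end

theorem Dist.nil {b : ℕ → ℕ} {ptr tmp : ℕ → ℕ} (h : ∀ r < n, ptr r = r) :
    Dist b n [] ptr tmp :=
  ⟨fun r hr => by simp [h r hr], fun t ht => by simp at ht⟩

/-- The pointer of the bucket equals the slot of the new element within the complete sequence `l ++
i :: l'`. Injectivity of slots over that sequence shows that no earlier element is overwritten. -/
theorem Dist.push {l l' : List ℕ} {i : ℕ} {ptr tmp : ℕ → ℕ}
    (h : Dist (rankOf key n) n l ptr tmp) (hl : (l ++ i :: l').Perm (List.range n)) :
    ptr (rankOf key n i) < n ∧ Dist (rankOf key n) n (l ++ [i])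
      (Function.update ptr (rankOf key n i) (ptr (rankOf key n i) + 1))
      (Function.update tmp (ptr (rankOf key n i)) i) := by
  have hlen : l.length < n := by
    have := hl.length_eq
    simp at this; omega
  have hi : i < n := by simpa using hl.mem_iff.1 (by simp)
  have hp : ptr (rankOf key n i) = slot (rankOf key n) (l ++ i :: l') l.length := by
    rw [slot_length, h.ptr _ (rankOf_lt hi)]
  refine ⟨by rw [hp]; exact slot_lt hl hlen, ?_, ?_⟩
  · intro r hr
    rw [Function.update_apply]
    split_ifs with e
    · subst e
      rw [h.ptr _ hr, List.countP_append]
      simp; omega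
    · rw [h.ptr _ hr, List.countP_append]
      simp [Ne.symm e]
  · intro t ht
    simp only [List.length_append, List.length_singleton] at ht
    have e1 : slot (rankOf key n) (l ++ [i]) t = slot (rankOf key n) (l ++ i :: l') t := by
      rw [show l ++ i :: l' = (l ++ [i]) ++ l' by simp,
        slot_append (l' := l') (by simpa using ht)]
    rw [hp, e1]
    by_cases e : t = l.length
    · subst e; simp
    · have ht' : t < l.length := by omega
      rw [Function.update_of_ne, slot_append ht', h.tmp t ht', List.getD_append _ _ _ _ ht']
      intro e'
      exact e (slot_inj hl (by omega) hlen e')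

/-- The distribution of a sequence into buckets is a stable sort. -/
theorem Dist.sortedBy {l : List ℕ} {ptr tmp : ℕ → ℕ} (h : Dist (rankOf key n) n l ptr tmp)
    (hl : l.Perm (List.range n)) (hs : l.Pairwise fun i j => key' i ≤ key' j) :
    SortedBy (fun i => toLex (key i, key' i)) n tmp := by
  have hlen : l.length = n := by simpa using hl.length_eq
  -- An injective map of `n` cells into themselves is onto, so every cell of the result has been
  -- written.
  have hsurj : ∀ p < n, ∃ t < n, slot (rankOf key n) l t = p := by
    intro p hp
    have : (Finset.range n).image (slot (rankOf key n) l) = Finset.range n := by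
      apply Finset.eq_of_subset_of_card_le
      · intro x hx
        simp only [Finset.mem_image, Finset.mem_range] at hx ⊢
        obtain ⟨t, ht, rfl⟩ := hx
        exact slot_lt hl ht
      · rw [Finset.card_image_of_injOn]
        intro t ht u hu e
        exact slot_inj hl (by simpa using ht) (by simpa using hu) e
    have hi' : p ∈ (Finset.range n).image (slot (rankOf key n) l) := by rw [this]; simpa using hp
    simpa using hi'
  refine ⟨?_, ?_, ?_⟩
  · intro p hp
    obtain ⟨t, ht, rfl⟩ := hsurj p hp
    rw [h.tmp t (by omega)]
    exact getD_lt_of_perm_range hl ht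
  · intro p hp q hq e
    obtain ⟨t, ht, rfl⟩ := hsurj p hp
    obtain ⟨u, hu, rfl⟩ := hsurj q hq
    rw [h.tmp t (by omega), h.tmp u (by omega), List.getD_eq_getElem _ _ (by omega),
      List.getD_eq_getElem _ _ (by omega)] at e
    have hnd : l.Nodup := hl.nodup_iff.2 List.nodup_range
    rw [(hnd.getElem_inj_iff).1 e]
  · intro p q hpq hq
    obtain ⟨t, ht, rfl⟩ := hsurj p (by omega)
    obtain ⟨u, hu, rfl⟩ := hsurj q hq
    rw [h.tmp t (by omega), h.tmp u (by omega), Prod.Lex.toLex_le_toLex]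
    rcases lt_trichotomy (key (l.getD t 0)) (key (l.getD u 0)) with h' | h' | h'
    · exact .inl h'
    · refine .inr ⟨h', ?_⟩
      rcases lt_trichotomy t u with h'' | h'' | h''
      · simp only [List.getD_eq_getElem _ _ (show t < l.length by omega),
          List.getD_eq_getElem _ _ (show u < l.length by omega)]
        exact List.pairwise_iff_getElem.1 hs t u _ _ h''
      · rw [h'']
      · exact absurd hpq (slot_lt_slot hl hu (.inr ⟨h'.symm, h''⟩)).not_ge
    · exact absurd hpq (slot_lt_slot hl hu (.inl h')).not_ge

/-- The indices `i < n` in the order in which `i + k` occurs in `f`, those with `n ≤ i + k` first. -/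
def shiftOrder (n k m : ℕ) (f : ℕ → ℕ) : List ℕ :=
  List.range' (n - k) k ++ (((List.range m).map f).filter (k ≤ ·)).map (· - k)

theorem shiftOrder_zero {k : ℕ} : shiftOrder n k 0 f = List.range' (n - k) k := by
  simp [shiftOrder]

theorem shiftOrder_succ {k m : ℕ} : shiftOrder n k (m + 1) f =
    if k ≤ f m then shiftOrder n k m f ++ [f m - k] else shiftOrder n k m f := by
  unfold shiftOrder
  rw [List.range_succ, List.map_append, List.filter_append, List.map_append]
  split_ifs with h <;> simp [h]

theorem SortedBy.map_perm (h : SortedBy key n f) : ((List.range n).map f).Perm (List.range n) := by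
  rw [List.perm_ext_iff_of_nodup _ List.nodup_range]
  · intro a
    simp only [List.mem_map, List.mem_range]
    constructor
    · rintro ⟨t, ht, rfl⟩; exact h.lt t ht
    · intro ha; exact h.surj ha
  · refine List.Nodup.map_on ?_ List.nodup_range
    intro x hx y hy e
    exact h.inj x (by simpa using hx) y (by simpa using hy) e

theorem shiftOrder_perm (h : SortedBy key n f) {k : ℕ} (hk : k ≤ n) :
    (shiftOrder n k n f).Perm (List.range n) := by
  have h1 : (((List.range n).map f).filter (k ≤ ·)).Perm (List.range' k (n - k)) := by
    refine (h.map_perm.filter _).trans ?_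
    rw [List.perm_ext_iff_of_nodup (List.nodup_range.filter _) List.nodup_range']
    intro a
    simp only [List.mem_filter, List.mem_range, List.mem_range'_1, decide_eq_true_eq]
    omega
  have h2 : (List.range' k (n - k)).map (· - k) = List.range (n - k) := by
    rw [List.range'_eq_map_range, List.map_map]
    have : (fun x => x - k) ∘ (fun x => k + x) = id := by ext; simp
    rw [this, List.map_id]
  unfold shiftOrder
  refine (List.perm_append_comm).trans ?_
  refine ((h1.map _).append_right _).trans ?_
  rw [h2, List.range_eq_range', List.range_eq_range']
  have := @List.range'_append_1 0 (n - k) k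
  rw [Nat.zero_add] at this
  rw [this, Nat.sub_add_cancel hk]

/-- The indices shifted beyond the end have a minimal key, so they may come first and in any order;
the others inherit the order of `f`. -/
theorem shiftOrder_pairwise (h : SortedBy key n f) {k : ℕ} (hk : k ≤ n)
    (hbot : ∀ i, n ≤ i → ∀ j, key i ≤ key j) :
    (shiftOrder n k n f).Pairwise fun i j => key (i + k) ≤ key (j + k) := by
  unfold shiftOrder
  rw [List.pairwise_append]
  refine ⟨?_, ?_, ?_⟩
  · rw [List.pairwise_iff_forall_sublist]
    intro a b hab
    have : a ∈ List.range' (n - k) k := hab.subset (by simp)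
    rw [List.mem_range'_1] at this
    exact hbot _ (by omega) _
  · rw [List.pairwise_map, List.pairwise_filter, List.pairwise_map, List.pairwise_iff_getElem]
    intro i j hi hj hij h1 h2
    simp only [List.length_range] at hi hj
    simp only [List.getElem_range, decide_eq_true_eq] at h1 h2 ⊢
    rw [Nat.sub_add_cancel h1, Nat.sub_add_cancel h2]
    exact h.mono i j hij.le hj
  · intro a ha b _
    rw [List.mem_range'_1] at ha
    exact hbot _ (by omega) _

end

/-! ### Longest common prefixes and s-factors -/

theorem cons_le_cons_iff_lex {β : Type*} [LinearOrder β] {a b : β} {x y : List β} :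
    a :: x ≤ b :: y ↔ a < b ∨ a = b ∧ x ≤ y := by
  rw [le_iff_lt_or_eq, le_iff_lt_or_eq, List.cons_lt_cons_iff, List.cons.injEq]
  tauto

section

variable {α : Type u} [LinearOrder α]

/-- The length of the longest common prefix. -/
def lcp : List α → List α → ℕ
  | a :: x, b :: y => if a = b then lcp x y + 1 else 0
  | _, _ => 0

@[simp] theorem lcp_nil_left (x : List α) : lcp [] x = 0 := by cases x <;> rfl

@[simp] theorem lcp_nil_right (x : List α) : lcp x [] = 0 := by cases x <;> rfl

theorem lcp_cons (a b : α) (x y : List α) :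
    lcp (a :: x) (b :: y) = if a = b then lcp x y + 1 else 0 := rfl

theorem lcp_comm (x y : List α) : lcp x y = lcp y x := by
  induction x generalizing y with
  | nil => simp
  | cons a x ih =>
    cases y with
    | nil => simp
    | cons b y => simp only [lcp_cons, ih y, eq_comm (a := a)]

theorem lcp_le_left (x y : List α) : lcp x y ≤ x.length := by
  induction x generalizing y with
  | nil => simp
  | cons a x ih =>
    cases y with
    | nil => simp
    | cons b y =>
      rw [lcp_cons]
      split_ifs
      · simpa using ih y
      · simp

theorem prefix_iff_le_lcp {f v : List α} (hf : f <+: v) (x : List α) :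
    f <+: x ↔ f.length ≤ lcp v x := by
  induction f generalizing v x with
  | nil => simp
  | cons a f ih =>
    cases v with
    | nil => simp at hf
    | cons b v =>
      obtain ⟨rfl, hf'⟩ := List.cons_prefix_cons.1 hf
      cases x with
      | nil => simp
      | cons c x =>
        rw [List.cons_prefix_cons, lcp_cons]
        split_ifs with h
        · subst h
          simp [ih hf']
        · simp [h]

theorem lcp_append_left (l x y : List α) : lcp (l ++ x) (l ++ y) = l.length + lcp x y := by
  induction l with
  | nil => simp
  | cons a l ih => simp [lcp_cons, ih]; omega

theorem lcp_eq_zero_of_head {x y : List α} (h : x.head? ≠ y.head? ∨ y = []) : lcp x y = 0 := by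
  cases x with
  | nil => simp
  | cons a x =>
    cases y with
    | nil => simp
    | cons b y =>
      rw [lcp_cons, if_neg]
      rintro rfl
      simp at h

theorem lcp_replicate {a : α} {x y : List α} (hx : x.head? ≠ some a) (hy : y.head? ≠ some a)
    (p q : ℕ) : lcp (List.replicate p a ++ x) (List.replicate q a ++ y) =
      if p = q then p + lcp x y else min p q := by
  rcases lt_trichotomy p q with h | h | h
  · obtain ⟨d, rfl⟩ := Nat.exists_eq_add_of_lt h
    rw [show p + d + 1 = p + (d + 1) by omega, List.replicate_add, List.append_assoc,
      lcp_append_left, lcp_eq_zero_of_head]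
    · simp
    · left; simpa [List.replicate_succ] using hx
  · subst h; simp [lcp_append_left]
  · obtain ⟨d, rfl⟩ := Nat.exists_eq_add_of_lt h
    rw [show q + d + 1 = q + (d + 1) by omega, List.replicate_add, List.append_assoc,
      lcp_append_left, lcp_eq_zero_of_head]
    · simp
    · left; simpa [List.replicate_succ] using hy.symm

/-- Of two distinct occurrences in `u ++ f`, one must begin before `u` ends, for lack of room.
Conversely an occurrence in `u ++ v` beginning inside `u` ends within `u ++ f`. So overlaps need no
separate treatment: the suffixes of the whole string can be compared. -/
theorem occursTwice_append_iff {u v f : List α} (hf : f <+: v) :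
    OccursTwice f (u ++ f) ↔ ∃ q < u.length, f <+: (u ++ v).drop q := by
  have huf : u ++ f <+: u ++ v := (List.prefix_append_right_inj u).2 hf
  constructor
  · rintro ⟨p, q, hpq, ⟨l, r, hl, h⟩, ⟨l', r', hl', h'⟩⟩
    have key : ∀ l r : List α, l ++ f ++ r = u ++ f → l.length < u.length →
        ∃ q < u.length, f <+: (u ++ v).drop q := by
      intro l r h hlt
      refine ⟨l.length, hlt, ?_⟩
      obtain ⟨z, hz⟩ := huf
      rw [← hz, ← h]
      simp
    have e1 := congrArg List.length h
    have e2 := congrArg List.length h'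
    simp only [List.length_append] at e1 e2
    by_cases hlt : l.length < u.length
    · exact key l r h hlt
    · exact key l' r' h' (by omega)
  · rintro ⟨q, hq, hfq⟩
    refine ⟨q, u.length, hq.ne, ?_, u, [], rfl, by simp⟩
    have h1 : u.take q ++ f <+: u ++ v := by
      conv_rhs => rw [← List.take_append_drop q (u ++ v)]
      rw [List.take_append_of_le_length hq.le]
      exact (List.prefix_append_right_inj _).2 hfq
    obtain ⟨r, hr⟩ := List.prefix_of_prefix_length_le h1 huf (by simp)
    exact ⟨u.take q, r, by simpa using hq.le, hr⟩

/-- The length of an s-factor is the maximal length of a longest common prefix of the remaining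
string with an earlier suffix, or `1` if this maximum is `0`. -/
theorem isSFactor_take {u v : List α} {len m : ℕ} (hv : v ≠ []) (hlen : len = max m 1)
    (hle : ∀ q < u.length, lcp v ((u ++ v).drop q) ≤ m)
    (hm : m ≠ 0 → ∃ q < u.length, lcp v ((u ++ v).drop q) = m) :
    IsSFactor u v (v.take len) := by
  obtain ⟨c, v', rfl⟩ := List.exists_cons_of_ne_nil hv
  refine ⟨c, v', rfl, ?_⟩
  rcases Nat.eq_zero_or_pos m with rfl | hpos
  · left
    refine ⟨fun hc => ?_, by simp [hlen]⟩
    obtain ⟨q, hq, rfl⟩ := List.getElem_of_mem hc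
    have := hle q hq
    rw [List.drop_append_of_le_length hq.le, List.drop_eq_getElem_cons hq, List.cons_append,
      lcp_cons] at this
    simp at this
  · right
    have hlen' : len = m := by rw [hlen, max_eq_left hpos]
    subst hlen'
    obtain ⟨q, hq, hqm⟩ := hm (by omega)
    have hpre : (c :: v').take len <+: c :: v' := List.take_prefix _ _
    have hl : len ≤ (c :: v').length := hqm ▸ lcp_le_left _ _
    have hll : ((c :: v').take len).length = len := by simpa using hl
    refine ⟨?_, hpre, ?_, ?_⟩
    · have h1 : [c] <+: (u ++ c :: v').drop q :=
        (prefix_iff_le_lcp (v := c :: v') (by simp) _).2 (by rw [hqm]; exact hpos)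
      rw [List.drop_append_of_le_length hq.le, List.drop_eq_getElem_cons hq, List.cons_append] at h1
      have h1 := List.cons_prefix_cons.1 h1
      rw [h1.1]
      exact List.getElem_mem hq
    · rw [occursTwice_append_iff hpre]
      exact ⟨q, hq, (prefix_iff_le_lcp hpre _).2 (by rw [hqm, hll])⟩
    · intro g hg hg2
      rw [occursTwice_append_iff hg] at hg2
      obtain ⟨q', hq', hgq⟩ := hg2
      rw [hll]
      exact ((prefix_iff_le_lcp hg _).1 hgq).trans (hle q' hq')

/-! ### Run-length encodings -/

/-- The exponents are positive and adjacent runs have different characters. -/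
structure Normal (R : List (α × ℕ)) : Prop where
  pos : ∀ x ∈ R, 0 < x.2
  chain : R.IsChain fun x y => x.1 ≠ y.1

theorem val_nil : val ([] : List (α × ℕ)) = [] := rfl

theorem val_cons (x : α × ℕ) (R : List (α × ℕ)) :
    val (x :: R) = List.replicate x.2 x.1 ++ val R := by simp [val]

theorem val_append (R R' : List (α × ℕ)) : val (R ++ R') = val R ++ val R' := by simp [val]

/-- Two adjacent runs of one character would merge to a longer power, against maximality of the
first. -/
theorem IsRLE.normal {S : List α} {R : List (α × ℕ)} (h : IsRLE S R) : Normal R := by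
  constructor
  · intro x hx
    obtain ⟨i, hi, rfl⟩ := List.getElem_of_mem hx
    exact (h.2 i hi).1
  · rw [List.isChain_iff_getElem]
    intro i hi e
    have h1 := (h.2 i (by omega)).2 R[i].1 (R[i].2 + R[i + 1].2) (by
      rw [List.drop_eq_getElem_cons (show i < R.length by omega), val_cons,
        List.drop_eq_getElem_cons hi, val_cons, List.replicate_add, ← e, ← List.append_assoc]
      exact List.prefix_append _ _)
    have := (h.2 (i + 1) hi).1
    omega

theorem Normal.drop {R : List (α × ℕ)} (h : Normal R) (i : ℕ) : Normal (R.drop i) :=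
  ⟨fun x hx => h.pos x (List.mem_of_mem_drop hx), h.chain.drop i⟩

theorem Normal.tail {x : α × ℕ} {R : List (α × ℕ)} (h : Normal (x :: R)) : Normal R :=
  h.drop 1

theorem Normal.head_ne {x : α × ℕ} {R : List (α × ℕ)} (h : Normal (x :: R)) :
    (val R).head? ≠ some x.1 := by
  cases R with
  | nil => simp [val]
  | cons y R =>
    have h1 := (List.isChain_cons_cons.1 h.chain).1
    obtain ⟨k, hk⟩ := Nat.exists_eq_succ_of_ne_zero (h.pos y (by simp)).ne'
    simp [val_cons, hk, List.replicate_succ, Ne.symm h1]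

theorem lcp_runs {a b : α} {x y : List α} (hx : x.head? ≠ some a) (hy : y.head? ≠ some b)
    {p q : ℕ} (hp : 0 < p) (hq : 0 < q) :
    lcp (List.replicate p a ++ x) (List.replicate q b ++ y) =
      if a = b then if p = q then p + lcp x y else min p q else 0 := by
  split_ifs with h h'
  · subst h; rw [lcp_replicate hx hy, if_pos h']
  · subst h; rw [lcp_replicate hx hy, if_neg h']
  · apply lcp_eq_zero_of_head
    left
    obtain ⟨k, rfl⟩ := Nat.exists_eq_succ_of_ne_zero hp.ne'
    obtain ⟨l, rfl⟩ := Nat.exists_eq_succ_of_ne_zero hq.ne'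
    simpa [List.replicate_succ] using h

theorem lcp_val_cons {x y : α × ℕ} {X Y : List (α × ℕ)} (hX : Normal (x :: X))
    (hY : Normal (y :: Y)) : lcp (val (x :: X)) (val (y :: Y)) =
      if x.1 = y.1 then if x.2 = y.2 then x.2 + lcp (val X) (val Y) else min x.2 y.2 else 0 := by
  rw [val_cons, val_cons]
  exact lcp_runs hX.head_ne hY.head_ne (hX.pos _ (by simp)) (hY.pos _ (by simp))

/-- Longest common prefixes are monotone along the lexicographic order of the run-length
encodings. -/
theorem lcp_val_le_of_between {X Y Z : List (α × ℕ)} (hX : Normal X) (hY : Normal Y)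
    (hZ : Normal Z) (hXY : X.map toLex ≤ Y.map toLex) (hYZ : Y.map toLex ≤ Z.map toLex) :
    lcp (val X) (val Z) ≤ lcp (val X) (val Y) ∧ lcp (val X) (val Z) ≤ lcp (val Y) (val Z) := by
  induction X generalizing Y Z with
  | nil => simp [val_nil]
  | cons x X ih =>
    cases Z with
    | nil => simp [val_nil]
    | cons z Z =>
      cases Y with
      | nil =>
        rw [List.map_nil, List.map_cons] at hXY
        exact absurd hXY (not_le_of_gt (List.nil_lt_cons _ _))
      | cons y Y =>
        simp only [List.map_cons, cons_le_cons_iff_lex, Prod.Lex.toLex_lt_toLex] at hXY hYZ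
        rw [lcp_val_cons hX hZ, lcp_val_cons hX hY, lcp_val_cons hY hZ]
        by_cases hxz : x.1 = z.1
        · have hxy : x.1 ≤ y.1 := by
            rcases hXY with (h | h) | h
            · exact h.le
            · exact h.1.le
            · rw [show x = y from toLex.injective h.1]
          have hyz : y.1 ≤ z.1 := by
            rcases hYZ with (h | h) | h
            · exact h.le
            · exact h.1.le
            · rw [show y = z from toLex.injective h.1]
          have e1 : x.1 = y.1 := le_antisymm hxy (hxz ▸ hyz)
          have e2 : y.1 = z.1 := e1 ▸ hxz
          have h1 : x.2 < y.2 ∨ x.2 = y.2 ∧ X.map toLex ≤ Y.map toLex := by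
            rcases hXY with (h | h) | h
            · exact absurd h (e1 ▸ lt_irrefl _)
            · exact .inl h.2
            · exact .inr ⟨by rw [show x = y from toLex.injective h.1], h.2⟩
          have h2 : y.2 < z.2 ∨ y.2 = z.2 ∧ Y.map toLex ≤ Z.map toLex := by
            rcases hYZ with (h | h) | h
            · exact absurd h (e2 ▸ lt_irrefl _)
            · exact .inl h.2
            · exact .inr ⟨by rw [show y = z from toLex.injective h.1], h.2⟩
          rw [if_pos hxz, if_pos e1, if_pos e2]
          rcases h1 with h1 | ⟨h1, h1'⟩
          · rw [if_neg (show x.2 ≠ y.2 by omega)]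
            rcases h2 with h2 | ⟨h2, -⟩
            · rw [if_neg (show x.2 ≠ z.2 by omega), if_neg (show y.2 ≠ z.2 by omega)]
              omega
            · rw [if_neg (show x.2 ≠ z.2 by omega), if_pos h2]
              omega
          · rcases h2 with h2 | ⟨h2, h2'⟩
            · rw [if_neg (show x.2 ≠ z.2 by omega), if_neg (show y.2 ≠ z.2 by omega), if_pos h1]
              omega
            · rw [if_pos (show x.2 = z.2 by omega), if_pos h1, if_pos h2]
              have := ih hX.tail hY.tail hZ.tail h1' h2'
              omega
        · rw [if_neg hxz]
          simp

/-! ### Positions of the string relative to the runs. -/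

/-- The exponent of run `i`. -/
def ex (R : List (α × ℕ)) (i : ℕ) : ℕ := (R.map Prod.snd).getD i 0

/-- The character of run `i`. -/
def chr (R : List (α × ℕ)) (i : ℕ) : Option α := (R.map Prod.fst)[i]?

/-- The beginning of run `i`. -/
def bnd (R : List (α × ℕ)) (i : ℕ) : ℕ := (val (R.take i)).length

/-- The length of the longest common prefix of the suffixes that begin with run `i` and run `j`. -/
def lce (R : List (α × ℕ)) (i j : ℕ) : ℕ := lcp (val (R.drop i)) (val (R.drop j))

variable {R : List (α × ℕ)} {i j e e' : ℕ}

theorem ex_eq (hi : i < R.length) : ex R i = R[i].2 := by simp [ex, hi]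

theorem ex_of_le (hi : R.length ≤ i) : ex R i = 0 := by simp [ex, hi]

theorem chr_eq (hi : i < R.length) : chr R i = some R[i].1 := by simp [chr, hi]

theorem Normal.ex_pos (h : Normal R) (hi : i < R.length) : 0 < ex R i := by
  rw [ex_eq hi]; exact h.pos _ (List.getElem_mem hi)

theorem bnd_zero : bnd R 0 = 0 := rfl

theorem bnd_succ (hi : i < R.length) : bnd R (i + 1) = bnd R i + ex R i := by
  rw [bnd, List.take_add_one, List.getElem?_eq_getElem hi, val_append, ex_eq hi]
  simp [bnd, val_cons, val_nil]

theorem bnd_length : bnd R R.length = (val R).length := by simp [bnd]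

theorem bnd_mono (hij : i ≤ j) (hj : j ≤ R.length) : bnd R i ≤ bnd R j := by
  induction j with
  | zero => rw [Nat.le_zero.1 hij]
  | succ j ih =>
    rcases Nat.lt_or_ge j i with h | h
    · rw [show i = j + 1 by omega]
    · rw [bnd_succ (by omega)]
      exact (ih h (by omega)).trans (by omega)

theorem Normal.le_bnd (h : Normal R) (hi : i ≤ R.length) : i ≤ bnd R i := by
  induction i with
  | zero => simp
  | succ i ih =>
    rw [bnd_succ (by omega)]
    have := h.ex_pos (show i < R.length by omega)
    have := ih (by omega)
    omega

/-- Counting backwards from the end of the run leaves a power of one character followed by an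
unmodified tail of the encoding. -/
theorem drop_bnd_sub (hi : i < R.length) (he : e ≤ ex R i) :
    (val R).drop (bnd R (i + 1) - e) = List.replicate e R[i].1 ++ val (R.drop (i + 1)) := by
  have h1 : val R = val (R.take i) ++ (List.replicate R[i].2 R[i].1 ++ val (R.drop (i + 1))) := by
    rw [← val_cons, ← List.drop_eq_getElem_cons hi, ← val_append, List.take_append_drop]
  rw [bnd_succ hi]
  rw [ex_eq hi] at he ⊢
  conv_lhs => rw [h1]
  rw [show bnd R i + R[i].2 - e = bnd R i + (R[i].2 - e) by omega, bnd, List.drop_length_add_append,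
    List.drop_append_of_le_length (by simp), List.drop_replicate]
  congr 2
  omega

/-- If `e ≠ e'`, then after `min e e'` characters one suffix continues with the character of the run
and the other does not. Only run-aligned positions can match across the end of the run. -/
theorem lcp_positions (h : Normal R) (hi : i < R.length) (hj : j < R.length) (he : 0 < e)
    (hei : e ≤ ex R i) (he' : 0 < e') (hej : e' ≤ ex R j) :
    lcp ((val R).drop (bnd R (i + 1) - e)) ((val R).drop (bnd R (j + 1) - e')) =
      if chr R i = chr R j then if e = e' then e + lce R (i + 1) (j + 1) else min e e' else 0 := by
  rw [drop_bnd_sub hi hei, drop_bnd_sub hj hej, chr_eq hi, chr_eq hj]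
  simp only [Option.some.injEq]
  have hd : ∀ (i : ℕ) (hi : i < R.length), (val (R.drop (i + 1))).head? ≠ some R[i].1 := by
    intro i hi
    have := h.drop i
    rw [List.drop_eq_getElem_cons hi] at this
    exact this.head_ne
  exact lcp_runs (hd i hi) (hd j hj) he he'

theorem exists_run_of_lt {m q : ℕ} (hm : m ≤ R.length) (hq : q < bnd R m) :
    ∃ j < m, ∃ e, 0 < e ∧ e ≤ ex R j ∧ q = bnd R (j + 1) - e := by
  induction m with
  | zero => simp [bnd_zero] at hq
  | succ m ih =>
    rcases Nat.lt_or_ge q (bnd R m) with h | h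
    · obtain ⟨j, hj, r⟩ := ih (by omega) h
      exact ⟨j, by omega, r⟩
    · rw [bnd_succ (by omega)] at hq
      refine ⟨m, by omega, bnd R m + ex R m - q, by omega, by omega, ?_⟩
      rw [bnd_succ (by omega)]
      omega

/-- `len` is the length of the s-factor that begins `e` positions before the end of run `i`. -/
def FactorLen (R : List (α × ℕ)) (i e len : ℕ) : Prop :=
  (∃ j < i, chr R j = chr R i ∧ e ≤ ex R j ∧ len = e + lce R (i + 1) (j + 1) ∧
      ∀ j' < i, chr R j' = chr R i → e ≤ ex R j' → lce R (i + 1) (j' + 1) ≤ lce R (i + 1) (j + 1)) ∨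
  ((∀ j < i, chr R j = chr R i → ex R j < e) ∧
    (e < ex R i ∧ len = e ∨ e = ex R i ∧
      ((∃ j < i, chr R j = chr R i ∧ ex R j = len ∧ ∀ j' < i, chr R j' = chr R i → ex R j' ≤ len) ∨
        (∀ j < i, chr R j ≠ chr R i) ∧ len = 1)))

/-- Each case of `FactorLen` exhibits the maximum `m` of the match lengths over all earlier
positions. With a candidate, misaligned positions contribute at most `e` and cannot win; without
one, every match is of the form `min e e'` or `0`. -/
theorem FactorLen.isSFactor {len : ℕ} (hR : Normal R) (hi : i < R.length) (he : 0 < e)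
    (hei : e ≤ ex R i) (h : FactorLen R i e len) :
    IsSFactor ((val R).take (bnd R (i + 1) - e)) ((val R).drop (bnd R (i + 1) - e))
        (((val R).drop (bnd R (i + 1) - e)).take len) ∧
      0 < len ∧ bnd R (i + 1) - e + len ≤ (val R).length := by
  set P := bnd R (i + 1) - e with hP
  have hb : bnd R (i + 1) ≤ (val R).length := by
    rw [← bnd_length]; exact bnd_mono (by omega) le_rfl
  have hbs : bnd R (i + 1) = bnd R i + ex R i := bnd_succ hi
  have hlen : ((val R).take P).length = P := by rw [List.length_take]; omega
  have hne : (val R).drop P ≠ [] := by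
    rw [Ne, List.drop_eq_nil_iff]; omega
  have hlcp : ∀ j < R.length, ∀ e', 0 < e' → e' ≤ ex R j →
      lcp ((val R).drop P) ((val R).drop (bnd R (j + 1) - e')) =
      if chr R i = chr R j then if e = e' then e + lce R (i + 1) (j + 1) else min e e' else 0 :=
    fun j hj e' h1 h2 => lcp_positions hR hi hj he hei h1 h2
  -- An earlier position lies in an earlier run, or in run `i` itself with more characters ahead of
  -- it; the latter is the self-overlapping case.
  have hq : ∀ q < P, ∃ j < R.length, ∃ e', 0 < e' ∧ e' ≤ ex R j ∧ q = bnd R (j + 1) - e' ∧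
      (j < i ∨ j = i ∧ e < e') := by
    intro q hq
    obtain ⟨j, hj, e', h1, h2, h3⟩ := exists_run_of_lt (m := i + 1) (by omega)
      (show q < bnd R (i + 1) by omega)
    refine ⟨j, by omega, e', h1, h2, h3, ?_⟩
    rcases Nat.lt_or_ge j i with h | h
    · exact .inl h
    · obtain rfl : j = i := by omega
      exact .inr ⟨rfl, by omega⟩
  have hjP : ∀ j < i, ∀ e', 0 < e' → bnd R (j + 1) - e' < P := by
    intro j hj e' h1
    have := bnd_mono (R := R) (show j + 1 ≤ i by omega) (by omega)
    have := bnd_succ (R := R) (show j < R.length by omega)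
    have := hR.ex_pos (show j < R.length by omega)
    omega
  suffices H : ∃ m, len = max m 1 ∧
      (∀ q < P, lcp ((val R).drop P) ((val R).drop q) ≤ m) ∧
      (m ≠ 0 → ∃ q < P, lcp ((val R).drop P) ((val R).drop q) = m) by
    obtain ⟨m, h1, h2, h3⟩ := H
    refine ⟨isSFactor_take (m := m) hne h1 ?_ ?_, by omega, ?_⟩
    · rwa [hlen, List.take_append_drop]
    · rwa [hlen, List.take_append_drop]
    · by_cases hm : m = 0
      · omega
      · obtain ⟨q, _, hq'⟩ := h3 hm
        have := lcp_le_left ((val R).drop P) ((val R).drop q)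
        rw [List.length_drop] at this
        omega
  rcases h with ⟨j, hj, hc, hej, rfl, hmax⟩ | ⟨hno, ⟨hlt, rfl⟩ | ⟨rfl, ⟨j, hj, hc, rfl, hmax⟩ | ⟨hnc, rfl⟩⟩⟩
  · refine ⟨e + lce R (i + 1) (j + 1), by omega, ?_, fun _ => ?_⟩
    · intro q hq'
      obtain ⟨j', hj', e', h1, h2, rfl, h3⟩ := hq q hq'
      rw [hlcp j' hj' e' h1 h2]
      split_ifs with h4 h5
      · have := hmax j' (by omega) h4.symm (by omega)
        omega
      · omega
      · omega
    · refine ⟨_, hjP j hj e he, ?_⟩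
      rw [hlcp j (by omega) e he hej, if_pos hc.symm, if_pos rfl]
  · refine ⟨len, by omega, ?_, fun _ => ?_⟩
    · intro q hq'
      obtain ⟨j', hj', e', h1, h2, rfl, h3⟩ := hq q hq'
      rw [hlcp j' hj' e' h1 h2]
      split_ifs with h4 h5
      · rcases h3 with h3 | h3
        · have := hno j' h3 h4.symm
          omega
        · omega
      · omega
      · omega
    -- The witness is the beginning of the same run, which matches `min e (ex R i) = e` characters.
    · refine ⟨bnd R (i + 1) - ex R i, by omega, ?_⟩
      rw [hlcp i hi (ex R i) (by omega) le_rfl, if_pos rfl, if_neg (by omega)]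
      omega
  · have hpos := hR.ex_pos (show j < R.length by omega)
    refine ⟨ex R j, by omega, ?_, fun _ => ?_⟩
    · intro q hq'
      obtain ⟨j', hj', e', h1, h2, rfl, h3⟩ := hq q hq'
      rw [hlcp j' hj' e' h1 h2]
      have hj'i : j' < i := by
        rcases h3 with h3 | ⟨rfl, h3⟩
        · exact h3
        · omega
      split_ifs with h4 h5
      · have := hno j' hj'i h4.symm
        omega
      · have := hmax j' hj'i h4.symm
        omega
      · omega
    · refine ⟨_, hjP j hj (ex R j) hpos, ?_⟩
      have := hno j hj hc
      rw [hlcp j (by omega) (ex R j) hpos le_rfl, if_pos hc.symm, if_neg (by omega)]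
      omega
  · refine ⟨0, by omega, ?_, fun h => absurd rfl h⟩
    intro q hq'
    obtain ⟨j', hj', e', h1, h2, rfl, h3⟩ := hq q hq'
    rw [hlcp j' hj' e' h1 h2, if_neg]
    have hj'i : j' < i := by
      rcases h3 with h3 | ⟨rfl, h3⟩
      · exact h3
      · omega
    exact fun h => hnc j' hj'i h.symm

end

/-! ### Sorting the runs -/

/-- The values `f a, …, f (b - 1)`. -/
def seg (f : ℕ → ℕ) (a b : ℕ) : List ℕ := (List.range' a (b - a)).map f

theorem seg_self (f : ℕ → ℕ) (a : ℕ) : seg f a a = [] := by simp [seg]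

theorem seg_cons (f : ℕ → ℕ) {a b : ℕ} (h : a < b) : seg f a b = f a :: seg f (a + 1) b := by
  unfold seg
  rw [show b - a = (b - (a + 1)) + 1 by omega, List.range'_succ, List.map_cons]

theorem seg_append (f : ℕ → ℕ) {a b c : ℕ} (h : a ≤ b) (h' : b ≤ c) :
    seg f a c = seg f a b ++ seg f b c := by
  unfold seg
  rw [← List.map_append, show c - a = (b - a) + (c - b) by omega]
  conv_rhs => rw [show b = a + (b - a) by omega, Nat.add_sub_cancel_left]
  rw [show a + (b - a) = b by omega, ← List.range'_append_1, show a + (b - a) = b by omega]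

theorem seg_snoc (f : ℕ → ℕ) {a b : ℕ} (h : a ≤ b) : seg f a (b + 1) = seg f a b ++ [f b] := by
  rw [seg_append f h (Nat.le_succ b), seg_cons f (Nat.lt_succ_self b), seg_self]

theorem seg_congr {f g : ℕ → ℕ} {a b : ℕ} (h : ∀ t, a ≤ t → t < b → f t = g t) :
    seg f a b = seg g a b := by
  refine List.map_congr_left fun t ht => ?_
  rw [List.mem_range'_1] at ht
  exact h t ht.1 (by omega)

theorem pairwise_seg {r : ℕ → ℕ → Prop} {f : ℕ → ℕ} {a b : ℕ} :
    (seg f a b).Pairwise r ↔ ∀ t u, a ≤ t → t < u → u < b → r (f t) (f u) := by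
  rw [seg, List.pairwise_map, List.pairwise_iff_getElem]
  simp only [List.length_range', List.getElem_range', one_mul]
  constructor
  · intro h t u h1 h2 h3
    have := h (t - a) (u - a) (by omega) (by omega) (by omega)
    rwa [show a + (t - a) = t by omega, show a + (u - a) = u by omega] at this
  · intro h i j hi hj hij
    exact h _ _ (by omega) (by omega) (by omega)

section

variable {α : Type u} [LinearOrder α] {w cap : ℕ}

/-- The suffix of the run-length encoding that begins with run `i`. -/
def sfx (R : List (α × ℕ)) (i : ℕ) : List (α ×ₗ ℕ) := (R.map toLex).drop i

/-- Run `i`, as a sorting key. -/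
def runKey (R : List (α × ℕ)) (i : ℕ) : List (α ×ₗ ℕ) := (sfx R i).take 1

theorem runKey_eq {R : List (α × ℕ)} {i : ℕ} (hi : i < R.length) :
    runKey R i = [toLex R[i]] := by
  rw [runKey, sfx, List.drop_eq_getElem_cons (by simpa using hi)]
  simp

/-- The right-hand side has the form in which the machine decides it: at most two strict character
comparisons and one comparison of exponents. -/
theorem runKey_lt_iff {R : List (α × ℕ)} {i j : ℕ} (hi : i < R.length) (hj : j < R.length) :
    runKey R i < runKey R j ↔ R[i].1 < R[j].1 ∨ ¬ R[j].1 < R[i].1 ∧ ex R i < ex R j := by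
  rw [runKey_eq hi, runKey_eq hj, List.cons_lt_cons_iff, Prod.Lex.toLex_lt_toLex, ex_eq hi, ex_eq hj]
  rcases lt_trichotomy R[i].1 R[j].1 with h | h | h
  · simp [h]
  · simp [h]
  · simp [h, h.not_gt, h.ne']

/-- `reg 12 := 1` if the run in register `11` is smaller than the run in register `10`, else `0`. -/
def cmpCmd : Cmd :=
  .charLt 12 11 10 ;; .ite (.eq 12 1) .skip
    (.charLt 13 10 11 ;; .ite (.eq 13 1) .skip
      (.load 13 0 10 ;; .load 14 0 11 ;; .ite (.lt 14 13) (.const 12 1) .skip))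

variable {R : List (α × ℕ)}

theorem runs_cmpCmd {s : State} {x y : ℕ} (hx : s.reg 10 = x) (hy : s.reg 11 = y)
    (hxn : x < R.length) (hyn : y < R.length) (h1 : s.reg 1 = 1) (hw : 1 < 2 ^ w)
    (hE : s.mem 0 = ex R) (hcap : R.length ≤ cap) :
    Runs w (R.map Prod.fst) cap cmpCmd s fun t s' => t ≤ 12 ∧
      s'.reg 12 = if runKey R y < runKey R x then 1 else 0 := by
  subst hx hy
  unfold cmpCmd
  rw [runs_seq]
  apply runs_charLt (by simpa using hyn) (by simpa using hxn)
  rw [runs_ite]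
  simp only [List.getElem_map, Cond.holds_eq, State.reg_setReg, if_true, h1, runs_skip,
    runKey_lt_iff hyn hxn]
  constructor
  · intro h
    simp at h
    simp [h]
  · intro h
    simp at h
    rw [runs_seq]
    apply runs_charLt (by simpa using hxn) (by simpa using hyn)
    rw [runs_ite]
    constructor
    · intro h'
      simp [h1] at h'
      simp [h', h'.not_gt]
    · intro h'
      simp [h1] at h'
      have e := le_antisymm h h'
      simp [runs_ite, hE, hxn.trans_le hcap, hyn.trans_le hcap, e, Nat.mod_eq_of_lt hw]

/-- One step of the merging of `SA[i..m)` (registers `7`, `5`) and `SA[j..r)` (registers `8`, `6`)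
to `TMP[k..)` (register `9`). -/
def mergeChoose : Cmd :=
  .ite (.lt 8 6)
    (.ite (.lt 7 5) (.load 10 2 7 ;; .load 11 2 8 ;; cmpCmd) (.const 12 1))
    (.const 12 0)

def mergeStep : Cmd :=
  mergeChoose ;;
  .ite (.eq 12 1) (.load 10 2 8 ;; .store 3 9 10 ;; .op .add 8 8 1)
    (.load 10 2 7 ;; .store 3 9 10 ;; .op .add 7 7 1) ;;
  .op .add 9 9 1

def mergeLoop : Cmd := .while (.lt 9 6) mergeStep

theorem runs_mergeChoose {s : State} {i j m r : ℕ} {f : ℕ → ℕ} (hi : s.reg 7 = i)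
    (hj : s.reg 8 = j) (hm : s.reg 5 = m) (hr : s.reg 6 = r) (h1 : s.reg 1 = 1) (hw : 1 < 2 ^ w)
    (hE : s.mem 0 = ex R) (hf : s.mem 2 = f) (hcap : R.length ≤ cap) (hmn : m ≤ R.length)
    (hrn : r ≤ R.length) (hlt : ∀ t < R.length, f t < R.length) :
    Runs w (R.map Prod.fst) cap mergeChoose s fun t s' => t ≤ 17 ∧
      s'.reg 12 = if j < r ∧ (i < m → runKey R (f j) < runKey R (f i)) then 1 else 0 := by
  unfold mergeChoose
  rw [runs_ite]
  simp only [Cond.holds_lt, hj, hr]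
  constructor
  · intro hjr
    rw [runs_ite]
    simp only [Cond.holds_lt, hi, hm]
    constructor
    · intro him
      simp only [runs_seq, runs_load, hi, State.reg_setReg, hf, State.mem_setReg]
      refine ⟨by omega, by simp [hj]; omega, ?_⟩
      refine (runs_cmpCmd (x := f i) (y := f j) (by simp) (by simp [hj]) (hlt _ (by omega))
        (hlt _ (by omega)) (by simp [h1]) hw (by simp [hE]) hcap).mono ?_
      rintro t s' _ ⟨ht, h⟩
      refine ⟨by omega, ?_⟩
      simp [h, hjr, him]
    · intro him
      simp [hjr, him, Nat.mod_eq_of_lt hw]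
  · intro hjr
    simp [hjr]

/-- The invariant says that the cells written so far, followed by the merge of the two remainders,
equal the merge of the whole blocks. Each step unfolds `List.merge` once. The write position is
always `i + j - m`, so two indices suffice. -/
theorem runs_mergeLoop {s : State} {b m r : ℕ} {f : ℕ → ℕ} (hi : s.reg 7 = b) (hk : s.reg 9 = b)
    (hj : s.reg 8 = m) (hm : s.reg 5 = m) (hr : s.reg 6 = r) (h1 : s.reg 1 = 1)
    (hw : R.length < 2 ^ w) (hE : s.mem 0 = ex R) (hf : s.mem 2 = f) (hcap : R.length ≤ cap)
    (hbm : b ≤ m) (hmr : m ≤ r) (hrn : r ≤ R.length) (hlt : ∀ t < R.length, f t < R.length) :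
    Runs w (R.map Prod.fst) cap mergeLoop s fun t s' => t ≤ (r - b) * 30 + 1 ∧
      (∀ t, t < b ∨ r ≤ t → s'.mem 3 t = s.mem 3 t) ∧
      seg (s'.mem 3) b r =
        (seg f b m).merge (seg f m r) fun x y => decide (runKey R x ≤ runKey R y) := by
  refine runs_while (fun p s' => ∃ i j, s'.reg 7 = i ∧ s'.reg 8 = j ∧ s'.reg 9 + m = i + j ∧
    b ≤ i ∧ i ≤ m ∧ m ≤ j ∧ j ≤ r ∧ p = (r - (i + j - m)) * 30 + 1 ∧
    (∀ t, t < b ∨ r ≤ t → s'.mem 3 t = s.mem 3 t) ∧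
    seg (s'.mem 3) b (i + j - m) ++ ((seg f i m).merge (seg f j r)
        fun x y => decide (runKey R x ≤ runKey R y)) =
      (seg f b m).merge (seg f m r) fun x y => decide (runKey R x ≤ runKey R y)) ?_ ?_ ?_
  · refine ⟨b, m, hi, hj, by omega, le_rfl, hbm, le_rfl, hmr, by simp, fun _ _ => rfl, ?_⟩
    simp [seg_self]
  · rintro p s' hF ⟨i, j, gi, gj, gk, h1', h2, h3, h4, rfl, hfr, hseg⟩ hb
    have g5 : s'.reg 5 = m := by rw [hF.reg 5 rfl, hm]
    have g6 : s'.reg 6 = r := by rw [hF.reg 6 rfl, hr]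
    have g1 : s'.reg 1 = 1 := by rw [hF.reg 1 rfl, h1]
    have m2 : s'.mem 2 = f := by rw [hF.mem 2 rfl, hf]
    have m0 : s'.mem 0 = ex R := by rw [hF.mem 0 rfl, hE]
    have g9 : s'.reg 9 = i + j - m := by omega
    simp only [Cond.holds_lt, g9, g6] at hb
    unfold mergeStep
    rw [runs_seq]
    refine (runs_mergeChoose gi gj g5 g6 g1 (by omega) m0 m2 hcap (by omega) hrn hlt).mono ?_
    rintro t s₂ hF2 ⟨ht, h12⟩
    have e1 : s₂.reg 1 = 1 := by rw [hF2.reg 1 rfl, g1]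
    have e7 : s₂.reg 7 = i := by rw [hF2.reg 7 rfl, gi]
    have e8 : s₂.reg 8 = j := by rw [hF2.reg 8 rfl, gj]
    have e9 : s₂.reg 9 = i + j - m := by rw [hF2.reg 9 rfl, g9]
    have n2 : s₂.mem 2 = f := by rw [hF2.mem 2 rfl, m2]
    have n3 : s₂.mem 3 = s'.mem 3 := by rw [hF2.mem 3 rfl]
    have hupd : ∀ v, seg (Function.update (s'.mem 3) (i + j - m) v) b (i + j - m + 1) =
        seg (s'.mem 3) b (i + j - m) ++ [v] := by
      intro v
      rw [seg_snoc _ (by omega), Function.update_self]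
      congr 1
      refine seg_congr fun t _ h => ?_
      rw [Function.update_of_ne (by omega)]
    have hfr' : ∀ v t, t < b ∨ r ≤ t →
        Function.update (s'.mem 3) (i + j - m) v t = s.mem 3 t := by
      intro v t h
      rw [Function.update_of_ne (by omega), hfr t h]
    simp only [runs_seq, runs_ite, Cond.holds_eq, h12, e1]
    constructor
    · intro hc
      have hc : j < r ∧ (i < m → runKey R (f j) < runKey R (f i)) := by
        by_contra h; simp [h] at hc
      have hj1 : (j + 1) % 2 ^ w = j + 1 := Nat.mod_eq_of_lt (by omega)
      have hk1 : (i + j - m + 1) % 2 ^ w = i + j - m + 1 := Nat.mod_eq_of_lt (by omega)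
      simp only [exec_rules, state_rules, Nat.zero_mod, Nat.reduceEqDiff, reduceIte, e1, e7, e8, e9, n2, n3,
        hj1, hk1]
      refine ⟨by omega, by omega, (r - (i + (j + 1) - m)) * 30 + 1, by omega, i, j + 1, rfl, rfl,
        by omega, by omega, by omega, by omega, by omega, rfl, fun t h => hfr' _ t h, ?_⟩
      rw [show i + (j + 1) - m = i + j - m + 1 by omega, hupd, ← hseg, List.append_assoc]
      congr 1
      rw [seg_cons f hc.1]
      rcases Nat.lt_or_ge i m with him | him
      · rw [seg_cons f him, List.cons_merge_cons, if_neg]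
        · rfl
        · simpa using hc.2 him
      · obtain rfl : i = m := by omega
        simp [seg_self]
    · intro hc
      have hc : ¬ (j < r ∧ (i < m → runKey R (f j) < runKey R (f i))) := by
        intro h; exact hc (if_pos h)
      have him : i < m := by
        by_contra h
        exact hc ⟨by omega, fun h' => absurd h' h⟩
      have hj1 : (i + 1) % 2 ^ w = i + 1 := Nat.mod_eq_of_lt (by omega)
      have hk1 : (i + j - m + 1) % 2 ^ w = i + j - m + 1 := Nat.mod_eq_of_lt (by omega)
      simp only [exec_rules, state_rules, Nat.zero_mod, Nat.reduceEqDiff, reduceIte, e1, e7, e8, e9, n2, n3,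
        hj1, hk1]
      refine ⟨by omega, by omega, (r - (i + 1 + j - m)) * 30 + 1, by omega, i + 1, j, rfl, rfl,
        by omega, by omega, by omega, by omega, by omega, rfl, fun t h => hfr' _ t h, ?_⟩
      rw [show i + 1 + j - m = i + j - m + 1 by omega, hupd, ← hseg, List.append_assoc]
      congr 1
      rw [seg_cons f him]
      rcases Nat.lt_or_ge j r with hjr | hjr
      · rw [seg_cons f hjr, List.cons_merge_cons, if_pos]
        · rfl
        · simp only [decide_eq_true_eq]
          by_contra h
          exact hc ⟨hjr, fun _ => not_le.1 h⟩
      · obtain rfl : j = r := by omega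
        simp [seg_self]
  · rintro p s' hF ⟨i, j, gi, gj, gk, h1', h2, h3, h4, rfl, hfr, hseg⟩ hb
    have g6 : s'.reg 6 = r := by rw [hF.reg 6 rfl, hr]
    simp only [Cond.holds_lt, g6] at hb
    obtain rfl : i = m := by omega
    obtain rfl : j = r := by omega
    refine ⟨by omega, hfr, ?_⟩
    rw [← hseg]
    simp [seg_self]

end

/-! ### Bottom-up merge sort by doubling the block length. -/

section

variable {α : Type u} [LinearOrder α] {w cap : ℕ} {T : List α} {R : List (α × ℕ)}

/-- `for h := 1, 2, 4, …` below register `0` `do body`, with `h` in register `3`; at the end, `h` is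
the value of register `0`. -/
def doubleLoop (body : Cmd) : Cmd :=
  .const 3 1 ;; .while (.lt 3 0)
    (body ;; .op .sub 10 0 3 ;; .ite (.lt 3 10) (.op .add 3 3 3) (.move 3 0))

/-- After `d` rounds `h = min (2 ^ d) n`, so a further round requires `2 ^ d < n` and hence `d ≤
log₂ n`. The program compares `h` with `n - h` instead of `2 h` with `n`, because `2 h` might not
fit into a word. -/
theorem runs_doubleLoop {n K : ℕ} {body : Cmd} {s₀ : State} (I : ℕ → (ℕ → ℕ → ℕ) → Prop)
    (hn : s₀.reg 0 = n) (hn1 : 1 ≤ n) (hw : n < 2 ^ w)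
    (hr0 : body.writesReg 0 = false) (hr3 : body.writesReg 3 = false) (h₀ : I 1 s₀.mem)
    (hstep : ∀ h s, 1 ≤ h → h < n → s.reg 3 = h → Frame (doubleLoop body) s₀ s → I h s.mem →
      Runs w T cap body s fun t s' => t ≤ K ∧
        ∀ h', h' = 2 * h ∨ h' = n ∧ n ≤ 2 * h → I h' s'.mem) :
    Runs w T cap (doubleLoop body) s₀ fun t s' =>
      t ≤ (Nat.log 2 n + 1) * (K + 4) + 2 ∧ I n s'.mem := by
  have hw1 : 1 < 2 ^ w := by omega
  simp only [doubleLoop, runs_seq, runs_const, Nat.mod_eq_of_lt hw1]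
  refine Runs.mono (runs_while (Q := fun s => I n s.mem)
    (fun p s => ∃ d h, p = (Nat.log 2 n + 1 - d) * (K + 4) + 1 ∧ d ≤ Nat.log 2 n + 1 ∧
      h = min (2 ^ d) n ∧ s.reg 3 = h ∧ I h s.mem)
    (p := (Nat.log 2 n + 1) * (K + 4) + 1)
    ⟨0, 1, by simp, by simp, by simp; omega, by simp, h₀⟩ ?_ ?_) ?_
  · rintro p s hf ⟨d, h, rfl, hd, hh, h3, hI⟩ hb
    have e0 : s.reg 0 = n := by
      rw [hf.reg 0 (by simp [Cmd.writesReg, hr0])]; simp [hn]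
    simp only [Cond.holds_lt, e0, h3] at hb
    have hdn : 2 ^ d < n := by
      by_contra hc
      rw [min_eq_right (by omega)] at hh
      omega
    have hhd : h = 2 ^ d := by rw [hh, min_eq_left hdn.le]
    have hdL : d ≤ Nat.log 2 n := Nat.le_log_of_pow_le (by norm_num) hdn.le
    have h1 : 1 ≤ h := hhd ▸ Nat.one_le_two_pow
    rw [runs_seq]
    refine (hstep h s h1 hb h3 ?_ hI).mono ?_
    · constructor
      · intro r hr
        simp only [doubleLoop, Cmd.writesReg, Bool.or_eq_false_iff] at hr
        rw [hf.reg r (by simp [Cmd.writesReg, hr])]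
        have : r ≠ 3 := by rintro rfl; simp at hr
        simp [this]
      · intro r hr
        simp only [doubleLoop, Cmd.writesArr, Bool.or_eq_false_iff] at hr
        rw [hf.mem r (by simp [Cmd.writesArr, hr])]
        simp
    · rintro t s' hf' ⟨ht, hI'⟩
      have g0 : s'.reg 0 = n := by rw [hf'.reg 0 hr0, e0]
      have g3 : s'.reg 3 = h := by rw [hf'.reg 3 hr3, h3]
      have hlog : Nat.log 2 n + 1 - d = (Nat.log 2 n + 1 - (d + 1)) + 1 := by omega
      have hmul : (Nat.log 2 n + 1 - d) * (K + 4) =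
          (Nat.log 2 n + 1 - (d + 1)) * (K + 4) + (K + 4) := by rw [hlog]; ring
      have hpow : 2 ^ (d + 1) = 2 * h := by rw [hhd]; ring
      simp only [exec_rules, state_rules, Nat.zero_mod, Nat.reduceEqDiff, reduceIte, g0, g3, sub_mod_two_pow hb.le hw]
      constructor
      · intro hlt
        rw [Nat.mod_eq_of_lt (by omega)]
        refine ⟨(Nat.log 2 n + 1 - (d + 1)) * (K + 4) + 1, by omega, d + 1, h + h, rfl, by omega, ?_,
          rfl, hI' _ (.inl (by ring))⟩
        rw [hpow, min_eq_left (by omega)]; ring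
      · intro hlt
        refine ⟨(Nat.log 2 n + 1 - (d + 1)) * (K + 4) + 1, by omega, d + 1, n, rfl, by omega, ?_,
          rfl, hI' _ (.inr ⟨rfl, by omega⟩)⟩
        rw [hpow, min_eq_right (by omega)]
  · rintro p s hf ⟨d, h, rfl, hd, hh, h3, hI⟩ hb
    have e0 : s.reg 0 = n := by
      rw [hf.reg 0 (by simp [Cmd.writesReg, hr0])]; simp [hn]
    simp only [Cond.holds_lt, e0, h3] at hb
    have : h = n := le_antisymm (hh ▸ min_le_right _ _) (by omega)
    subst this
    exact ⟨by omega, hI⟩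
  · rintro t s' _ ⟨ht, h⟩
    exact ⟨by omega, h⟩

/-- Copy the first cells (as many as register `0` says) of array `a` to array `b`. -/
def copyCmd (a b : ℕ) : Cmd := forRange 7 (.load 10 a 7 ;; .store b 7 10)

theorem runs_copyCmd {s : State} {n a b : ℕ} (hn : s.reg 0 = n) (h1 : s.reg 1 = 1)
    (hw : n < 2 ^ w) (hcap : n ≤ cap) (hab : a ≠ b) :
    Runs w T cap (copyCmd a b) s fun t s' => t ≤ n * 4 + 2 ∧
      ∀ t < n, s'.mem b t = s.mem a t := by
  refine (runs_forRange (K := 2) (fun k s' => ∀ t < k, s'.mem b t = s.mem a t) hn h1 hw rfl rfl rfl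
    (by decide) (by decide) (by simp) ?_).mono ?_
  · intro k s' hk _ _ h7 hf hI
    have ma : s'.mem a = s.mem a := hf.mem a (by simp [forRange, Cmd.writesArr, hab.symm])
    simp only [exec_rules, state_rules, Nat.zero_mod, Nat.reduceEqDiff, reduceIte, h7, ma]
    refine ⟨by omega, by omega, by omega, ?_⟩
    intro t ht
    rw [Function.update_apply]
    split_ifs with h
    · rw [h]
    · exact hI t (by omega)
  · rintro t s' _ ⟨ht, h⟩
    exact ⟨by omega, h⟩

/-- `f` is sorted on each block `[q h, (q + 1) h)`. -/
def BlockSorted {κ : Type*} [LinearOrder κ] (key : ℕ → κ) (n h : ℕ) (f : ℕ → ℕ) : Prop :=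
  ∀ t u, t ≤ u → u < n → t / h = u / h → key (f t) ≤ key (f u)

theorem sortedBy_of_perm {κ : Type*} [LinearOrder κ] {key : ℕ → κ} {n : ℕ} {f : ℕ → ℕ}
    (hp : (seg f 0 n).Perm (List.range n))
    (hm : ∀ t u, t ≤ u → u < n → key (f t) ≤ key (f u)) : SortedBy key n f := by
  refine ⟨fun t ht => ?_, fun t ht u hu e => ?_, hm⟩
  · have : f t ∈ seg f 0 n := List.mem_map.2 ⟨t, by simpa using ht, rfl⟩
    simpa using hp.mem_iff.1 this
  · have hnd : (seg f 0 n).Nodup := hp.nodup_iff.2 List.nodup_range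
    exact List.inj_on_of_nodup_map hnd (by simpa using ht) (by simpa using hu) e

theorem lt_of_seg_perm {n : ℕ} {f : ℕ → ℕ} (hp : (seg f 0 n).Perm (List.range n)) :
    ∀ t < n, f t < n := fun t ht => by
  have : f t ∈ seg f 0 n := List.mem_map.2 ⟨t, by simpa using ht, rfl⟩
  simpa using hp.mem_iff.1 this

/-- `reg d := min (reg a + reg 3) (reg 0)` -/
def minAdd (d a : ℕ) : Cmd :=
  .op .sub 10 0 a ;; .ite (.lt 3 10) (.op .add d a 3) (.move d 0)

/-- The sum is formed only after `h < n - x` has been checked, which rules out an overflow. -/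
theorem runs_minAdd {s : State} {Q : ℕ → State → Prop} {d a x h n : ℕ} (ha : s.reg a = x)
    (h3 : s.reg 3 = h) (h0 : s.reg 0 = n) (hw : n < 2 ^ w) (hxn : x ≤ n) (ha10 : a ≠ 10)
    (hQ : Q 3 ((s.setReg 10 (n - x)).setReg d (min (x + h) n))) :
    Runs w T cap (minAdd d a) s Q := by
  unfold minAdd
  simp only [exec_rules, state_rules, Nat.zero_mod, Nat.reduceEqDiff, reduceIte, ha, h3, h0, ha10, sub_mod_two_pow hxn hw]
  constructor
  · intro hlt
    rwa [Nat.mod_eq_of_lt (by omega), ← min_eq_left (show x + h ≤ n by omega)]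
  · intro hlt
    rwa [min_eq_right (by omega)] at hQ

/-- Registers `4`, `5`, `6` delimit the two blocks, `7` and `8` are the read heads and `9` is the
write head. Both ends are cut off at `n`, so the last blocks may be short or empty. -/
def mergeBlock : Cmd :=
  minAdd 5 4 ;; minAdd 6 5 ;; .move 7 4 ;; .move 8 5 ;; .move 9 4 ;; mergeLoop ;; .move 4 6

/-- Merge adjacent sorted blocks of length `h` (register `3`) of array `2` to array `3`. -/
def mergePass : Cmd := .const 4 0 ;; .while (.lt 4 0) mergeBlock

theorem div_eq_of_block {b h q t : ℕ} (hb : b = h * q) (h1 : b ≤ t) (h2 : t < b + h) : t / h = q := by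
  subst hb
  have hh : 0 < h := by omega
  rw [Nat.div_eq_iff hh]
  constructor
  · rw [mul_comm]; exact h1
  · rw [mul_comm]; omega

theorem runs_mergePass {s : State} {h : ℕ} {f : ℕ → ℕ} (h0 : s.reg 0 = R.length)
    (h1 : s.reg 1 = 1) (h3 : s.reg 3 = h) (hw : R.length < 2 ^ w) (hE : s.mem 0 = ex R)
    (hf : s.mem 2 = f) (hcap : R.length ≤ cap) (hh : 1 ≤ h)
    (hp : (seg f 0 R.length).Perm (List.range R.length))
    (hbs : BlockSorted (runKey R) R.length h f) :
    Runs w (R.map Prod.fst) cap mergePass s fun t s' => t ≤ R.length * 60 + 2 ∧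
      (seg (s'.mem 3) 0 R.length).Perm (List.range R.length) ∧
      BlockSorted (runKey R) R.length (2 * h) (s'.mem 3) := by
  have hlt := lt_of_seg_perm hp
  set n := R.length with hn
  unfold mergePass
  simp only [exec_rules, state_rules, Nat.zero_mod, Nat.reduceEqDiff, reduceIte, ]
  refine (runs_while (Q := fun s' => (seg (s'.mem 3) 0 n).Perm (List.range n) ∧
      BlockSorted (runKey R) n (2 * h) (s'.mem 3))
    (fun p s' => ∃ b, b ≤ n ∧ s'.reg 4 = b ∧ p = (n - b) * 60 + 1 ∧
      ((∃ q, b = 2 * h * q) ∨ b = n) ∧ (seg (s'.mem 3) 0 b).Perm (seg f 0 b) ∧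
      BlockSorted (runKey R) b (2 * h) (s'.mem 3)) (p := n * 60 + 1)
    ⟨0, by omega, by simp, by simp, .inl ⟨0, by simp⟩, by simp [seg_self], ?_⟩ ?_ ?_).mono ?_
  · intro t u _ hu; omega
  · rintro p s' hF ⟨b, hbn, h4, rfl, hq, hperm, hsort⟩ hb
    have g0 : s'.reg 0 = n := by rw [hF.reg 0 rfl]; simp [h0]
    have g1 : s'.reg 1 = 1 := by rw [hF.reg 1 rfl]; simp [h1]
    have g3 : s'.reg 3 = h := by rw [hF.reg 3 rfl]; simp [h3]
    have m0 : s'.mem 0 = ex R := by rw [hF.mem 0 rfl]; simp [hE]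
    have m2 : s'.mem 2 = f := by rw [hF.mem 2 rfl]; simp [hf]
    simp only [Cond.holds_lt, h4, g0] at hb
    obtain ⟨q, hq⟩ : ∃ q, b = 2 * h * q := hq.resolve_right (by omega)
    unfold mergeBlock
    rw [runs_seq]
    refine runs_minAdd h4 g3 g0 hw hbn (by decide) ?_
    rw [runs_seq]
    set m := min (b + h) n with hm
    refine runs_minAdd (x := m) (h := h) (n := n) (by simp) (by simp [g3]) (by simp [g0]) hw
      (min_le_right _ _) (by decide) ?_
    set r := min (m + h) n with hr
    have hr' : r = min (b + 2 * h) n := by omega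
    simp only [exec_rules, state_rules, Nat.zero_mod, Nat.reduceEqDiff, reduceIte, ]
    refine (runs_mergeLoop (R := R) (b := b) (m := m) (r := r) (f := f) (by simp [h4]) (by simp [h4])
      (by simp) (by simp) (by simp) (by simp [g1]) hw (by simp [m0]) (by simp [m2]) hcap
      (by omega) (by omega) (by omega) hlt).mono ?_
    rintro t s₂ hF2 ⟨ht, hout, hseg⟩
    have e6 : s₂.reg 6 = r := by rw [hF2.reg 6 rfl]; simp
    simp only [State.mem_setReg] at hout
    rw [e6]
    have hold : ∀ t < b, s₂.mem 3 t = s'.mem 3 t := fun t ht => hout t (.inl ht)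
    have hs1 : (seg f b m).Pairwise fun x y => decide (runKey R x ≤ runKey R y) = true := by
      rw [pairwise_seg]
      intro t u ht htu hu
      simp only [decide_eq_true_eq]
      have hbq : b = h * (2 * q) := by rw [hq]; ring
      refine hbs t u htu.le (by omega) ?_
      rw [div_eq_of_block hbq ht (by omega), div_eq_of_block hbq (by omega) (by omega)]
    have hs2 : (seg f m r).Pairwise fun x y => decide (runKey R x ≤ runKey R y) = true := by
      rw [pairwise_seg]
      intro t u ht htu hu
      simp only [decide_eq_true_eq]
      have hbq : b + h = h * (2 * q + 1) := by rw [hq]; ring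
      refine hbs t u htu.le (by omega) ?_
      rw [div_eq_of_block hbq (by omega) (by omega), div_eq_of_block hbq (by omega) (by omega)]
    have hs : (seg (s₂.mem 3) b r).Pairwise
        fun x y => decide (runKey R x ≤ runKey R y) = true := by
      rw [hseg]
      refine List.pairwise_merge ?_ ?_ _ _ hs1 hs2
      · intro x y z hxy hyz
        simp only [decide_eq_true_eq] at *
        exact hxy.trans hyz
      · intro x y
        simpa using le_total (runKey R x) (runKey R y)
    refine ⟨(n - r) * 60 + 1, by omega, r, by omega, rfl, rfl, ?_, ?_, ?_⟩
    · rcases le_total (b + 2 * h) n with h' | h'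
      · left
        refine ⟨q + 1, ?_⟩
        rw [hr', min_eq_left h', hq]; ring
      · right; omega
    · rw [seg_append _ (show 0 ≤ b by omega) (show b ≤ r by omega),
        seg_append f (show 0 ≤ b by omega) (show b ≤ r by omega), hseg]
      refine List.Perm.append ?_ ?_
      · rw [seg_congr fun t _ ht => hold t ht]; exact hperm
      · refine (List.merge_perm_append _).trans ?_
        rw [← seg_append f (by omega) (by omega)]
    · intro t u htu hu hdiv
      show runKey R (s₂.mem 3 t) ≤ runKey R (s₂.mem 3 u)
      rcases Nat.lt_or_ge u b with hub | hub
      · rw [hold t (by omega), hold u hub]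
        exact hsort t u htu hub hdiv
      · rcases Nat.lt_or_ge t b with htb | htb
        -- The part merged now begins at the multiple `b` of `2 h`, so `t < b ≤ u` lie in different
        -- blocks.
        · exfalso
          rw [div_eq_of_block hq hub (by omega), Nat.div_eq_iff (by omega)] at hdiv
          have : 2 * h * q = q * (2 * h) := by ring
          omega
        · rcases htu.eq_or_lt with rfl | htu
          · exact le_rfl
          · simpa using pairwise_seg.1 hs t u htb htu hu
  · rintro p s' hF ⟨b, hbn, h4, rfl, hq, hperm, hsort⟩ hb
    have g0 : s'.reg 0 = n := by rw [hF.reg 0 rfl]; simp [h0]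
    simp only [Cond.holds_lt, h4, g0] at hb
    obtain rfl : b = n := by omega
    exact ⟨by omega, hperm.trans hp, hsort⟩
  · rintro t s' _ ⟨ht, h⟩
    exact ⟨by omega, h⟩

/-- Sort the runs: afterwards, array `2` holds their indices in sorted order. -/
def sortCmd : Cmd :=
  forRange 7 (.store 2 7 7) ;; doubleLoop (mergePass ;; copyCmd 3 2)

theorem runs_sortCmd {s : State} (h0 : s.reg 0 = R.length)
    (h1 : s.reg 1 = 1) (hw : R.length < 2 ^ w) (hE : s.mem 0 = ex R)
    (hcap : R.length ≤ cap) (hn1 : 1 ≤ R.length) :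
    Runs w (R.map Prod.fst) cap sortCmd s fun t s' =>
      t ≤ R.length * 3 + 2 + ((Nat.log 2 R.length + 1) * (R.length * 64 + 8) + 2) ∧
      SortedBy (runKey R) R.length (s'.mem 2) := by
  set n := R.length with hn
  unfold sortCmd
  rw [runs_seq]
  refine (runs_forRange (K := 1) (fun k s' => ∀ t < k, s'.mem 2 t = t) h0 h1 hw rfl rfl rfl
    (by decide) (by decide) (by simp) ?_).mono ?_
  · intro k s' hk _ _ h7 hf hI
    simp only [exec_rules, state_rules, Nat.zero_mod, Nat.reduceEqDiff, reduceIte, h7]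
    refine ⟨by omega, by omega, ?_⟩
    intro t ht
    rw [Function.update_apply]
    split_ifs with h
    · rw [h]
    · exact hI t (by omega)
  rintro t s₁ hF ⟨ht, hid⟩
  have g0 : s₁.reg 0 = n := by rw [hF.reg 0 rfl, h0]
  have g1 : s₁.reg 1 = 1 := by rw [hF.reg 1 rfl, h1]
  have m0 : s₁.mem 0 = ex R := by rw [hF.mem 0 rfl, hE]
  refine (runs_doubleLoop (K := n * 64 + 4)
    (fun h M => (seg (M 2) 0 n).Perm (List.range n) ∧ BlockSorted (runKey R) n h (M 2))
    g0 hn1 hw rfl rfl ?_ ?_).mono ?_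
  · constructor
    · rw [seg_congr (g := id) fun t _ ht => hid t ht, seg, List.map_id, List.range_eq_range']
      simp
    · intro t u _ _ h
      simp only [Nat.div_one] at h
      rw [h]
  · rintro h s' hh1 hhn h3 hF' ⟨hp, hbs⟩
    have e0 : s'.reg 0 = n := by rw [hF'.reg 0 rfl, g0]
    have e1 : s'.reg 1 = 1 := by rw [hF'.reg 1 rfl, g1]
    have n0 : s'.mem 0 = ex R := by rw [hF'.mem 0 rfl, m0]
    rw [runs_seq]
    refine (runs_mergePass e0 e1 h3 hw n0 rfl hcap hh1 hp hbs).mono ?_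
    rintro t₁ s₂ hF2 ⟨ht1, hp2, hbs2⟩
    refine (runs_copyCmd (n := n) (by rw [hF2.reg 0 rfl, e0]) (by rw [hF2.reg 1 rfl, e1]) hw hcap
      (by decide)).mono ?_
    rintro t₂ s₃ _ ⟨ht2, hc⟩
    refine ⟨by omega, fun h' hh' => ⟨?_, ?_⟩⟩
    · rw [seg_congr fun t _ ht => hc t ht]; exact hp2
    · intro t u htu hu hdiv
      rw [hc t (by omega), hc u hu]
      refine hbs2 t u htu hu ?_
      -- If the block length is cut off at `n`, then `n` and `2 h` both describe one single block.
      rcases hh' with rfl | ⟨rfl, h2⟩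
      · exact hdiv
      · rw [Nat.div_eq_of_lt (by omega), Nat.div_eq_of_lt (by omega)]
  · rintro t' s' _ ⟨ht', hp, hbs⟩
    refine ⟨by rw [show n * 64 + 8 = n * 64 + 4 + 4 by ring]; omega, sortedBy_of_perm hp fun t u htu hu => hbs t u htu hu ?_⟩
    rw [Nat.div_eq_of_lt (by omega), Nat.div_eq_of_lt (by omega)]

end

/-! ### Sorting the suffixes of the run-length encoding -/

theorem list_nil_le {β : Type*} [LinearOrder β] (l : List β) : [] ≤ l :=
  le_of_not_gt (List.not_lt_nil l)

theorem range'_prefix (a : ℕ) {m n : ℕ} (h : m ≤ n) : List.range' a m <+: List.range' a n := by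
  obtain ⟨d, rfl⟩ := Nat.exists_eq_add_of_le h
  rw [← List.range'_append_1]
  exact List.prefix_append _ _

/-- The principle of prefix doubling: a strict difference among the first `k` entries decides, and a
tie passes the decision to the next `m` entries. -/
theorem take_add_le {β : Type*} [LinearOrder β] {k m : ℕ} {X Y : List β}
    (h : X.take k < Y.take k ∨ X.take k = Y.take k ∧ (X.drop k).take m ≤ (Y.drop k).take m) :
    X.take (k + m) ≤ Y.take (k + m) := by
  induction k generalizing X Y with
  | zero => simpa using h
  | succ k ih =>
    cases X with
    | nil => simpa using list_nil_le _
    | cons x X =>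
      cases Y with
      | nil => simp at h
      | cons y Y =>
        rw [show k + 1 + m = k + m + 1 by omega]
        simp only [List.take_succ_cons, List.drop_succ_cons, List.cons_lt_cons_iff, List.cons.injEq,
          cons_le_cons_iff_lex] at h ⊢
        rcases h with (h | ⟨h1, h2⟩) | ⟨⟨h1, h2⟩, h3⟩
        · exact .inl h
        · exact .inr ⟨h1, ih (.inl h2)⟩
        · exact .inr ⟨h1, ih (.inr ⟨h2, h3⟩)⟩

section

variable {α : Type u} [LinearOrder α] {w cap : ℕ} {T : List α} {R : List (α × ℕ)}

/-- The first `k` runs of a suffix, as a sorting key. -/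
def sfxKey (R : List (α × ℕ)) (k i : ℕ) : List (α ×ₗ ℕ) := (sfx R i).take k

/-- The character of run `i`, as a sorting key. -/
def charKey (R : List (α × ℕ)) (i : ℕ) : List α := ((R.map Prod.fst).drop i).take 1

theorem charKey_eq {i : ℕ} (hi : i < R.length) : charKey R i = [R[i].1] := by
  rw [charKey, List.drop_eq_getElem_cons (by simpa using hi)]
  simp

theorem charKey_eq_iff {i j : ℕ} (hi : i < R.length) (hj : j < R.length) :
    charKey R i = charKey R j ↔ chr R i = chr R j := by
  rw [charKey_eq hi, charKey_eq hj, chr_eq hi, chr_eq hj]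
  simp

/-- The character is the leading component of the key, so the sorted runs are also sorted by
character and one scan yields both kinds of ranks. -/
theorem charKey_le_of_runKey_le {i j : ℕ} (hi : i < R.length) (hj : j < R.length)
    (h : runKey R i ≤ runKey R j) : charKey R i ≤ charKey R j := by
  rw [charKey_eq hi, charKey_eq hj, cons_le_cons_iff_lex]
  rw [runKey_eq hi, runKey_eq hj, cons_le_cons_iff_lex, Prod.Lex.toLex_lt_toLex] at h
  rcases h with (h | h) | h
  · exact .inl h
  · exact .inr ⟨h.1, le_rfl⟩
  · have := toLex.injective h.1
    exact .inr ⟨by rw [this], le_rfl⟩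

theorem sfx_length (i : ℕ) : (sfx R i).length = R.length - i := by simp [sfx]

theorem sfx_drop (i k : ℕ) : (sfx R i).drop k = sfx R (i + k) := by simp [sfx]

theorem sfxKey_of_le {i k : ℕ} (h : R.length ≤ i + k) : sfxKey R k i = sfx R i :=
  List.take_of_length_le (by rw [sfx_length]; omega)

theorem sfxKey_bot {i k : ℕ} (h : R.length ≤ i) (j : ℕ) : sfxKey R k i ≤ sfxKey R k j := by
  have : sfx R i = [] := List.eq_nil_of_length_eq_zero (by rw [sfx_length]; omega)
  rw [sfxKey, this]
  simpa using list_nil_le _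

theorem sfx_bot {i : ℕ} (h : R.length ≤ i) (j : ℕ) : sfx R i ≤ sfx R j := by
  have : sfx R i = [] := List.eq_nil_of_length_eq_zero (by rw [sfx_length]; omega)
  rw [this]
  exact list_nil_le _

theorem sfxKey_add (k m i : ℕ) : sfxKey R (k + m) i = sfxKey R k i ++ sfxKey R m (i + k) := by
  rw [sfxKey, List.take_add, sfx_drop, sfxKey, sfxKey]

theorem sfxKey_add_eq_iff {k i j : ℕ} :
    sfxKey R (k + k) i = sfxKey R (k + k) j ↔
      sfxKey R k i = sfxKey R k j ∧ sfxKey R k (i + k) = sfxKey R k (j + k) := by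
  constructor
  · intro h
    have h1 : sfxKey R k i = sfxKey R k j := by
      have := congrArg (List.take k) h
      simpa [sfxKey, List.take_take] using this
    rw [sfxKey_add, sfxKey_add, h1] at h
    exact ⟨h1, List.append_cancel_left h⟩
  · rintro ⟨h1, h2⟩
    rw [sfxKey_add, sfxKey_add, h1, h2]

/-- With at most `k` runs left, the key of `i` is its entire suffix, and its length tells it apart
from every other key. So `rerank` needs no rank for an index `i + k` beyond the end. -/
theorem sfxKey_ne {k i j : ℕ} (hij : i ≠ j) (hi : i < R.length) (hj : j < R.length)
    (h : R.length - k ≤ i) : sfxKey R (k + k) i ≠ sfxKey R (k + k) j := by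
  intro e
  have := congrArg List.length e
  simp only [sfxKey, List.length_take, sfx_length] at this
  omega

theorem sfxKey_add_le {k i j : ℕ}
    (h : toLex (sfxKey R k i, sfxKey R k (i + k)) ≤ toLex (sfxKey R k j, sfxKey R k (j + k))) :
    sfxKey R (k + k) i ≤ sfxKey R (k + k) j := by
  rw [Prod.Lex.toLex_le_toLex] at h
  unfold sfxKey at *
  rw [← sfx_drop, ← sfx_drop] at h
  exact take_add_le h

/-! ### Ranks and the rounds of prefix doubling. -/

/-- Scan the sorted runs: compute the ranks of the runs (array `4`) and of their characters
(array `5`). -/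
def rankScan : Cmd :=
  .const 15 0 ;; .const 16 0 ;; .const 18 0 ;; .load 17 2 18 ;; forRange 7
    (.load 11 2 7 ;; .charLt 12 17 11 ;;
    .ite (.eq 12 1) (.move 15 7 ;; .move 16 7)
      (.load 13 0 17 ;; .load 14 0 11 ;; .ite (.lt 13 14) (.move 15 7) .skip) ;;
    .store 4 11 15 ;; .store 5 11 16 ;; .move 17 11)

theorem runs_rankScan {s : State} {f : ℕ → ℕ} (h0 : s.reg 0 = R.length)
    (h1 : s.reg 1 = 1) (hw : R.length < 2 ^ w) (hE : s.mem 0 = ex R) (hf : s.mem 2 = f)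
    (hcap : R.length ≤ cap) (hn1 : 1 ≤ R.length) (hs : SortedBy (runKey R) R.length f) :
    Runs w (R.map Prod.fst) cap rankScan s fun t s' => t ≤ R.length * 14 + 6 ∧
      ∀ i < R.length, s'.mem 4 i = rankOf (runKey R) R.length i ∧
        s'.mem 5 i = rankOf (charKey R) R.length i := by
  have hc : SortedBy (charKey R) R.length f :=
    hs.of_key fun i hi j hj h => charKey_le_of_runKey_le hi hj h
  set n := R.length with hn
  unfold rankScan
  simp only [exec_rules, state_rules, Nat.zero_mod, Nat.reduceEqDiff, reduceIte, hf]
  refine ⟨by omega, ?_⟩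
  -- Register `17` holds the previous element. It is initialized with `f 0`, in accordance with the
  -- truncated `t - 1` at `t = 0`.
  refine (runs_forRange (K := 12) (n := n) (fun t s' => s'.reg 17 = f (t - 1) ∧
    s'.reg 15 = (if t = 0 then 0 else rankOf (runKey R) n (f (t - 1))) ∧
    s'.reg 16 = (if t = 0 then 0 else rankOf (charKey R) n (f (t - 1))) ∧
    ∀ u < t, s'.mem 4 (f u) = rankOf (runKey R) n (f u) ∧
      s'.mem 5 (f u) = rankOf (charKey R) n (f u)) (by simp [h0]) (by simp [h1]) hw rfl rfl rfl
    (by decide) (by decide) (by simp) ?_).mono ?_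
  · rintro k s' hk g0 g1 g7 hF ⟨h17, h15, h16, hI⟩
    have m2 : s'.mem 2 = f := by rw [hF.mem 2 rfl]; simp [hf]
    have m0 : s'.mem 0 = ex R := by rw [hF.mem 0 rfl]; simp [hE]
    have hx : f (k - 1) < n := hs.lt _ (by omega)
    have hy : f k < n := hs.lt _ hk
    simp only [exec_rules, state_rules, Nat.zero_mod, Nat.reduceEqDiff, reduceIte, g7, m2]
    refine ⟨by omega, ?_⟩
    apply runs_charLt (by simpa [h17] using hx) (by simpa using hy)
    have hle : runKey R (f (k - 1)) ≤ runKey R (f k) := hs.mono _ _ (by omega) hk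
    have key : ∀ r c : ℕ, r = rankOf (runKey R) n (f k) → c = rankOf (charKey R) n (f k) →
        ∀ u < k + 1, Function.update (s'.mem 4) (f k) r (f u) = rankOf (runKey R) n (f u) ∧
          Function.update (s'.mem 5) (f k) c (f u) = rankOf (charKey R) n (f u) := by
      intro r c hr hc' u hu
      by_cases huk : u = k
      · subst huk; simp [hr, hc']
      · have : f u ≠ f k := fun e => huk (hs.inj u (by omega) k hk e)
        rw [Function.update_of_ne this, Function.update_of_ne this]
        exact hI u (by omega)
    have hcR : charKey R (f (k - 1)) = charKey R (f k) ↔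
        R[f (k - 1)].1 = R[f k].1 := by rw [charKey_eq hx, charKey_eq hy]; simp
    -- The keys are already known to be in order, so excluding a strict increase of the exponent is
    -- enough for equality.
    have hrR : runKey R (f (k - 1)) = runKey R (f k) ↔
        R[f (k - 1)].1 = R[f k].1 ∧ ¬ ex R (f (k - 1)) < ex R (f k) := by
      rw [runKey_eq hx, runKey_eq hy, cons_le_cons_iff_lex, Prod.Lex.toLex_lt_toLex] at hle
      rw [runKey_eq hx, runKey_eq hy, ex_eq hx, ex_eq hy]
      simp only [List.cons.injEq, and_true, EmbeddingLike.apply_eq_iff_eq, Prod.ext_iff]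
      constructor
      · rintro ⟨a, b⟩; exact ⟨a, by omega⟩
      · rintro ⟨a, b⟩
        refine ⟨a, ?_⟩
        rcases hle with (h | h) | h
        · rw [a] at h; exact absurd h (lt_irrefl _)
        · omega
        · rw [toLex.injective h.1]
    simp only [exec_rules, state_rules, Nat.zero_mod, Nat.reduceEqDiff, reduceIte, g1, g7, h17, h15, h16, m0, m2, List.getElem_map, Nat.add_sub_cancel,
      Nat.add_eq_zero_iff, one_ne_zero, and_false]
    constructor
    · intro hlt
      have hlt : R[f (k - 1)].1 < R[f k].1 := by by_contra h; simp [h] at hlt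
      have e1 := hs.rankOf_scan_ne hk fun _ h => hlt.ne (hrR.1 h).1
      have e2 := hc.rankOf_scan_ne hk fun _ h => hlt.ne (hcR.1 h)
      exact ⟨by omega, by omega, by omega, trivial, e1, e2, key k k e1 e2⟩
    · intro hlt
      have hlt : ¬ R[f (k - 1)].1 < R[f k].1 := by intro h; simp [h] at hlt
      have e2 := hc.rankOf_scan_eq hk fun _ => by
        rw [charKey_eq hx, charKey_eq hy]
        have := charKey_le_of_runKey_le hx hy hle
        rw [charKey_eq hx, charKey_eq hy, cons_le_cons_iff_lex] at this
        rcases this with h | h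
        · exact absurd h hlt
        · rw [h.1]
      refine ⟨by omega, by omega, fun h => ?_, fun h => ?_⟩
      · have e1 := hs.rankOf_scan_ne hk fun _ h' => (hrR.1 h').2 h
        exact ⟨by omega, by omega, by omega, trivial, e1, e2, key _ _ e1 e2⟩
      · have e1 := hs.rankOf_scan_eq hk fun hk0 => hrR.2 ⟨hcR.1 ?_, h⟩
        · exact ⟨by omega, by omega, by omega, trivial, e1, e2, key _ _ e1 e2⟩
        · rw [if_neg hk0] at e2
          exact (rankOf_eq_iff hx hy).1 e2
  · rintro t s' _ ⟨ht, -, -, -, h⟩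
    refine ⟨by omega, fun i hi => ?_⟩
    obtain ⟨u, hu, rfl⟩ := hs.surj hi
    exact h u hu

/-- Process index `i` (register `11`) in the distribution into the buckets given by array `a`. -/
def pushCmd (a : ℕ) : Cmd :=
  .load 12 a 11 ;; .load 14 6 12 ;; .store 3 14 11 ;; .op .add 14 14 1 ;; .store 6 12 14

theorem runs_pushCmd {κ : Type*} [LinearOrder κ] {key : ℕ → κ} {s : State} {a n i : ℕ}
    {l G : List ℕ} (h1 : s.reg 1 = 1) (hi : s.reg 11 = i) (hw : n < 2 ^ w) (hcap : n ≤ cap)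
    (ha : ∀ i < n, s.mem a i = rankOf key n i) (hG : G.Perm (List.range n)) (hl : l ++ [i] <+: G)
    (hd : Dist (rankOf key n) n l (s.mem 6) (s.mem 3)) :
    Runs w T cap (pushCmd a) s fun t s' => t ≤ 5 ∧
      Dist (rankOf key n) n (l ++ [i]) (s'.mem 6) (s'.mem 3) := by
  obtain ⟨l', rfl⟩ := hl
  rw [List.append_assoc, List.singleton_append] at hG
  have hin : i < n := by simpa using hG.mem_iff.1 (by simp)
  obtain ⟨hp, hd'⟩ := hd.push hG
  have hr : rankOf key n i < n := rankOf_lt hin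
  unfold pushCmd
  simp only [exec_rules, state_rules, Nat.zero_mod, Nat.reduceEqDiff, reduceIte, h1, hi, ha i hin]
  rw [Nat.mod_eq_of_lt (by omega)]
  exact ⟨by omega, by omega, by omega, by omega, by omega, hd'⟩

/-- Distribute the indices `i`, ordered by the rank of `i + k` in array `2`, into the buckets given
by array `a`; `k` is in register `3`. -/
def distribute (a : ℕ) : Cmd :=
  forRange 7 (.store 6 7 7) ;; .op .sub 19 0 3 ;; .move 11 19 ;;
  .while (.lt 11 0) (pushCmd a ;; .op .add 11 11 1) ;;
  forRange 7 (.load 13 2 7 ;; .ite (.le 3 13) (.op .sub 11 13 3 ;; pushCmd a) .skip)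

/-- A radix step: the indices arrive sorted by the second key of their shift by `k`, and the stable
distribution sorts them by the first key. The two keys may differ, because the doubling rounds use
prefixes of suffixes for both, while the final order combines characters with whole suffixes. -/
theorem runs_distribute {κ κ' : Type*} [LinearOrder κ] [LinearOrder κ'] {key : ℕ → κ}
    {key' : ℕ → κ'} {s : State} {a n k : ℕ} {f : ℕ → ℕ} (h0 : s.reg 0 = n) (h1 : s.reg 1 = 1)
    (h3 : s.reg 3 = k) (hk : k ≤ n) (hw : n < 2 ^ w) (hcap : n ≤ cap) (ha3 : a ≠ 3) (ha6 : a ≠ 6)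
    (ha : ∀ i < n, s.mem a i = rankOf key n i) (hf : s.mem 2 = f) (hs : SortedBy key' n f)
    (hbot : ∀ i, n ≤ i → ∀ j, key' i ≤ key' j) :
    Runs w T cap (distribute a) s fun t s' => t ≤ n * 21 + 7 ∧
      SortedBy (fun i => toLex (key i, key' (i + k))) n (s'.mem 3) := by
  have hperm := shiftOrder_perm hs hk
  have hpair := shiftOrder_pairwise hs hk hbot
  -- Slots are defined relative to the complete sequence, so each intermediate stage must be
  -- recognized as a prefix of it.
  have hpre : ∀ m, m ≤ n → shiftOrder n k m f <+: shiftOrder n k n f := by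
    intro m hm
    unfold shiftOrder
    refine (List.prefix_append_right_inj _).2 (List.IsPrefix.map _ (List.IsPrefix.filter _ ?_))
    refine List.IsPrefix.map _ ?_
    obtain ⟨d, rfl⟩ := Nat.exists_eq_add_of_le hm
    rw [List.range_add]
    exact List.prefix_append _ _
  unfold distribute
  rw [runs_seq]
  refine (runs_forRange (K := 1) (fun k s' => ∀ t < k, s'.mem 6 t = t) h0 h1 hw rfl rfl rfl
    (by decide) (by decide) (by simp) ?_).mono ?_
  · intro k s' hk _ _ h7 hf hI
    simp only [exec_rules, state_rules, Nat.zero_mod, Nat.reduceEqDiff, reduceIte, h7]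
    refine ⟨by omega, by omega, ?_⟩
    intro t ht
    rw [Function.update_apply]
    split_ifs with h
    · rw [h]
    · exact hI t (by omega)
  rintro t₁ s₁ hF1 ⟨ht1, hptr⟩
  have e0 : s₁.reg 0 = n := by rw [hF1.reg 0 rfl, h0]
  have e1 : s₁.reg 1 = 1 := by rw [hF1.reg 1 rfl, h1]
  have e3 : s₁.reg 3 = k := by rw [hF1.reg 3 rfl, h3]
  have ea : s₁.mem a = s.mem a := hF1.mem a (by simp [forRange, Cmd.writesArr, ha6.symm])
  have e2 : s₁.mem 2 = f := by rw [hF1.mem 2 rfl, hf]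
  simp only [exec_rules, state_rules, Nat.zero_mod, Nat.reduceEqDiff, reduceIte, e0, e3, sub_mod_two_pow hk hw]
  refine (runs_while (Q := fun s' => Dist (rankOf key n) n (List.range' (n - k) k)
      (s'.mem 6) (s'.mem 3))
    (fun p s' => ∃ c, c ≤ k ∧ p = (k - c) * 7 + 1 ∧ s'.reg 11 = n - k + c ∧
      Dist (rankOf key n) n (List.range' (n - k) c) (s'.mem 6) (s'.mem 3)) (p := k * 7 + 1)
    ⟨0, by omega, by simp, by simp, by simpa using Dist.nil hptr⟩ ?_ ?_).mono ?_
  · rintro p s' hF ⟨c, hc, rfl, h11, hd⟩ hb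
    have g0 : s'.reg 0 = n := by rw [hF.reg 0 rfl]; simp [e0]
    have g1 : s'.reg 1 = 1 := by rw [hF.reg 1 rfl]; simp [e1]
    have ga : s'.mem a = s.mem a := by
      rw [hF.mem a (by simp [pushCmd, Cmd.writesArr, ha3.symm, ha6.symm])]; simp [ea]
    simp only [Cond.holds_lt, h11, g0] at hb
    have hr : List.range' (n - k) c ++ [n - k + c] = List.range' (n - k) (c + 1) := by
      rw [← List.range'_append_1]; simp
    rw [runs_seq]
    refine (runs_pushCmd (G := shiftOrder n k n f) g1 h11 hw hcap (by rw [ga]; exact ha) hperm ?_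
      hd).mono ?_
    · rw [hr]
      refine List.IsPrefix.trans ?_ (List.prefix_append _ _)
      exact range'_prefix _ (by omega)
    rintro t s₂ hF2 ⟨ht, hd2⟩
    have i11 : s₂.reg 11 = n - k + c := by rw [hF2.reg 11 rfl, h11]
    have i1 : s₂.reg 1 = 1 := by rw [hF2.reg 1 rfl, g1]
    simp only [exec_rules, state_rules, Nat.zero_mod, Nat.reduceEqDiff, reduceIte, i11, i1]
    rw [Nat.mod_eq_of_lt (by omega)]
    exact ⟨(k - (c + 1)) * 7 + 1, by omega, c + 1, by omega, rfl, by omega, hr ▸ hd2⟩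
  · rintro p s' hF ⟨c, hc, rfl, h11, hd⟩ hb
    have g0 : s'.reg 0 = n := by rw [hF.reg 0 rfl]; simp [e0]
    simp only [Cond.holds_lt, h11, g0] at hb
    obtain rfl : c = k := by omega
    exact ⟨by omega, hd⟩
  rintro t₂ s₂ hF2 ⟨ht2, hd2⟩
  have f0 : s₂.reg 0 = n := by rw [hF2.reg 0 rfl]; simp [e0]
  have f1 : s₂.reg 1 = 1 := by rw [hF2.reg 1 rfl]; simp [e1]
  have f3 : s₂.reg 3 = k := by rw [hF2.reg 3 rfl]; simp [e3]
  have fa : s₂.mem a = s.mem a := by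
    rw [hF2.mem a (by simp [pushCmd, Cmd.writesArr, ha3.symm, ha6.symm])]; simp [ea]
  have f2 : s₂.mem 2 = f := by rw [hF2.mem 2 rfl]; simp [e2]
  refine (runs_forRange (K := 9) (fun m s' => Dist (rankOf key n) n (shiftOrder n k m f)
    (s'.mem 6) (s'.mem 3)) f0 f1 hw rfl rfl rfl (by decide) (by decide)
    (by simpa [shiftOrder_zero] using hd2) ?_).mono ?_
  · intro m s' hm _ g1 g7 hF hd
    have g3 : s'.reg 3 = k := by rw [hF.reg 3 rfl, f3]
    have ga : s'.mem a = s.mem a := by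
      rw [hF.mem a (by simp [forRange, pushCmd, Cmd.writesArr, ha3.symm, ha6.symm]), fa]
    have g2 : s'.mem 2 = f := by rw [hF.mem 2 rfl, f2]
    have hfm := hs.lt m hm
    simp only [exec_rules, state_rules, Nat.zero_mod, Nat.reduceEqDiff, reduceIte, g7, g3, g2]
    refine ⟨by omega, fun hkm => ?_, fun hkm => ?_⟩
    · rw [sub_mod_two_pow hkm (by omega)]
      refine (runs_pushCmd (i := f m - k) (G := shiftOrder n k n f) (key := key) (n := n)
        (l := shiftOrder n k m f) (by simp [g1]) (by simp) hw hcap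
        (by simpa [ga] using ha) hperm ?_ (by simpa using hd)).mono ?_
      · have := hpre (m + 1) (by omega)
        rwa [shiftOrder_succ, if_pos hkm] at this
      · rintro t s₃ _ ⟨ht, hd3⟩
        refine ⟨by omega, ?_⟩
        rw [shiftOrder_succ, if_pos hkm]
        exact hd3
    · rw [shiftOrder_succ, if_neg hkm]
      exact ⟨by omega, hd⟩
  · rintro t₃ s₃ _ ⟨ht3, hd3⟩
    exact ⟨by omega, hd3.sortedBy hperm hpair⟩

/-- Scan the suffixes, sorted by their first `2 k` runs: compute their ranks (array `4`) from those
by the first `k` runs; `k` is in register `3`. -/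
def rerank : Cmd :=
  .const 15 0 ;; .const 18 0 ;; .load 17 2 18 ;; .op .sub 19 0 3 ;; forRange 7
    (.load 11 2 7 ;; .load 13 4 17 ;; .load 14 4 11 ;;
    .ite (.eq 13 14)
      (.ite (.lt 17 19)
        (.ite (.lt 11 19)
          (.op .add 13 17 3 ;; .op .add 14 11 3 ;; .load 13 4 13 ;; .load 14 4 14 ;;
            .ite (.eq 13 14) .skip (.move 15 7))
          (.move 15 7))
        (.move 15 7))
      (.move 15 7) ;;
    .store 7 11 15 ;; .move 17 11) ;;
  copyCmd 7 4

/-- Two neighbours have equal keys of length `2 k` iff two pairs of old ranks agree. The new ranks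
go to a separate array because the scan still reads the old ones. -/
theorem runs_rerank {s : State} {f : ℕ → ℕ} {k : ℕ} (h0 : s.reg 0 = R.length)
    (h1 : s.reg 1 = 1) (h3 : s.reg 3 = k) (hk1 : 1 ≤ k) (hk : k ≤ R.length)
    (hw : R.length < 2 ^ w) (hf : s.mem 2 = f) (hcap : R.length ≤ cap)
    (hr : ∀ i < R.length, s.mem 4 i = rankOf (sfxKey R k) R.length i)
    (hs : SortedBy (sfxKey R (k + k)) R.length f) :
    Runs w T cap rerank s fun t s' => t ≤ R.length * 20 + 8 ∧
      ∀ i < R.length, s'.mem 4 i = rankOf (sfxKey R (k + k)) R.length i := by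
  set n := R.length with hn
  unfold rerank
  simp only [exec_rules, state_rules, Nat.zero_mod, Nat.reduceEqDiff, reduceIte, hf, h0, h3, sub_mod_two_pow hk hw]
  refine ⟨by omega, ?_⟩
  refine (runs_forRange (K := 14) (n := n) (fun t s' => s'.reg 17 = f (t - 1) ∧
    s'.reg 15 = (if t = 0 then 0 else rankOf (sfxKey R (k + k)) n (f (t - 1))) ∧
    ∀ u < t, s'.mem 7 (f u) = rankOf (sfxKey R (k + k)) n (f u)) (by simp [h0]) (by simp [h1])
    hw rfl rfl rfl (by decide) (by decide) (by simp) ?_).mono ?_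
  · rintro t s' ht g0 g1 g7 hF ⟨h17, h15, hI⟩
    have m2 : s'.mem 2 = f := by rw [hF.mem 2 rfl]; simp [hf]
    have m4 : s'.mem 4 = s.mem 4 := by rw [hF.mem 4 rfl]; simp
    have g3 : s'.reg 3 = k := by rw [hF.reg 3 rfl]; simp [h3]
    have g19 : s'.reg 19 = n - k := by rw [hF.reg 19 rfl]; simp
    have hx : f (t - 1) < n := hs.lt _ (by omega)
    have hy : f t < n := hs.lt _ ht
    have hxy : t ≠ 0 → f (t - 1) ≠ f t := fun h e => by
      have := hs.inj _ (by omega) _ ht e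
      omega
    have key : ∀ r : ℕ, r = rankOf (sfxKey R (k + k)) n (f t) →
        ∀ u < t + 1, Function.update (s'.mem 7) (f t) r (f u) =
          rankOf (sfxKey R (k + k)) n (f u) := by
      intro r hr u hu
      by_cases hut : u = t
      · subst hut; simp [hr]
      · have : f u ≠ f t := fun e => hut (hs.inj u (by omega) t ht e)
        rw [Function.update_of_ne this]
        exact hI u (by omega)
    have hne : (t ≠ 0 → sfxKey R (k + k) (f (t - 1)) ≠ sfxKey R (k + k) (f t)) →
        t = rankOf (sfxKey R (k + k)) n (f t) := hs.rankOf_scan_ne ht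
    simp only [exec_rules, state_rules, Nat.zero_mod, Nat.reduceEqDiff, reduceIte, g1, g3, g7, g19, h17, h15, m2, m4, hr _ hx, hr _ hy, Nat.add_sub_cancel,
      Nat.add_eq_zero_iff, one_ne_zero, and_false]
    refine ⟨by omega, by omega, by omega, fun e1 => ⟨fun hxk => ⟨fun hyk => ?_, fun hyk => ?_⟩,
      fun hxk => ?_⟩, fun e1 => ?_⟩
    · rw [Nat.mod_eq_of_lt (show f (t - 1) + k < 2 ^ w by omega),
        Nat.mod_eq_of_lt (show f t + k < 2 ^ w by omega), hr _ (show f (t - 1) + k < n by omega),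
        hr _ (show f t + k < n by omega)]
      refine ⟨by omega, by omega, fun e2 => ?_, fun e2 => ?_⟩
      · have e := hs.rankOf_scan_eq ht fun _ => sfxKey_add_eq_iff.2
          ⟨(rankOf_eq_iff hx hy).1 e1, (rankOf_eq_iff (by omega) (by omega)).1 e2⟩
        exact ⟨by omega, by omega, trivial, e, key _ e⟩
      · have e := hne fun _ h =>
          e2 ((rankOf_eq_iff (by omega) (by omega)).2 (sfxKey_add_eq_iff.1 h).2)
        exact ⟨by omega, by omega, trivial, e, key _ e⟩
    · have e := hne fun h0 => (sfxKey_ne (hxy h0).symm hy hx (by omega)).symm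
      exact ⟨by omega, by omega, trivial, e, key _ e⟩
    · have e := hne fun h0 => sfxKey_ne (hxy h0) hx hy (by omega)
      exact ⟨by omega, by omega, trivial, e, key _ e⟩
    · have e := hne fun _ h => e1 ((rankOf_eq_iff hx hy).2 (sfxKey_add_eq_iff.1 h).1)
      exact ⟨by omega, by omega, trivial, e, key _ e⟩
  · rintro t₁ s₁ hF1 ⟨ht1, -, -, hI⟩
    refine (runs_copyCmd (n := n) (by rw [hF1.reg 0 rfl]; simp [h0])
      (by rw [hF1.reg 1 rfl]; simp [h1]) hw hcap (by decide)).mono ?_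
    rintro t₂ s₂ _ ⟨ht2, hc⟩
    refine ⟨by omega, fun i hi => ?_⟩
    rw [hc i hi]
    obtain ⟨u, hu, rfl⟩ := hs.surj hi
    exact hI u hu

/-- Sort the suffixes: array `3` receives the indices sorted by the character of the run and then by
the suffix that follows the run, array `8` the inverse permutation, and array `5` the ranks of the
characters. -/
def suffixSort : Cmd :=
  sortCmd ;; rankScan ;;
  doubleLoop (distribute 4 ;; copyCmd 3 2 ;; rerank) ;;
  .const 3 1 ;; distribute 5 ;; forRange 7 (.load 10 3 7 ;; .store 8 10 7)

/-- The last distribution uses the ranks of characters, not of runs: a match covers the last `e`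
characters of a run, so the full exponent of that run must not influence the order. -/
theorem runs_suffixSort {s : State} (h0 : s.reg 0 = R.length)
    (h1 : s.reg 1 = 1) (hw : R.length < 2 ^ w) (hE : s.mem 0 = ex R)
    (hcap : R.length ≤ cap) (hn1 : 1 ≤ R.length) :
    Runs w (R.map Prod.fst) cap suffixSort s fun t s' =>
      t ≤ (Nat.log 2 R.length + 1) * R.length * 300 ∧
      SortedBy (fun i => toLex (charKey R i, sfx R (i + 1))) R.length (s'.mem 3) ∧
      (∀ t < R.length, s'.mem 8 (s'.mem 3 t) = t) ∧
      ∀ i < R.length, s'.mem 5 i = rankOf (charKey R) R.length i := by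
  set n := R.length with hn
  unfold suffixSort
  rw [runs_seq]
  refine (runs_sortCmd h0 h1 hw hE hcap hn1).mono ?_
  rintro t₁ s₁ hF1 ⟨ht1, hs1⟩
  have e0 : s₁.reg 0 = n := by rw [hF1.reg 0 rfl, h0]
  have e1 : s₁.reg 1 = 1 := by rw [hF1.reg 1 rfl, h1]
  have eE : s₁.mem 0 = ex R := by rw [hF1.mem 0 rfl, hE]
  rw [runs_seq]
  refine (runs_rankScan e0 e1 hw eE rfl hcap hn1 hs1).mono ?_
  rintro t₂ s₂ hF2 ⟨ht2, hr2⟩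
  have f0 : s₂.reg 0 = n := by rw [hF2.reg 0 rfl, e0]
  have f1 : s₂.reg 1 = 1 := by rw [hF2.reg 1 rfl, e1]
  have f2 : s₂.mem 2 = s₁.mem 2 := hF2.mem 2 rfl
  rw [runs_seq]
  refine (runs_doubleLoop (K := n * 45 + 17)
    (fun h M => SortedBy (sfxKey R h) n (M 2) ∧ ∀ i < n, M 4 i = rankOf (sfxKey R h) n i)
    -- Merge sort supplies the case `h = 1`, since `runKey R` is `sfxKey R 1` by definition.
    f0 hn1 hw rfl rfl ⟨by rw [f2]; exact hs1, fun i hi => (hr2 i hi).1⟩ ?_).mono ?_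
  · rintro h s' hh1 hhn h3 hF' ⟨hs, hr⟩
    have g0 : s'.reg 0 = n := by rw [hF'.reg 0 rfl, f0]
    have g1 : s'.reg 1 = 1 := by rw [hF'.reg 1 rfl, f1]
    rw [runs_seq]
    refine (runs_distribute (key := sfxKey R h) g0 g1 h3 hhn.le hw hcap (by decide) (by decide) hr rfl
      hs fun i hi j => sfxKey_bot hi j).mono ?_
    rintro u₁ v₁ hG1 ⟨hu1, hv1⟩
    have hv1 : SortedBy (sfxKey R (h + h)) n (v₁.mem 3) :=
      hv1.of_key fun i _ j _ hij => sfxKey_add_le hij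
    have a0 : v₁.reg 0 = n := by rw [hG1.reg 0 rfl, g0]
    have a1 : v₁.reg 1 = 1 := by rw [hG1.reg 1 rfl, g1]
    rw [runs_seq]
    refine (runs_copyCmd a0 a1 hw hcap (by decide)).mono ?_
    rintro u₂ v₂ hG2 ⟨hu2, hv2⟩
    have hs2 : SortedBy (sfxKey R (h + h)) n (v₂.mem 2) := hv1.congr_fun hv2
    refine (runs_rerank (k := h) (by rw [hG2.reg 0 rfl, a0]) (by rw [hG2.reg 1 rfl, a1])
      (by rw [hG2.reg 3 rfl, hG1.reg 3 rfl, h3]) hh1 hhn.le hw rfl hcap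
      (by rw [hG2.mem 4 rfl, hG1.mem 4 rfl]; exact hr) hs2).mono ?_
    rintro u₃ v₃ hG3 ⟨hu3, hv3⟩
    refine ⟨by omega, fun h' hh' => ?_⟩
    -- If the doubling is cut off at `n`, both keys are already the entire suffixes.
    have hkey : sfxKey R h' = sfxKey R (h + h) := by
      rcases hh' with rfl | ⟨rfl, hle⟩
      · rw [two_mul]
      · funext i
        rw [sfxKey_of_le (by omega), sfxKey_of_le (by omega)]
    rw [hkey, hG3.mem 2 rfl]
    exact ⟨hs2, hv3⟩
  rintro t₃ s₃ hF3 ⟨ht3, hs3, -⟩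
  have hs3 : SortedBy (sfx R) n (s₃.mem 2) := by
    have : sfxKey R n = sfx R := funext fun i => sfxKey_of_le (by omega)
    rwa [this] at hs3
  have g0 : s₃.reg 0 = n := by rw [hF3.reg 0 rfl, f0]
  have g1 : s₃.reg 1 = 1 := by rw [hF3.reg 1 rfl, f1]
  have g5 : s₃.mem 5 = s₂.mem 5 := hF3.mem 5 rfl
  rw [runs_seq, runs_const, runs_seq, Nat.mod_eq_of_lt (show 1 < 2 ^ w by omega)]
  refine (runs_distribute (s := s₃.setReg 3 1) (a := 5) (key := charKey R) (key' := sfx R) (n := n) (k := 1) (by simp [g0])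
    (by simp [g1]) (by simp) hn1 hw hcap (by decide) (by decide)
    (fun i hi => by rw [State.mem_setReg, g5]; exact (hr2 i hi).2) rfl hs3
    fun i hi j => sfx_bot hi j).mono ?_
  rintro t₄ s₄ hF4 ⟨ht4, hs4⟩
  refine (runs_forRange (K := 2) (n := n) (fun k s' => ∀ t < k, s'.mem 8 (s₄.mem 3 t) = t)
    (by rw [hF4.reg 0 rfl]; simp [g0]) (by rw [hF4.reg 1 rfl]; simp [g1]) hw rfl rfl rfl
    (by decide) (by decide) (by simp) ?_).mono ?_
  · intro k s' hk _ _ h7 hf hI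
    have m3 : s'.mem 3 = s₄.mem 3 := hf.mem 3 rfl
    have := hs4.lt k hk
    simp only [exec_rules, state_rules, Nat.zero_mod, Nat.reduceEqDiff, reduceIte, h7, m3]
    refine ⟨by omega, by omega, by omega, ?_⟩
    intro t ht
    rw [Function.update_apply]
    split_ifs with h
    · exact (hs4.inj t (by omega) k hk h).symm
    · refine hI t ?_
      rcases Nat.lt_succ_iff_lt_or_eq.1 ht with h' | rfl
      · exact h'
      · exact absurd rfl h
  · rintro t₅ s₅ hF5 ⟨ht5, hI⟩
    have m3 : s₅.mem 3 = s₄.mem 3 := hF5.mem 3 rfl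
    have m5 : s₅.mem 5 = s₂.mem 5 := by rw [hF5.mem 5 rfl, hF4.mem 5 rfl]; exact g5
    rw [m3, m5]
    refine ⟨?_, hs4, hI, fun i hi => (hr2 i hi).2⟩
    have hL : 1 ≤ Nat.log 2 n + 1 := by omega
    generalize Nat.log 2 n + 1 = L at *
    have q1 : L ≤ L * n := Nat.le_mul_of_pos_right _ hn1
    have q2 : n ≤ L * n := Nat.le_mul_of_pos_left _ hL
    have q3 : L * (n * 64 + 8) = 64 * (L * n) + 8 * L := by ring
    have q4 : L * (n * 45 + 17 + 4) = 45 * (L * n) + 21 * L := by ring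
    rw [q3] at ht1
    rw [q4] at ht3
    omega

end

/-! ### Segment trees

The leaves `x < 2 ^ (D + 1)` of a complete binary tree carry values `V x`. The inner nodes are
numbered as in a heap: the ancestor of leaf `x` at height `h` is `(2 ^ (D + 1) + x) / 2 ^ h`. Two
arrays hold the maximal values below the left and below the right child of each inner node. -/

/-- The entry that belongs to node `c`. -/
def entry (A B : ℕ → ℕ) (c : ℕ) : ℕ := if c % 2 = 0 then A (c / 2) else B (c / 2)

theorem entry_even (A B : ℕ → ℕ) (v : ℕ) : entry A B (2 * v) = A v := by simp [entry]

theorem entry_odd (A B : ℕ → ℕ) (v : ℕ) : entry A B (2 * v + 1) = B v := by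
  rw [entry, if_neg (by omega), show (2 * v + 1) / 2 = v by omega]

theorem entry_update_left (A B : ℕ → ℕ) (v y c : ℕ) :
    entry (Function.update A v y) B c = if c = 2 * v then y else entry A B c := by
  unfold entry
  rw [Function.update_apply]
  split_ifs <;> first | rfl | omega

theorem entry_update_right (A B : ℕ → ℕ) (v y c : ℕ) :
    entry A (Function.update B v y) c = if c = 2 * v + 1 then y else entry A B c := by
  unfold entry
  rw [Function.update_apply]
  split_ifs <;> first | rfl | omega

/-- The arrays `A` and `B` hold the maxima of the values `V` below left and right children. -/
def TreeInv (D : ℕ) (V A B : ℕ → ℕ) : Prop :=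
  ∀ h ≤ D, ∀ c, 2 ^ (D + 1 - h) ≤ c → c < 2 ^ (D + 2 - h) → ∀ e, 1 ≤ e →
    (e ≤ entry A B c ↔ ∃ y < 2 ^ (D + 1), (2 ^ (D + 1) + y) / 2 ^ h = c ∧ e ≤ V y)

theorem node_range {D x h : ℕ} (hx : x < 2 ^ (D + 1)) (hh : h ≤ D + 1) :
    2 ^ (D + 1 - h) ≤ (2 ^ (D + 1) + x) / 2 ^ h ∧ (2 ^ (D + 1) + x) / 2 ^ h < 2 ^ (D + 2 - h) := by
  constructor
  · rw [Nat.le_div_iff_mul_le (by positivity), ← pow_add, show D + 1 - h + h = D + 1 by omega]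
    omega
  · rw [Nat.div_lt_iff_lt_mul (by positivity), ← pow_add, show D + 2 - h + h = D + 1 + 1 by omega,
      pow_succ]
    omega

theorem node_eq_zero {D x h : ℕ} (hx : x < 2 ^ (D + 1)) (hh : D + 1 < h) :
    (2 ^ (D + 1) + x) / 2 ^ h = 0 := by
  apply Nat.div_eq_of_lt
  have : 2 ^ (D + 1 + 1) ≤ 2 ^ h := Nat.pow_le_pow_right (by norm_num) hh
  rw [pow_succ] at this
  omega

/-- The levels of the tree occupy disjoint dyadic intervals of node numbers, so a number determines
its height. -/
theorem node_height_unique {D x h h' : ℕ} (hx : x < 2 ^ (D + 1)) (hh : h ≤ D)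
    (h1 : 2 ^ (D + 1 - h) ≤ (2 ^ (D + 1) + x) / 2 ^ h')
    (h2 : (2 ^ (D + 1) + x) / 2 ^ h' < 2 ^ (D + 2 - h)) : h' = h := by
  have hpos : 0 < 2 ^ (D + 1 - h) := by positivity
  have hh' : h' ≤ D + 1 := by
    by_contra hc
    rw [node_eq_zero hx (by omega)] at h1
    omega
  obtain ⟨h3, h4⟩ := node_range hx hh'
  rcases lt_trichotomy h h' with hl | hl | hl
  · have : 2 ^ (D + 2 - h') ≤ 2 ^ (D + 1 - h) := Nat.pow_le_pow_right (by norm_num) (by omega)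
    omega
  · exact hl.symm
  · have : 2 ^ (D + 2 - h) ≤ 2 ^ (D + 1 - h') := Nat.pow_le_pow_right (by norm_num) (by omega)
    omega

theorem TreeInv.zero (D : ℕ) : TreeInv D (fun _ => 0) (fun _ => 0) (fun _ => 0) := by
  intro h _ c _ _ e he
  simp only [entry, ite_self]
  constructor
  · intro h; omega
  · rintro ⟨_, _, _, h⟩; omega

/-- Raising one leaf affects only the maxima at the leaf and its ancestors. The root, number `1`, is
nobody's child and has no entry, whence `2 ≤ c`. -/
theorem TreeInv.insert {D x p : ℕ} {V A B A' B' : ℕ → ℕ} (hT : TreeInv D V A B)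
    (hx : x < 2 ^ (D + 1)) (hp : V x ≤ p)
    (hin : ∀ c, 2 ≤ c → (∃ h, (2 ^ (D + 1) + x) / 2 ^ h = c) →
      entry A' B' c = max (entry A B c) p)
    (hout : ∀ c, 2 ≤ c → (¬ ∃ h, (2 ^ (D + 1) + x) / 2 ^ h = c) → entry A' B' c = entry A B c) :
    TreeInv D (Function.update V x p) A' B' := by
  intro k hk c hc1 hc2 e he
  have hc : 2 ≤ c := by
    refine le_trans ?_ hc1
    rw [show D + 1 - k = (D - k) + 1 by omega, pow_succ]
    have : 0 < 2 ^ (D - k) := by positivity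
    omega
  have hT' := hT k hk c hc1 hc2 e he
  by_cases hex : ∃ h, (2 ^ (D + 1) + x) / 2 ^ h = c
  · rw [hin c hc hex]
    obtain ⟨h', hh'⟩ := hex
    obtain rfl : h' = k := node_height_unique hx hk (hh' ▸ hc1) (hh' ▸ hc2)
    rw [le_max_iff, hT']
    constructor
    · rintro (⟨y, hy, hyc, hey⟩ | hep)
      · refine ⟨y, hy, hyc, ?_⟩
        rw [Function.update_apply]
        split_ifs with hyx
        · subst hyx; omega
        · exact hey
      · exact ⟨x, hx, hh', by simpa using hep⟩
    · rintro ⟨y, hy, hyc, hey⟩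
      rw [Function.update_apply] at hey
      split_ifs at hey with hyx
      · exact .inr hey
      · exact .inl ⟨y, hy, hyc, hey⟩
  · rw [hout c hc hex, hT']
    have : ∀ y, (2 ^ (D + 1) + y) / 2 ^ k = c → Function.update V x p y = V y := by
      intro y hyc
      rw [Function.update_of_ne]
      rintro rfl
      exact hex ⟨k, hyc⟩
    constructor
    · rintro ⟨y, hy, hyc, hey⟩; exact ⟨y, hy, hyc, by rwa [this y hyc]⟩
    · rintro ⟨y, hy, hyc, hey⟩; exact ⟨y, hy, hyc, by rwa [this y hyc] at hey⟩

section

variable {α : Type u} [LinearOrder α] {w cap : ℕ} {T : List α}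

/-- Raise the entries above leaf `x` (register `21`) to at least `p` (register `22`); the number of
leaves is twice register `20`. -/
def treeInsert (a b : ℕ) : Cmd :=
  .op .shr 23 21 1 ;; .op .add 23 20 23 ;; .op .and 24 21 1 ;;
  .while (.lt 2 23)
    (.ite (.eq 24 2) (.load 25 a 23 ;; .ite (.lt 25 22) (.store a 23 22) .skip)
      (.load 25 b 23 ;; .ite (.lt 25 22) (.store b 23 22) .skip) ;;
    .op .and 24 23 1 ;; .op .shr 23 23 1)

/-- The number of a leaf, and even `2 ^ (D + 1)`, may exceed the largest word. A node is therefore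
represented by its parent `v` and a side bit, and a climb begins at `2 ^ D + x / 2` with bit `x %
2`. -/
theorem half_add_half {D x : ℕ} :
    2 * (2 ^ D + x / 2) + x % 2 = (2 ^ (D + 1) + x) / 2 ^ 0 := by
  rw [pow_zero, Nat.div_one, pow_succ]; omega

theorem node_succ (D x h : ℕ) :
    (2 ^ (D + 1) + x) / 2 ^ (h + 1) = (2 ^ (D + 1) + x) / 2 ^ h / 2 := by
  rw [Nat.div_div_eq_div_mul, ← pow_succ]

theorem runs_treeInsert {s : State} {a b D x p : ℕ} {V : ℕ → ℕ} (h1 : s.reg 1 = 1)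
    (h2 : s.reg 2 = 0) (h20 : s.reg 20 = 2 ^ D) (hx : s.reg 21 = x) (hp : s.reg 22 = p)
    (hxD : x < 2 ^ (D + 1)) (hw : 2 ^ (D + 1) ≤ 2 ^ w) (hcap : 2 ^ (D + 1) ≤ cap) (hab : a ≠ b)
    (hT : TreeInv D V (s.mem a) (s.mem b)) (hV : V x ≤ p) :
    Runs w T cap (treeInsert a b) s fun t s' => t ≤ (D + 1) * 10 + 4 ∧
      TreeInv D (Function.update V x p) (s'.mem a) (s'.mem b) := by
  classical
  have hpow : 2 ^ (D + 1) = 2 * 2 ^ D := by rw [pow_succ]; ring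
  unfold treeInsert
  simp only [exec_rules, state_rules, Nat.zero_mod, Nat.reduceEqDiff, reduceIte, h1, hx, h20, Nat.and_one_is_mod, Nat.shiftRight_one]
  rw [Nat.mod_eq_of_lt (by omega)]
  refine (runs_while (Q := fun s' => TreeInv D (Function.update V x p) (s'.mem a) (s'.mem b))
    (fun q s' => ∃ h, h ≤ D + 1 ∧ q = (D + 1 - h) * 10 + 1 ∧
      2 * s'.reg 23 + s'.reg 24 = (2 ^ (D + 1) + x) / 2 ^ h ∧ s'.reg 24 < 2 ∧
      ∀ c, 2 ≤ c → entry (s'.mem a) (s'.mem b) c =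
        if ∃ h' < h, (2 ^ (D + 1) + x) / 2 ^ h' = c then max (entry (s.mem a) (s.mem b) c) p
        else entry (s.mem a) (s.mem b) c) (p := (D + 1) * 10 + 1)
    ⟨0, by omega, by simp, by simpa using half_add_half, by simp; omega, ?_⟩ ?_ ?_).mono ?_
  · intro c _; simp
  · rintro q s' hF ⟨h, hh, rfl, hnode, h24, hent⟩ hb
    have g1 : s'.reg 1 = 1 := by rw [hF.reg 1 rfl]; simp [h1]
    have g2 : s'.reg 2 = 0 := by rw [hF.reg 2 rfl]; simp [h2]
    have g22 : s'.reg 22 = p := by rw [hF.reg 22 rfl]; simp [hp]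
    simp only [Cond.holds_lt, g2] at hb
    generalize hv : s'.reg 23 = v at *
    generalize hc : s'.reg 24 = side at *
    have hhD : h ≤ D := by
      by_contra hcon
      obtain ⟨_, h4⟩ := node_range hxD hh
      rw [show D + 2 - h = 1 by omega] at h4
      omega
    have hvN : v < 2 ^ (D + 1) := by
      have : (2 ^ (D + 1) + x) / 2 ^ h ≤ 2 ^ (D + 1) + x := Nat.div_le_self _ _
      omega
    have hnode' : 2 * (v / 2) + v % 2 = (2 ^ (D + 1) + x) / 2 ^ (h + 1) := by
      rw [node_succ, ← hnode]; omega
    have step : ∀ A' B' : ℕ → ℕ, (∀ c, entry A' B' c = if c = 2 * v + side then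
          max (entry (s'.mem a) (s'.mem b) c) p else entry (s'.mem a) (s'.mem b) c) →
        ∀ c, 2 ≤ c → entry A' B' c =
        if ∃ h' < h + 1, (2 ^ (D + 1) + x) / 2 ^ h' = c then max (entry (s.mem a) (s.mem b) c) p
        else entry (s.mem a) (s.mem b) c := by
      intro A' B' hAB c hc2
      rw [hAB, hent c hc2, hnode]
      have hiff : (∃ h' < h + 1, (2 ^ (D + 1) + x) / 2 ^ h' = c) ↔
          (∃ h' < h, (2 ^ (D + 1) + x) / 2 ^ h' = c) ∨ c = (2 ^ (D + 1) + x) / 2 ^ h := by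
        constructor
        · rintro ⟨h', h3, h4⟩
          rcases Nat.lt_succ_iff_lt_or_eq.1 h3 with h5 | rfl
          · exact .inl ⟨h', h5, h4⟩
          · exact .inr h4.symm
        · rintro (⟨h', h3, h4⟩ | h3)
          · exact ⟨h', by omega, h4⟩
          · exact ⟨h, by omega, h3.symm⟩
      by_cases e1 : c = (2 ^ (D + 1) + x) / 2 ^ h
      · rw [if_pos e1, if_pos (hiff.2 (.inr e1))]
        split_ifs <;> omega
      · rw [if_neg e1]
        by_cases e2 : ∃ h' < h, (2 ^ (D + 1) + x) / 2 ^ h' = c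
        · rw [if_pos e2, if_pos (hiff.2 (.inl e2))]
        · rw [if_neg e2, if_neg (fun h => (hiff.1 h).elim e2 e1)]
    have hq : (D + 1 - h) * 10 = (D + 1 - (h + 1)) * 10 + 10 := by omega
    simp only [exec_rules, state_rules, Nat.zero_mod, Nat.reduceEqDiff, reduceIte, g1, g2, g22, hv, hc, hab, hab.symm, Nat.and_one_is_mod, Nat.shiftRight_one]
    refine ⟨fun e0 => ⟨by omega, fun hlt => ⟨by omega, _, ?_, h + 1, by omega, rfl, hnode', by omega,
      step _ _ ?_⟩, fun hlt => ⟨_, ?_, h + 1, by omega, rfl, hnode', by omega, step _ _ ?_⟩⟩,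
      fun e0 => ⟨by omega, fun hlt => ⟨by omega, _, ?_, h + 1, by omega, rfl, hnode', by omega,
      step _ _ ?_⟩, fun hlt => ⟨_, ?_, h + 1, by omega, rfl, hnode', by omega, step _ _ ?_⟩⟩⟩
    · omega
    · intro c
      rw [entry_update_left, e0, Nat.add_zero]
      split_ifs with e
      · rw [e, entry_even]; omega
      · rfl
    · omega
    · intro c
      split_ifs with e
      · rw [e, e0, Nat.add_zero, entry_even]; omega
      · rfl
    · omega
    · intro c
      obtain rfl : side = 1 := by omega
      rw [entry_update_right]
      split_ifs with e
      · rw [e, entry_odd]; omega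
      · rfl
    · omega
    · intro c
      obtain rfl : side = 1 := by omega
      split_ifs with e
      · rw [e, entry_odd]; omega
      · rfl
  · rintro q s' hF ⟨h, hh, rfl, hnode, h24, hent⟩ hb
    have g2 : s'.reg 2 = 0 := by rw [hF.reg 2 rfl]; simp [h2]
    simp only [Cond.holds_lt, g2] at hb
    have hiff : ∀ c, 2 ≤ c → ((∃ h' < h, (2 ^ (D + 1) + x) / 2 ^ h' = c) ↔
        ∃ h', (2 ^ (D + 1) + x) / 2 ^ h' = c) := by
      intro c hc
      constructor
      · rintro ⟨h', _, e⟩; exact ⟨h', e⟩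
      · rintro ⟨h', e⟩
        -- The loop stops at a node numbered at most `1`, and ancestors further up have no larger
        -- numbers, so all ancestors `c ≥ 2` have been treated.
        refine ⟨h', ?_, e⟩
        by_contra hcon
        have : (2 ^ (D + 1) + x) / 2 ^ h' ≤ (2 ^ (D + 1) + x) / 2 ^ h :=
          Nat.div_le_div_left (Nat.pow_le_pow_right (by norm_num) (by omega)) (by positivity)
        omega
    refine ⟨by omega, hT.insert hxD hV (fun c hc hex => ?_) fun c hc hex => ?_⟩
    · rw [hent c hc, if_pos ((hiff c hc).2 hex)]
    · rw [hent c hc, if_neg fun h => hex ((hiff c hc).1 h)]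
  · rintro t s' _ ⟨ht, hI⟩
    exact ⟨by omega, hI⟩

/-- Climb from leaf `x` (register `21`) to the first left sibling with a value that is at least `e`
(register `22`) below it; register `26` tells if there is one, and its parent goes to register
`27`. -/
def treeClimb (a : ℕ) : Cmd :=
  .op .shr 23 21 1 ;; .op .add 23 20 23 ;; .op .and 24 21 1 ;; .const 26 0 ;;
  .while (.lt 2 23)
    (.load 25 a 23 ;; .ite (.eq 24 2) (.const 25 0) .skip ;;
    .ite (.le 22 25) (.move 27 23 ;; .const 26 1 ;; .move 23 2)
      (.op .and 24 23 1 ;; .op .shr 23 23 1))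

/-- Descend from the left child of the node in register `27` to its last leaf with a value that is at
least `e` (register `22`). -/
def treeDescend (b : ℕ) : Cmd :=
  .const 24 0 ;;
  .while (.lt 27 20)
    (.op .add 27 27 27 ;; .op .add 27 27 24 ;; .load 25 b 27 ;;
    .ite (.le 22 25) (.const 24 1) (.const 24 0)) ;;
  .op .sub 27 27 20 ;; .op .add 27 27 27 ;; .op .add 27 27 24

/-- Find the last leaf before leaf `x` (register `21`) with a value that is at least `e` (register
`22`): register `26` tells if there is one, register `27` receives it. -/
def treeFind (a b : ℕ) : Cmd :=
  treeClimb a ;; .ite (.eq 26 1) (treeDescend b) .skip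

/-- Invariant: every suitable leaf before `x` lies below a node strictly to the left of the current
one on the same level. If the current node is a right child and its sibling contains a suitable
leaf, the last one is below that sibling; otherwise the invariant passes to the parent. -/
theorem runs_treeClimb {s : State} {a b D x e : ℕ} {V : ℕ → ℕ} (h1 : s.reg 1 = 1)
    (h2 : s.reg 2 = 0) (h20 : s.reg 20 = 2 ^ D) (hx : s.reg 21 = x) (he : s.reg 22 = e)
    (hxD : x < 2 ^ (D + 1)) (hw : 2 ^ (D + 1) ≤ 2 ^ w) (hw1 : 1 < 2 ^ w) (hcap : 2 ^ (D + 1) ≤ cap)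
    (hT : TreeInv D V (s.mem a) (s.mem b)) (he1 : 1 ≤ e) :
    Runs w T cap (treeClimb a) s fun t s' => t ≤ (D + 1) * 10 + 5 ∧
      (s'.reg 26 = 0 ∧ (∀ z < x, V z < e) ∨
      s'.reg 26 = 1 ∧ ∃ h ≤ D, 2 ^ (D - h) ≤ s'.reg 27 ∧ s'.reg 27 < 2 ^ (D + 1 - h) ∧
        (∃ y < 2 ^ (D + 1), (2 ^ (D + 1) + y) / 2 ^ h = 2 * s'.reg 27 ∧ e ≤ V y) ∧
        (∀ y < x, e ≤ V y → (2 ^ (D + 1) + y) / 2 ^ h ≤ 2 * s'.reg 27) ∧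
        ∀ y, (2 ^ (D + 1) + y) / 2 ^ h = 2 * s'.reg 27 → y < x) := by
  have hpow : 2 ^ (D + 1) = 2 * 2 ^ D := by rw [pow_succ]; ring
  unfold treeClimb
  simp only [exec_rules, state_rules, Nat.zero_mod, Nat.reduceEqDiff, reduceIte, h1, hx, h20, Nat.and_one_is_mod, Nat.shiftRight_one]
  rw [Nat.mod_eq_of_lt (by omega)]
  set Found : State → Prop := fun s' => s'.reg 26 = 1 ∧
      ∃ h ≤ D, 2 ^ (D - h) ≤ s'.reg 27 ∧ s'.reg 27 < 2 ^ (D + 1 - h) ∧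
        (∃ y < 2 ^ (D + 1), (2 ^ (D + 1) + y) / 2 ^ h = 2 * s'.reg 27 ∧ e ≤ V y) ∧
        (∀ y < x, e ≤ V y → (2 ^ (D + 1) + y) / 2 ^ h ≤ 2 * s'.reg 27) ∧
        ∀ y, (2 ^ (D + 1) + y) / 2 ^ h = 2 * s'.reg 27 → y < x with hFound
  refine (runs_while (Q := fun s' => s'.reg 26 = 0 ∧ (∀ z < x, V z < e) ∨ Found s')
    -- A success sets register `23` to `0` in order to leave the loop; the unit of time kept in `1 ≤
    -- q` pays for the last test.
    (fun q s' => (1 ≤ q ∧ s'.reg 23 = 0 ∧ Found s') ∨ s'.reg 26 = 0 ∧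
      ∃ h, h ≤ D + 1 ∧ q = (D + 1 - h) * 10 + 1 ∧
      2 * s'.reg 23 + s'.reg 24 = (2 ^ (D + 1) + x) / 2 ^ h ∧ s'.reg 24 < 2 ∧
      ∀ y < x, e ≤ V y → (2 ^ (D + 1) + y) / 2 ^ h < (2 ^ (D + 1) + x) / 2 ^ h)
    (p := (D + 1) * 10 + 1)
    (.inr ⟨by simp, 0, by omega, by simp, by simpa using half_add_half, by simp; omega, ?_⟩)
    ?_ ?_).mono ?_
  · intro y hy _; simpa using hy
  · rintro q s' hF (⟨_, h23, _⟩ | ⟨h26, h, hh, rfl, hnode, h24, hI⟩) hb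
    · have g2 : s'.reg 2 = 0 := by rw [hF.reg 2 rfl]; simp [h2]
      simp [h23, g2] at hb
    have g1 : s'.reg 1 = 1 := by rw [hF.reg 1 rfl]; simp [h1]
    have g2 : s'.reg 2 = 0 := by rw [hF.reg 2 rfl]; simp [h2]
    have g22 : s'.reg 22 = e := by rw [hF.reg 22 rfl]; simp [he]
    have ga : s'.mem a = s.mem a := by rw [hF.mem a rfl]; simp
    simp only [Cond.holds_lt, g2] at hb
    generalize hv : s'.reg 23 = v at *
    generalize hc : s'.reg 24 = side at *
    have hhD : h ≤ D := by
      by_contra hcon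
      obtain ⟨_, h4⟩ := node_range hxD hh
      rw [show D + 2 - h = 1 by omega] at h4
      omega
    have hvN : v < 2 ^ (D + 1) := by
      have : (2 ^ (D + 1) + x) / 2 ^ h ≤ 2 ^ (D + 1) + x := Nat.div_le_self _ _
      omega
    have hnode' : 2 * (v / 2) + v % 2 = (2 ^ (D + 1) + x) / 2 ^ (h + 1) := by
      rw [node_succ, ← hnode]; omega
    have hvn : v = (2 ^ (D + 1) + x) / 2 ^ (h + 1) := by omega
    obtain ⟨hr1, hr2⟩ := node_range hxD (show h + 1 ≤ D + 1 by omega)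
    rw [← hvn, show D + 1 - (h + 1) = D - h by omega] at hr1
    rw [← hvn, show D + 2 - (h + 1) = D + 1 - h by omega] at hr2
    have hTv : e ≤ s.mem a v ↔ ∃ y < 2 ^ (D + 1), (2 ^ (D + 1) + y) / 2 ^ h = 2 * v ∧ e ≤ V y := by
      rw [← entry_even (s.mem a) (s.mem b) v]
      refine hT h hhD (2 * v) ?_ ?_ e he1
      · rw [show D + 1 - h = (D - h) + 1 by omega, pow_succ]; omega
      · rw [show D + 2 - h = (D + 1 - h) + 1 by omega, pow_succ]; omega
    have hnot : ¬ (side ≠ 0 ∧ e ≤ s.mem a v) → ∀ y < x, e ≤ V y →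
        (2 ^ (D + 1) + y) / 2 ^ (h + 1) < v := by
      intro hno y hy hey
      have h3 := hI y hy hey
      rw [node_succ]
      by_contra hcon
      refine hno ⟨by omega, hTv.2 ⟨y, by omega, by omega, hey⟩⟩
    have hq : (D + 1 - h) * 10 = (D + 1 - (h + 1)) * 10 + 10 := by omega
    simp only [exec_rules, state_rules, Nat.zero_mod, Nat.reduceEqDiff, reduceIte, g1, g2, g22, hv, hc, ga, Nat.and_one_is_mod, Nat.shiftRight_one]
    -- At a left child the loaded entry is replaced by `0`, and the test fails because `e ≥ 1`.
    refine ⟨by omega, fun e0 => ⟨fun h => by omega, fun _ => ?_⟩, fun e0 => ⟨fun hle => ?_, fun hle => ?_⟩⟩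
    · exact ⟨_, by omega, .inr ⟨h26, h + 1, by omega, rfl, hnode', by omega,
        hvn ▸ hnot (fun h => h.1 e0)⟩⟩
    · refine ⟨1, by omega, .inl ⟨le_rfl, trivial, ?_⟩⟩
      rw [hFound]
      simp only [state_rules, Nat.reduceEqDiff, reduceIte, Nat.mod_eq_of_lt hw1]
      refine ⟨trivial, h, hhD, hr1, hr2, hTv.1 hle, ?_, ?_⟩
      · intro y hy hey
        have := hI y hy hey
        omega
      · intro y hy
        by_contra hcon
        have : (2 ^ (D + 1) + x) / 2 ^ h ≤ (2 ^ (D + 1) + y) / 2 ^ h :=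
          Nat.div_le_div_right (by omega)
        omega
    · exact ⟨_, by omega, .inr ⟨h26, h + 1, by omega, rfl, hnode', by omega,
        hvn ▸ hnot (fun h => hle h.2)⟩⟩
  · rintro q s' hF (⟨hq, _, hfound⟩ | ⟨h26, h, hh, rfl, hnode, h24, hI⟩) hb
    · exact ⟨hq, .inr hfound⟩
    · have g2 : s'.reg 2 = 0 := by rw [hF.reg 2 rfl]; simp [h2]
      simp only [Cond.holds_lt, g2] at hb
      refine ⟨by omega, .inl ⟨h26, fun z hz => ?_⟩⟩
      by_contra hcon
      have h3 := hI z hz (by omega)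
      have hle : (2 ^ (D + 1) + x) / 2 ^ h ≤ 1 := by omega
      have : 1 ≤ (2 ^ (D + 1) + z) / 2 ^ h := by
        have := (node_range (D := D) (x := z) (by omega) hh).1
        have : 0 < 2 ^ (D + 1 - h) := by positivity
        omega
      omega
  · rintro t s' _ ⟨ht, hI⟩
    exact ⟨by omega, hI⟩

/-- Invariant: the current node contains a suitable leaf, no suitable leaf before `x` lies to its
right, and its whole subtree lies before `x`. The right child keeps this invariant if it contains a
suitable leaf, and the left child does otherwise. -/
theorem runs_treeDescend {s : State} {a b D x e h₀ v₀ : ℕ} {V : ℕ → ℕ}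
    (h20 : s.reg 20 = 2 ^ D) (he : s.reg 22 = e)
    (hw : 2 ^ (D + 1) ≤ 2 ^ w) (hw1 : 1 < 2 ^ w) (hcap : 2 ^ (D + 1) ≤ cap)
    (hT : TreeInv D V (s.mem a) (s.mem b)) (he1 : 1 ≤ e) (hv₀ : s.reg 27 = v₀) (hh₀ : h₀ ≤ D)
    (hr1 : 2 ^ (D - h₀) ≤ v₀) (hr2 : v₀ < 2 ^ (D + 1 - h₀))
    (hex : ∃ y < 2 ^ (D + 1), (2 ^ (D + 1) + y) / 2 ^ h₀ = 2 * v₀ ∧ e ≤ V y)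
    (hmax : ∀ y < x, e ≤ V y → (2 ^ (D + 1) + y) / 2 ^ h₀ ≤ 2 * v₀)
    (hlt : ∀ y, (2 ^ (D + 1) + y) / 2 ^ h₀ = 2 * v₀ → y < x) :
    Runs w T cap (treeDescend b) s fun t s' => t ≤ (D + 1) * 10 + 5 ∧
      s'.reg 27 < x ∧ e ≤ V (s'.reg 27) ∧ ∀ z < x, e ≤ V z → z ≤ s'.reg 27 := by
  have hpow : 2 ^ (D + 1) = 2 * 2 ^ D := by rw [pow_succ]; ring
  unfold treeDescend
  simp only [exec_rules, state_rules, Nat.zero_mod, Nat.reduceEqDiff, reduceIte, ]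
  refine (runs_while (Q := fun s' => ∃ y, y < x ∧ e ≤ V y ∧ (∀ z < x, e ≤ V z → z ≤ y) ∧
      2 ^ D ≤ s'.reg 27 ∧ y = 2 * (s'.reg 27 - 2 ^ D) + s'.reg 24 ∧ y < 2 ^ (D + 1))
    (fun q s' => ∃ h v c, h ≤ D ∧ q = h * 10 + 1 ∧ s'.reg 27 = v ∧ c = 2 * v + s'.reg 24 ∧
      s'.reg 24 < 2 ∧ 2 ^ (D - h) ≤ v ∧ v < 2 ^ (D + 1 - h) ∧
      (∃ y < 2 ^ (D + 1), (2 ^ (D + 1) + y) / 2 ^ h = c ∧ e ≤ V y) ∧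
      (∀ y < x, e ≤ V y → (2 ^ (D + 1) + y) / 2 ^ h ≤ c) ∧
      ∀ y, (2 ^ (D + 1) + y) / 2 ^ h = c → y < x)
    (p := h₀ * 10 + 1)
    ⟨h₀, v₀, 2 * v₀, hh₀, rfl, by simp [hv₀], by simp, by simp, hr1, hr2, hex, hmax, hlt⟩
    ?_ ?_).mono ?_
  · rintro q s' hF ⟨h, v, c, hh, rfl, h27, hc, h24, hv1, hv2, ⟨y₀, hy₀, hyc₀, hey₀⟩, hI, hJ⟩ hb
    have g20 : s'.reg 20 = 2 ^ D := by rw [hF.reg 20 rfl]; simp [h20]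
    have g22 : s'.reg 22 = e := by rw [hF.reg 22 rfl]; simp [he]
    have gb : s'.mem b = s.mem b := by rw [hF.mem b rfl]; simp
    simp only [Cond.holds_lt, g20, h27] at hb
    obtain ⟨k, rfl⟩ : ∃ k, h = k + 1 := by
      rcases h with _ | k
      · simp at hv1; omega
      · exact ⟨k, rfl⟩
    have hcN : c < 2 ^ (D + 1) := by omega
    have hc1 : 2 ^ (D - k) ≤ c := by
      rw [show D - k = (D - (k + 1)) + 1 by omega, pow_succ]; omega
    have hc2 : c < 2 ^ (D + 1 - k) := by
      rw [show D + 1 - k = (D + 1 - (k + 1)) + 1 by omega, pow_succ]; omega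
    have hTc : e ≤ s.mem b c ↔
        ∃ y < 2 ^ (D + 1), (2 ^ (D + 1) + y) / 2 ^ k = 2 * c + 1 ∧ e ≤ V y := by
      rw [← entry_odd (s.mem a) (s.mem b) c]
      refine hT k (by omega) (2 * c + 1) ?_ ?_ e he1
      · rw [show D + 1 - k = (D - k) + 1 by omega, pow_succ]; omega
      · rw [show D + 2 - k = (D + 1 - k) + 1 by omega, pow_succ]; omega
    have hJ' : ∀ d, d < 2 → ∀ y, (2 ^ (D + 1) + y) / 2 ^ k = 2 * c + d → y < x := by
      intro d hd y hy
      refine hJ y ?_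
      rw [node_succ]; omega
    have hI' : ∀ y < x, e ≤ V y → (2 ^ (D + 1) + y) / 2 ^ k ≤ 2 * c + 1 := by
      intro y hy hey
      have := hI y hy hey
      rw [node_succ] at this
      omega
    simp only [exec_rules, state_rules, Nat.zero_mod, Nat.reduceEqDiff, reduceIte, g20, g22, gb, h27]
    rw [Nat.mod_eq_of_lt (show v + v < 2 ^ w by omega), show v + v + s'.reg 24 = c by omega,
      Nat.mod_eq_of_lt (show c < 2 ^ w by omega)]
    refine ⟨by omega, fun hle => ?_, fun hle => ?_⟩
    · refine ⟨k * 10 + 1, by omega, k, c, 2 * c + 1, by omega, rfl, rfl, ?_, ?_, hc1, hc2,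
        hTc.1 hle, hI', hJ' 1 (by omega)⟩
      · rw [Nat.mod_eq_of_lt hw1]
      · rw [Nat.mod_eq_of_lt hw1]; omega
    · refine ⟨k * 10 + 1, by omega, k, c, 2 * c, by omega, rfl, rfl, rfl, by omega, hc1, hc2,
        ⟨y₀, hy₀, ?_, hey₀⟩, ?_, hJ' 0 (by omega)⟩
      · have : (2 ^ (D + 1) + y₀) / 2 ^ k ≠ 2 * c + 1 := fun h => hle (hTc.2 ⟨y₀, hy₀, h, hey₀⟩)
        rw [node_succ] at hyc₀
        omega
      · intro y hy hey
        have h3 := hI' y hy hey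
        by_contra hcon
        have h4 : (2 ^ (D + 1) + y) / 2 ^ k = 2 * c + 1 := by omega
        by_cases hyN : y < 2 ^ (D + 1)
        · exact hle (hTc.2 ⟨y, hyN, h4, hey⟩)
        · have h5 : 2 ^ (D + 1) * 2 / 2 ^ k ≤ (2 ^ (D + 1) + y) / 2 ^ k :=
            Nat.div_le_div_right (by omega)
          rw [← pow_succ, Nat.pow_div (by omega) (by norm_num),
            show D + 1 + 1 - k = (D + 1 - k) + 1 by omega, pow_succ] at h5
          omega
  · rintro q s' hF ⟨h, v, c, hh, rfl, h27, hc, h24, hv1, hv2, ⟨y₀, hy₀, hyc₀, hey₀⟩, hI, hJ⟩ hb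
    have g20 : s'.reg 20 = 2 ^ D := by rw [hF.reg 20 rfl]; simp [h20]
    simp only [Cond.holds_lt, g20, h27] at hb
    obtain rfl : h = 0 := by
      by_contra hne
      have : 2 ^ (D + 1 - h) ≤ 2 ^ D := Nat.pow_le_pow_right (by norm_num) (by omega)
      omega
    simp only [pow_zero, Nat.div_one] at hyc₀ hI hJ
    refine ⟨by omega, y₀, hJ y₀ hyc₀, hey₀, ?_, by omega, by omega, hy₀⟩
    intro z hz hez
    have := hI z hz hez
    omega
  · rintro t s' hF ⟨ht, y, hyx, hey, hmaxy, h27, hy, hyN⟩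
    have g20 : s'.reg 20 = 2 ^ D := by rw [hF.reg 20 rfl]; simp [h20]
    have hD : 2 ^ D ≤ 2 ^ w := by omega
    simp only [exec_rules, state_rules, Nat.zero_mod, Nat.reduceEqDiff, reduceIte, g20]
    have h27w : s'.reg 27 < 2 ^ w := by
      generalize s'.reg 27 = r at *
      omega
    -- Subtracting `2 ^ D` before doubling keeps the computation of the leaf index within a word.
    rw [sub_mod_two_pow h27 h27w,
      Nat.mod_eq_of_lt (show s'.reg 27 - 2 ^ D + (s'.reg 27 - 2 ^ D) < 2 ^ w by omega),
      show s'.reg 27 - 2 ^ D + (s'.reg 27 - 2 ^ D) + s'.reg 24 = y by omega,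
      Nat.mod_eq_of_lt (by omega)]
    have : h₀ * 10 ≤ D * 10 := by omega
    exact ⟨by omega, hyx, hey, hmaxy⟩

theorem runs_treeFind {s : State} {a b D x e : ℕ} {V : ℕ → ℕ} (h1 : s.reg 1 = 1)
    (h2 : s.reg 2 = 0) (h20 : s.reg 20 = 2 ^ D) (hx : s.reg 21 = x) (he : s.reg 22 = e)
    (hxD : x < 2 ^ (D + 1)) (hw : 2 ^ (D + 1) ≤ 2 ^ w) (hw1 : 1 < 2 ^ w) (hcap : 2 ^ (D + 1) ≤ cap)
    (hT : TreeInv D V (s.mem a) (s.mem b)) (he1 : 1 ≤ e) :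
    Runs w T cap (treeFind a b) s fun t s' => t ≤ (D + 1) * 20 + 12 ∧
      (s'.reg 26 = 0 ∧ (∀ z < x, V z < e) ∨
      s'.reg 26 = 1 ∧ s'.reg 27 < x ∧ e ≤ V (s'.reg 27) ∧
        ∀ z < x, e ≤ V z → z ≤ s'.reg 27) := by
  unfold treeFind
  rw [runs_seq]
  refine (runs_treeClimb h1 h2 h20 hx he hxD hw hw1 hcap hT he1).mono ?_
  rintro t₁ s₁ hF ⟨ht1, hc⟩
  have g1 : s₁.reg 1 = 1 := by rw [hF.reg 1 rfl, h1]
  rw [runs_ite]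
  simp only [Cond.holds_eq, g1]
  rcases hc with ⟨h26, hno⟩ | ⟨h26, h, hh, hr1, hr2, hex, hmax, hlt⟩
  · refine ⟨fun h => by omega, fun _ => ?_⟩
    rw [runs_skip]
    exact ⟨by omega, .inl ⟨h26, hno⟩⟩
  · refine ⟨fun _ => ?_, fun h => absurd h26 h⟩
    refine (runs_treeDescend (a := a) (x := x) (by rw [hF.reg 20 rfl, h20])
      (by rw [hF.reg 22 rfl, he]) hw hw1 hcap
      (by rw [hF.mem a rfl, hF.mem b rfl]; exact hT) he1 rfl hh hr1 hr2 hex hmax hlt).mono ?_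
    rintro t₂ s₂ hF2 ⟨ht2, h3⟩
    exact ⟨by omega, .inr ⟨by rw [hF2.reg 26 rfl, h26], h3⟩⟩

end

/-! ### Computing the length of an s-factor -/

section

variable {α : Type u} [LinearOrder α] {w cap D : ℕ} {T : List α} {R : List (α × ℕ)}
  {ord pos cr : ℕ → ℕ}

/-- The context of the factorization: bounds, and the sorted suffixes. -/
structure Ctx (R : List (α × ℕ)) (w cap D : ℕ) (ord pos cr : ℕ → ℕ) : Prop where
  normal : Normal R
  one_le : 1 ≤ R.length
  word : (val R).length < 2 ^ w
  cap_le : 2 * R.length + 1 ≤ cap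
  length_le : R.length ≤ 2 ^ (D + 1)
  leaves_le : 2 ^ (D + 1) ≤ 2 * R.length
  leaves_word : 2 ^ (D + 1) ≤ 2 ^ w
  sorted : SortedBy (fun i => toLex (charKey R i, sfx R (i + 1))) R.length ord
  pos_ord : ∀ t < R.length, pos (ord t) = t
  cr_eq : ∀ i < R.length, cr i = rankOf (charKey R) R.length i

namespace Ctx

variable (C : Ctx R w cap D ord pos cr) {i j : ℕ}
include C

theorem length_word : R.length < 2 ^ w := by
  have := C.normal.le_bnd le_rfl
  rw [bnd_length] at this
  have := C.word
  omega

theorem ord_pos (hi : i < R.length) : ord (pos i) = i := by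
  obtain ⟨t, ht, rfl⟩ := C.sorted.surj hi
  rw [C.pos_ord t ht]

theorem pos_lt (hi : i < R.length) : pos i < R.length := by
  obtain ⟨t, ht, rfl⟩ := C.sorted.surj hi
  rwa [C.pos_ord t ht]

theorem pos_inj (hi : i < R.length) (hj : j < R.length) (h : pos i = pos j) : i = j := by
  rw [← C.ord_pos hi, h, C.ord_pos hj]

theorem cr_eq_iff (hi : i < R.length) (hj : j < R.length) : cr i = cr j ↔ chr R i = chr R j := by
  rw [C.cr_eq i hi, C.cr_eq j hj, rankOf_eq_iff hi hj, charKey_eq_iff hi hj]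

theorem cr_lt (hi : i < R.length) : cr i < R.length := by
  rw [C.cr_eq i hi]; exact rankOf_lt hi

/-- Equal characters at both ends force the same character in between, so the three runs are ordered
by what follows them and `lcp_val_le_of_between` applies. Therefore the nearest candidate on each
side is the best one there. -/
theorem lce_between {x y z : ℕ} (hxy : x ≤ y) (hyz : y ≤ z) (hz : z < R.length)
    (hc : chr R (ord x) = chr R (ord z)) :
    chr R (ord y) = chr R (ord z) ∧
      lce R (ord x + 1) (ord z + 1) ≤ lce R (ord x + 1) (ord y + 1) ∧
      lce R (ord x + 1) (ord z + 1) ≤ lce R (ord y + 1) (ord z + 1) := by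
  have hx : ord x < R.length := C.sorted.lt x (by omega)
  have hy : ord y < R.length := C.sorted.lt y (by omega)
  have hz' : ord z < R.length := C.sorted.lt z hz
  have h1 := C.sorted.mono x y hxy (by omega)
  have h2 := C.sorted.mono y z hyz hz
  rw [← charKey_eq_iff hx hz'] at hc
  rw [← charKey_eq_iff hy hz']
  rw [Prod.Lex.toLex_le_toLex] at h1 h2
  simp only at h1 h2
  have h3 : charKey R (ord x) ≤ charKey R (ord y) := by
    rcases h1 with h | h
    · exact h.le
    · exact h.1.le
  have h4 : charKey R (ord y) ≤ charKey R (ord z) := by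
    rcases h2 with h | h
    · exact h.le
    · exact h.1.le
  have e1 : charKey R (ord y) = charKey R (ord z) := le_antisymm h4 (hc ▸ h3)
  have e2 : charKey R (ord x) = charKey R (ord y) := hc.trans e1.symm
  have h5 : sfx R (ord x + 1) ≤ sfx R (ord y + 1) := by
    rcases h1 with h | h
    · exact absurd e2 h.ne
    · exact h.2
  have h6 : sfx R (ord y + 1) ≤ sfx R (ord z + 1) := by
    rcases h2 with h | h
    · exact absurd e1 h.ne
    · exact h.2
  unfold sfx at h5 h6
  rw [← List.map_drop, ← List.map_drop] at h5 h6
  exact ⟨e1, lcp_val_le_of_between (C.normal.drop _) (C.normal.drop _) (C.normal.drop _) h5 h6⟩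

end Ctx

theorem lce_comm (i j : ℕ) : lce R i j = lce R j i := lcp_comm _ _

theorem lce_eq {i j : ℕ} (hR : Normal R) (hi : i < R.length) (hj : j < R.length) :
    lce R i j = if chr R i = chr R j then
      if ex R i = ex R j then ex R i + lce R (i + 1) (j + 1) else min (ex R i) (ex R j) else 0 := by
  have h1 := hR.drop i
  have h2 := hR.drop j
  rw [List.drop_eq_getElem_cons hi] at h1
  rw [List.drop_eq_getElem_cons hj] at h2
  rw [lce, List.drop_eq_getElem_cons hi, List.drop_eq_getElem_cons hj, lcp_val_cons h1 h2,
    chr_eq hi, chr_eq hj, ex_eq hi, ex_eq hj]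
  simp only [Option.some.injEq]
  rfl

theorem lce_of_le {i j : ℕ} (hi : R.length ≤ i) : lce R i j = 0 := by
  rw [lce, List.drop_of_length_le hi, val_nil, lcp_nil_left]

theorem bnd_add_lce_le {i j : ℕ} : bnd R i + lce R i j ≤ (val R).length := by
  have h1 := lcp_le_left (val (R.drop i)) (val (R.drop j))
  have h2 : (val R).length = bnd R i + (val (R.drop i)).length := by
    conv_lhs => rw [← List.take_append_drop i R, val_append, List.length_append]
    rfl
  unfold lce
  omega

/-! ### Search structures for the runs already passed. -/

/-- The registers and arrays that do not change during the factorization. -/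
structure Static (R : List (α × ℕ)) (D : ℕ) (ord pos cr : ℕ → ℕ) (s : State) : Prop where
  r0 : s.reg 0 = R.length
  r1 : s.reg 1 = 1
  r2 : s.reg 2 = 0
  r20 : s.reg 20 = 2 ^ D
  m0 : s.mem 0 = ex R
  m3 : s.mem 3 = ord
  m5 : s.mem 5 = cr
  m8 : s.mem 8 = pos

theorem Static.frame {s s' : State} {c : Cmd} (h : Static R D ord pos cr s) (hF : Frame c s s')
    (hc : (c.writesReg 0 || c.writesReg 1 || c.writesReg 2 || c.writesReg 20 ||
      c.writesArr 0 || c.writesArr 3 || c.writesArr 5 || c.writesArr 8) = false) :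
    Static R D ord pos cr s' := by
  simp only [Bool.or_eq_false_iff] at hc
  obtain ⟨⟨⟨⟨⟨⟨⟨c0, c1⟩, c2⟩, c20⟩, a0⟩, a3⟩, a5⟩, a8⟩ := hc
  exact ⟨by rw [hF.reg 0 c0, h.r0], by rw [hF.reg 1 c1, h.r1], by rw [hF.reg 2 c2, h.r2],
    by rw [hF.reg 20 c20, h.r20], by rw [hF.mem 0 a0, h.m0], by rw [hF.mem 3 a3, h.m3],
    by rw [hF.mem 5 a5, h.m5], by rw [hF.mem 8 a8, h.m8]⟩

/-- The exponents of the runs before run `i`, at their positions in the sorted order. -/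
def leafVal (R : List (α × ℕ)) (ord : ℕ → ℕ) (i x : ℕ) : ℕ :=
  if x < R.length ∧ ord x < i then ex R (ord x) else 0

/-- The values of the leaves in reverse order. -/
def leafValRev (R : List (α × ℕ)) (ord : ℕ → ℕ) (i x : ℕ) : ℕ :=
  if x < R.length then leafVal R ord i (R.length - 1 - x) else 0

/-- The runs before run `i` have been inserted into the search structures. -/
structure Inserted (R : List (α × ℕ)) (D : ℕ) (ord cr : ℕ → ℕ) (i : ℕ) (s : State) : Prop where
  left : TreeInv D (leafVal R ord i) (s.mem 9) (s.mem 10)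
  right : TreeInv D (leafValRev R ord i) (s.mem 11) (s.mem 12)
  le_max : ∀ j < R.length, ∀ j' < i, chr R j' = chr R j → ex R j' ≤ s.mem 13 (cr j)
  max_eq : ∀ j < R.length, s.mem 13 (cr j) ≠ 0 →
    ∃ j' < i, chr R j' = chr R j ∧ ex R j' = s.mem 13 (cr j)

theorem Inserted.frame {s s' : State} {c : Cmd} {i : ℕ} (h : Inserted R D ord cr i s)
    (hF : Frame c s s') (hc : (c.writesArr 9 || c.writesArr 10 || c.writesArr 11 ||
      c.writesArr 12 || c.writesArr 13) = false) : Inserted R D ord cr i s' := by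
  simp only [Bool.or_eq_false_iff] at hc
  obtain ⟨⟨⟨⟨a9, a10⟩, a11⟩, a12⟩, a13⟩ := hc
  refine ⟨?_, ?_, ?_, ?_⟩
  · rw [hF.mem 9 a9, hF.mem 10 a10]; exact h.left
  · rw [hF.mem 11 a11, hF.mem 12 a12]; exact h.right
  · rw [hF.mem 13 a13]; exact h.le_max
  · rw [hF.mem 13 a13]; exact h.max_eq

theorem Ctx.leafVal_succ (C : Ctx R w cap D ord pos cr) {i : ℕ} (hi : i < R.length) :
    leafVal R ord (i + 1) = Function.update (leafVal R ord i) (pos i) (ex R i) := by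
  funext x
  rw [Function.update_apply]
  unfold leafVal
  split_ifs with h1 h2 h3 h4 h5
  · rw [h2, C.ord_pos hi]
  · rfl
  · exfalso
    have : ord x = i := by omega
    exact h2 (by rw [← this, C.pos_ord x h1.1])
  · exfalso
    rw [h4, C.ord_pos hi] at h1
    exact h1 ⟨C.pos_lt hi, by omega⟩
  · omega
  · rfl

/-- In the mirrored tree the first candidate to the right becomes the last candidate before a leaf,
so one search routine serves both sides. -/
theorem Ctx.leafValRev_succ (C : Ctx R w cap D ord pos cr) {i : ℕ} (hi : i < R.length) :
    leafValRev R ord (i + 1) =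
      Function.update (leafValRev R ord i) (R.length - 1 - pos i) (ex R i) := by
  funext x
  have := C.pos_lt hi
  unfold leafValRev
  rw [C.leafVal_succ hi, Function.update_apply, Function.update_apply]
  split_ifs <;> first | rfl | omega

theorem Ctx.leafVal_pos (C : Ctx R w cap D ord pos cr) {i j : ℕ} (hi : i < R.length) :
    leafVal R ord j (pos i) = if i < j then ex R i else 0 := by
  unfold leafVal
  rw [C.ord_pos hi]
  simp [C.pos_lt hi]

/-- Insert run `i` (register `30`) into the search structures. -/
def insertCmd : Cmd :=
  .load 21 8 30 ;; .load 22 0 30 ;; treeInsert 9 10 ;;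
  .op .sub 21 0 21 ;; .op .sub 21 21 1 ;; treeInsert 11 12 ;;
  .load 23 5 30 ;; .load 24 13 23 ;; .ite (.lt 24 22) (.store 13 23 22) .skip

theorem runs_insertCmd (C : Ctx R w cap D ord pos cr) {s : State} {i : ℕ}
    (hS : Static R D ord pos cr s) (hI : Inserted R D ord cr i s) (h30 : s.reg 30 = i)
    (hi : i < R.length) :
    Runs w T cap insertCmd s fun t s' => t ≤ (D + 1) * 20 + 16 ∧
      Inserted R D ord cr (i + 1) s' := by
  have hw := C.length_word
  have hcap := C.cap_le
  have hle := C.length_le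
  have hle2 := C.leaves_le
  have hp := C.pos_lt hi
  have hcr := C.cr_lt hi
  unfold insertCmd
  simp only [exec_rules, state_rules, Nat.zero_mod, Nat.reduceEqDiff, reduceIte, h30, hS.m8, hS.m0]
  refine ⟨by omega, by omega, ?_⟩
  refine (runs_treeInsert (D := D) (x := pos i) (p := ex R i) (V := leafVal R ord i)
    (by simp [hS.r1]) (by simp [hS.r2]) (by simp [hS.r20]) (by simp) (by simp) (by omega)
    C.leaves_word (by omega) (by decide) (by simpa using hI.left) ?_).mono ?_
  · rw [C.leafVal_pos hi]; simp
  rintro t₁ s₁ hF1 ⟨ht1, hT1⟩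
  have g0 : s₁.reg 0 = R.length := by rw [hF1.reg 0 rfl]; simp [hS.r0]
  have g1 : s₁.reg 1 = 1 := by rw [hF1.reg 1 rfl]; simp [hS.r1]
  have g2 : s₁.reg 2 = 0 := by rw [hF1.reg 2 rfl]; simp [hS.r2]
  have g20 : s₁.reg 20 = 2 ^ D := by rw [hF1.reg 20 rfl]; simp [hS.r20]
  have g21 : s₁.reg 21 = pos i := by rw [hF1.reg 21 rfl]; simp
  have g22 : s₁.reg 22 = ex R i := by rw [hF1.reg 22 rfl]; simp
  have g30 : s₁.reg 30 = i := by rw [hF1.reg 30 rfl]; simp [h30]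
  have k5 : s₁.mem 5 = cr := by rw [hF1.mem 5 rfl]; simp [hS.m5]
  have k11 : s₁.mem 11 = s.mem 11 := by rw [hF1.mem 11 rfl]; simp
  have k12 : s₁.mem 12 = s.mem 12 := by rw [hF1.mem 12 rfl]; simp
  have k13 : s₁.mem 13 = s.mem 13 := by rw [hF1.mem 13 rfl]; simp
  simp only [exec_rules, state_rules, Nat.zero_mod, Nat.reduceEqDiff, reduceIte, g0, g1, g21, sub_mod_two_pow hp.le hw,
    sub_mod_two_pow (show 1 ≤ R.length - pos i by omega) (show R.length - pos i < 2 ^ w by omega)]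
  refine (runs_treeInsert (D := D) (x := R.length - 1 - pos i) (p := ex R i)
    (V := leafValRev R ord i)
    (by simp [g1]) (by simp [g2]) (by simp [g20]) (by simp; omega) (by simp [g22]) (by omega)
    C.leaves_word (by omega) (by decide) (by simpa [k11, k12] using hI.right) ?_).mono ?_
  · unfold leafValRev
    rw [if_pos (by omega), show R.length - 1 - (R.length - 1 - pos i) = pos i by omega,
      C.leafVal_pos hi]
    simp
  rintro t₂ s₂ hF2 ⟨ht2, hT2⟩
  have e22 : s₂.reg 22 = ex R i := by rw [hF2.reg 22 rfl]; simp [g22]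
  have e30 : s₂.reg 30 = i := by rw [hF2.reg 30 rfl]; simp [g30]
  have l5 : s₂.mem 5 = cr := by rw [hF2.mem 5 rfl]; simp [k5]
  have l9 : s₂.mem 9 = s₁.mem 9 := by rw [hF2.mem 9 rfl]; simp
  have l10 : s₂.mem 10 = s₁.mem 10 := by rw [hF2.mem 10 rfl]; simp
  have l13 : s₂.mem 13 = s.mem 13 := by rw [hF2.mem 13 rfl]; simp [k13]
  rw [← C.leafVal_succ hi, ← l9, ← l10] at hT1
  rw [← C.leafValRev_succ hi] at hT2
  -- Array `13` holds the largest exponent per character, indexed by the rank of the character. Both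
  -- branches of the final test store this maximum, so they are treated together.
  have hmax : ∀ (M : ℕ → ℕ), M = Function.update (s.mem 13) (cr i) (max (s.mem 13 (cr i)) (ex R i)) →
      (∀ j < R.length, ∀ j' < i + 1, chr R j' = chr R j → ex R j' ≤ M (cr j)) ∧
      ∀ j < R.length, M (cr j) ≠ 0 → ∃ j' < i + 1, chr R j' = chr R j ∧ ex R j' = M (cr j) := by
    rintro M rfl
    constructor
    · intro j hj j' hj' hc
      rw [Function.update_apply]
      rcases Nat.lt_succ_iff_lt_or_eq.1 hj' with hlt | rfl
      · have := hI.le_max j hj j' hlt hc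
        split_ifs with hcr'
        · rw [← hcr']; omega
        · exact this
      · rw [if_pos ((C.cr_eq_iff hj hi).2 hc.symm)]
        exact le_max_right _ _
    · intro j hj hne
      rw [Function.update_apply] at hne ⊢
      split_ifs at hne ⊢ with hcr'
      · rcases le_total (ex R i) (s.mem 13 (cr i)) with hl | hl
        · rw [max_eq_left hl] at hne ⊢
          rw [← hcr'] at hne ⊢
          obtain ⟨j', h1, h2, h3⟩ := hI.max_eq j hj hne
          exact ⟨j', by omega, h2, h3⟩
        · rw [max_eq_right hl]
          exact ⟨i, by omega, ((C.cr_eq_iff hj hi).1 hcr').symm, rfl⟩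
      · obtain ⟨j', h1, h2, h3⟩ := hI.max_eq j hj hne
        exact ⟨j', by omega, h2, h3⟩
  simp only [exec_rules, state_rules, Nat.zero_mod, Nat.reduceEqDiff, reduceIte, e22, e30, l5, l13]
  refine ⟨by omega, by omega, fun hlt => ⟨by omega, by omega, ?_⟩, fun hlt => ⟨by omega, ?_⟩⟩
  · have hm := hmax (Function.update (s.mem 13) (cr i) (ex R i)) (by rw [max_eq_right hlt.le])
    exact ⟨by simpa using hT1, by simpa using hT2, by simpa [l13] using hm.1,
      by simpa [l13] using hm.2⟩
  · have hm := hmax (s.mem 13) (by rw [max_eq_left (by omega), Function.update_eq_self])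
    exact ⟨by simpa using hT1, by simpa using hT2, by simpa [l13] using hm.1,
      by simpa [l13] using hm.2⟩

/-- One step of the comparison of the suffixes that begin with the runs in registers `37` and `38`;
the length of the common prefix is accumulated in register `36`, and register `39` becomes `0` at the
first difference. -/
def matchStep : Cmd :=
  .ite (.lt 37 0)
    (.load 40 5 37 ;; .load 41 5 38 ;; .load 42 0 37 ;; .load 43 0 38 ;;
    .ite (.eq 40 41)
      (.ite (.eq 42 43)
        (.op .add 36 36 42 ;; .op .add 37 37 1 ;; .op .add 38 38 1)
        (.const 39 0 ;; .ite (.lt 42 43) (.op .add 36 36 42) (.op .add 36 36 43)))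
      (.const 39 0))
    (.const 39 0)

/-- Register `36` receives the length of the longest common prefix of the last `e` (register `31`)
characters of run `i` (register `30`) and what follows, and of the last `e` characters of run `j`
(register `35`) and what follows. -/
def matchCmd : Cmd :=
  .load 37 5 30 ;; .load 38 5 35 ;; .ite (.eq 37 38)
    (.move 36 31 ;; .op .add 37 30 1 ;; .op .add 38 35 1 ;; .const 39 1 ;;
      .while (.eq 39 1) matchStep)
    (.const 36 0)

/-- The number `k` of runs that pay for the comparison is bounded through the match length: these
runs lie entirely inside the match. This makes the naive comparison affordable in the main loop. -/
theorem runs_matchCmd (C : Ctx R w cap D ord pos cr) {s : State} {i j e : ℕ}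
    (hS : Static R D ord pos cr s) (h30 : s.reg 30 = i) (h31 : s.reg 31 = e) (h35 : s.reg 35 = j)
    (hi : i < R.length) (hj : j < i) (he : e ≤ ex R i) :
    Runs w T cap matchCmd s fun t s' =>
      s'.reg 36 = (if chr R j = chr R i then e + lce R (i + 1) (j + 1) else 0) ∧
      ∃ k, i + 1 + k ≤ R.length ∧ (k = 0 ∨ bnd R (i + 1 + k) + e ≤ bnd R (i + 1) + s'.reg 36) ∧
        t ≤ k * 14 + 28 := by
  have hw := C.length_word
  have hcap := C.cap_le
  have hwS := C.word
  have h1w : 1 < 2 ^ w := by have := C.one_le; omega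
  unfold matchCmd
  simp only [exec_rules, state_rules, Nat.zero_mod, Nat.reduceEqDiff, reduceIte, h30, h31, h35, hS.m5, hS.r1]
  refine ⟨by omega, by omega, fun hc => ?_, fun hc => ?_⟩
  · rw [C.cr_eq_iff hi (by omega)] at hc
    rw [if_pos hc.symm, Nat.mod_eq_of_lt (show i + 1 < 2 ^ w by omega),
      Nat.mod_eq_of_lt (show j + 1 < 2 ^ w by omega), Nat.mod_eq_of_lt h1w]
    have htot : bnd R (i + 1) + lce R (i + 1) (j + 1) ≤ (val R).length := bnd_add_lce_le
    have hbi : bnd R (i + 1) = bnd R i + ex R i := bnd_succ hi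
    set L := lce R (i + 1) (j + 1) with hL
    -- The number of whole runs after run `i` that fit into the common prefix, an upper bound for
    -- the successful iterations.
    let K : ℕ := Nat.findGreatest (fun k => bnd R (i + 1 + k) ≤ bnd R (i + 1) + L)
      (R.length - (i + 1))
    have hK1 : K ≤ R.length - (i + 1) := Nat.findGreatest_le _
    have hK2 : bnd R (i + 1 + K) ≤ bnd R (i + 1) + L :=
      Nat.findGreatest_spec (P := fun k => bnd R (i + 1 + k) ≤ bnd R (i + 1) + L)
        (Nat.zero_le _) (by simp)
    have hK3 : ∀ k, i + 1 + k ≤ R.length → bnd R (i + 1 + k) ≤ bnd R (i + 1) + L → k ≤ K :=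
      fun k h1 h2 => Nat.le_findGreatest (by omega) h2
    refine (runs_while (Q := fun s' => s'.reg 36 = e + L)
      (fun q s' => (s'.reg 39 = 1 ∧ ∃ k ≤ K, q = (K - k) * 14 + 14 ∧ s'.reg 37 = i + 1 + k ∧
          s'.reg 38 = j + 1 + k ∧ s'.reg 36 + bnd R (i + 1) = e + bnd R (i + 1 + k) ∧
          s'.reg 36 + lce R (i + 1 + k) (j + 1 + k) = e + L) ∨
        (s'.reg 39 = 0 ∧ q = 1 ∧ s'.reg 36 = e + L))
      (p := K * 14 + 14) (.inl ⟨by simp, 0, by omega, by simp, by simp, by simp, by simp, by simp [hL]⟩)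
      ?_ ?_).mono ?_
    · rintro q s' hF (⟨h39, k, hk, rfl, h37, h38, hb, hl⟩ | ⟨h39, -, -⟩) hcond
      swap
      · have e1 : s'.reg 1 = 1 := by rw [hF.reg 1 rfl]; simp [hS.r1]
        simp only [Cond.holds_eq, e1, h39] at hcond
        omega
      have e0 : s'.reg 0 = R.length := by rw [hF.reg 0 rfl]; simp [hS.r0]
      have e1 : s'.reg 1 = 1 := by rw [hF.reg 1 rfl]; simp [hS.r1]
      have m5 : s'.mem 5 = cr := by rw [hF.mem 5 rfl]; simp [hS.m5]
      have m0 : s'.mem 0 = ex R := by rw [hF.mem 0 rfl]; simp [hS.m0]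
      unfold matchStep
      simp only [exec_rules, state_rules, Nat.zero_mod, Nat.reduceEqDiff, reduceIte, h37, h38, h39, e0, e1, m5, m0]
      refine ⟨fun hlt => ?_, fun hge => ⟨1, by omega, .inr ⟨trivial, rfl, ?_⟩⟩⟩
      swap
      · rw [lce_of_le (by omega)] at hl
        omega
      have hbk : bnd R (i + 1 + k + 1) = bnd R (i + 1 + k) + ex R (i + 1 + k) := bnd_succ hlt
      rw [lce_eq C.normal hlt (by omega)] at hl
      refine ⟨by omega, by omega, by omega, by omega, fun hcr => ⟨fun hex => ?_, fun hex =>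
        ⟨fun h3 => ⟨1, by omega, .inr ⟨trivial, rfl, ?_⟩⟩,
          fun h3 => ⟨1, by omega, .inr ⟨trivial, rfl, ?_⟩⟩⟩⟩,
        fun hcr => ⟨1, by omega, .inr ⟨trivial, rfl, ?_⟩⟩⟩
      · rw [C.cr_eq_iff hlt (by omega)] at hcr
        rw [if_pos hcr, if_pos hex] at hl
        have hk' : k + 1 ≤ K := hK3 (k + 1) (by omega) (by
          rw [show i + 1 + (k + 1) = i + 1 + k + 1 by omega]; omega)
        rw [Nat.mod_eq_of_lt (show i + 1 + k + 1 < 2 ^ w by omega),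
          Nat.mod_eq_of_lt (show j + 1 + k + 1 < 2 ^ w by omega), Nat.mod_eq_of_lt (by omega)]
        refine ⟨(K - (k + 1)) * 14 + 14, by omega, .inl ⟨trivial, k + 1, hk', rfl, by omega, by omega,
          ?_, ?_⟩⟩
        · rw [show i + 1 + (k + 1) = i + 1 + k + 1 by omega]; omega
        · rw [show i + 1 + (k + 1) = i + 1 + k + 1 by omega,
            show j + 1 + (k + 1) = j + 1 + k + 1 by omega]; omega
      · rw [C.cr_eq_iff hlt (by omega)] at hcr
        rw [if_pos hcr, if_neg hex, min_eq_left (by omega)] at hl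
        rw [hl, Nat.mod_eq_of_lt (by omega)]
      · rw [C.cr_eq_iff hlt (by omega)] at hcr
        rw [if_pos hcr, if_neg hex, min_eq_right (by omega)] at hl
        rw [hl, Nat.mod_eq_of_lt (by omega)]
      · rw [C.cr_eq_iff hlt (by omega)] at hcr
        rw [if_neg hcr] at hl
        omega
    · rintro q s' hF (⟨h39, -⟩ | ⟨h39, rfl, h36⟩) hcond
      · have e1 : s'.reg 1 = 1 := by rw [hF.reg 1 rfl]; simp [hS.r1]
        simp only [Cond.holds_eq, e1, h39] at hcond
        exact absurd trivial hcond
      · exact ⟨le_rfl, h36⟩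
    · rintro t s' - ⟨ht, h36⟩
      exact ⟨h36, K, by omega, .inr (by omega), by omega⟩
  · rw [C.cr_eq_iff hi (by omega)] at hc
    rw [if_neg (fun h => hc h.symm)]
    refine ⟨rfl, 0, by omega, .inl rfl, by omega⟩

end

/-! ### The best match on either side and the length of the s-factor. -/

section

variable {α : Type u} [LinearOrder α] {w cap D : ℕ} {T : List α} {R : List (α × ℕ)}
  {ord pos cr : ℕ → ℕ}

/-- The length `len` is realized by an earlier run, and no run with property `p` gives more. -/
def IsMaxMatch (R : List (α × ℕ)) (i e : ℕ) (p : ℕ → Prop) (len : ℕ) : Prop :=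
  (len = 0 ∨ ∃ j < i, chr R j = chr R i ∧ e ≤ ex R j ∧ len = e + lce R (i + 1) (j + 1)) ∧
    ∀ j < i, p j → chr R j = chr R i → e ≤ ex R j → e + lce R (i + 1) (j + 1) ≤ len

/-- Update the maximum in register `33` by the length of the match with the run at the sorted
position in register `27`. -/
def candCmd : Cmd := .load 35 3 27 ;; matchCmd ;; .ite (.lt 33 36) (.move 33 36) .skip

/-- Update the maximum in register `33` by the matches to the left of run `i`. -/
def leftCmd : Cmd :=
  .load 21 8 30 ;; .move 22 31 ;; treeFind 9 10 ;; .ite (.eq 26 1) candCmd .skip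

/-- Update the maximum in register `33` by the matches to the right of run `i`. -/
def rightCmd : Cmd :=
  .load 21 8 30 ;; .op .sub 21 0 21 ;; .op .sub 21 21 1 ;; .move 22 31 ;; treeFind 11 12 ;;
  .ite (.eq 26 1) (.op .sub 27 0 27 ;; .op .sub 27 27 1 ;; candCmd) .skip

theorem runs_candCmd (C : Ctx R w cap D ord pos cr) {s : State} {i z e b : ℕ}
    (hS : Static R D ord pos cr s) (h30 : s.reg 30 = i) (h31 : s.reg 31 = e) (h27 : s.reg 27 = z)
    (h33 : s.reg 33 = b) (hi : i < R.length) (hz : z < R.length) (hj : ord z < i) (he : e ≤ ex R i) :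
    Runs w T cap candCmd s fun t s' => ∃ len,
      len = (if chr R (ord z) = chr R i then e + lce R (i + 1) (ord z + 1) else 0) ∧
      s'.reg 33 = max b len ∧
      ∃ k, i + 1 + k ≤ R.length ∧ (k = 0 ∨ bnd R (i + 1 + k) + e ≤ bnd R (i + 1) + len) ∧
        t ≤ k * 14 + 31 := by
  have hcap := C.cap_le
  unfold candCmd
  simp only [exec_rules, state_rules, Nat.zero_mod, Nat.reduceEqDiff, reduceIte, h27, hS.m3]
  refine ⟨by omega, ?_⟩
  refine (runs_matchCmd C (i := i) (j := ord z) (e := e) ?_ (by simp [h30]) (by simp [h31]) (by simp)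
    hi hj he).mono ?_
  · exact ⟨by simp [hS.r0], by simp [hS.r1], by simp [hS.r2], by simp [hS.r20], by simp [hS.m0],
      by simp [hS.m3], by simp [hS.m5], by simp [hS.m8]⟩
  rintro t₁ s₁ hF ⟨h36, k, hk1, hk2, ht⟩
  have g33 : s₁.reg 33 = b := by rw [hF.reg 33 rfl]; simp [h33]
  simp only [exec_rules, state_rules, Nat.zero_mod, Nat.reduceEqDiff, reduceIte, g33]
  exact ⟨fun hlt => ⟨_, h36, by rw [max_eq_right hlt.le], k, hk1, hk2, by omega⟩,
    fun hlt => ⟨_, h36, by rw [max_eq_left (by omega)], k, hk1, hk2, by omega⟩⟩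

theorem runs_leftCmd (C : Ctx R w cap D ord pos cr) {s : State} {i e b : ℕ}
    (hS : Static R D ord pos cr s) (hI : Inserted R D ord cr i s) (h30 : s.reg 30 = i)
    (h31 : s.reg 31 = e) (h33 : s.reg 33 = b) (hi : i < R.length) (he1 : 1 ≤ e) (he : e ≤ ex R i) :
    Runs w T cap leftCmd s fun t s' => ∃ len, IsMaxMatch R i e (fun j => pos j < pos i) len ∧
      s'.reg 33 = max b len ∧
      ∃ k, i + 1 + k ≤ R.length ∧ (k = 0 ∨ bnd R (i + 1 + k) + e ≤ bnd R (i + 1) + len) ∧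
        t ≤ (D + 1) * 20 + k * 14 + 50 := by
  have hw := C.length_word
  have hcap := C.cap_le
  have hp := C.pos_lt hi
  have hle := C.length_le
  have hle2 := C.leaves_le
  have h1w : 1 < 2 ^ w := by
    have := C.leaves_word
    have : 1 ≤ 2 ^ D := Nat.one_le_two_pow
    rw [pow_succ] at *; omega
  unfold leftCmd
  simp only [exec_rules, state_rules, Nat.zero_mod, Nat.reduceEqDiff, reduceIte, h30, h31, hS.m8]
  refine ⟨by omega, (runs_treeFind (D := D) (x := pos i) (e := e) (V := leafVal R ord i)
    (by simp [hS.r1]) (by simp [hS.r2]) (by simp [hS.r20]) (by simp) (by simp) (by omega)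
    C.leaves_word h1w (by omega) (by simpa using hI.left) he1).mono ?_⟩
  rintro t₁ s₁ hF ⟨ht, h⟩
  have hS1 : Static R D ord pos cr s₁ := by
    refine Static.frame (s := (s.setReg 21 (pos i)).setReg 22 e) ?_ hF rfl
    exact ⟨by simp [hS.r0], by simp [hS.r1], by simp [hS.r2], by simp [hS.r20], by simp [hS.m0],
      by simp [hS.m3], by simp [hS.m5], by simp [hS.m8]⟩
  have g33 : s₁.reg 33 = b := by rw [hF.reg 33 rfl]; simp [h33]
  have g30 : s₁.reg 30 = i := by rw [hF.reg 30 rfl]; simp [h30]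
  have g31 : s₁.reg 31 = e := by rw [hF.reg 31 rfl]; simp [h31]
  have hval : ∀ j < i, leafVal R ord i (pos j) = ex R j := fun j hj => by
    rw [C.leafVal_pos (by omega), if_pos hj]
  simp only [exec_rules, state_rules, Nat.zero_mod, Nat.reduceEqDiff, reduceIte, hS1.r1]
  rcases h with ⟨h26, hno⟩ | ⟨h26, hz, hez, hmax⟩
  · rw [h26]
    refine ⟨fun h => by omega, fun _ => ⟨0, ⟨.inl rfl, ?_⟩, by simp [g33], 0, by omega, .inl rfl,
      by omega⟩⟩
    intro j hj hpj _ hej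
    have := hno _ hpj
    rw [hval j hj] at this
    omega
  · refine ⟨fun _ => ?_, fun h => absurd h26 h⟩
    set z := s₁.reg 27 with hzdef
    unfold leafVal at hez
    split_ifs at hez with hzc
    swap
    · omega
    refine (runs_candCmd C hS1 g30 g31 hzdef.symm g33 hi hzc.1 hzc.2 he).mono ?_
    rintro t₂ s₂ - ⟨len, hlen, hmx, k, hk1, hk2, ht2⟩
    refine ⟨len, ⟨?_, ?_⟩, hmx, k, hk1, hk2, by omega⟩
    · split_ifs at hlen with hc
      · exact .inr ⟨ord z, hzc.2, hc, hez, hlen⟩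
      · exact .inl hlen
    · intro j hj hpj hc hej
      have hle' := hmax (pos j) hpj (by rw [hval j hj]; exact hej)
      -- The tree ignores characters. A candidate `j` further out has the character of run `i`, and
      -- so has the run found in between; hence a neighbour with another character means that this
      -- side has no candidate.
      have hb := C.lce_between hle' hz.le hp (by rw [C.ord_pos hi, C.ord_pos (by omega), hc])
      rw [C.ord_pos hi, C.ord_pos (by omega)] at hb
      rw [if_pos hb.1] at hlen
      rw [hlen, lce_comm _ (j + 1), lce_comm _ (ord z + 1)]
      exact Nat.add_le_add_left hb.2.2 _

theorem runs_rightCmd (C : Ctx R w cap D ord pos cr) {s : State} {i e b : ℕ}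
    (hS : Static R D ord pos cr s) (hI : Inserted R D ord cr i s) (h30 : s.reg 30 = i)
    (h31 : s.reg 31 = e) (h33 : s.reg 33 = b) (hi : i < R.length) (he1 : 1 ≤ e) (he : e ≤ ex R i) :
    Runs w T cap rightCmd s fun t s' => ∃ len, IsMaxMatch R i e (fun j => pos i < pos j) len ∧
      s'.reg 33 = max b len ∧
      ∃ k, i + 1 + k ≤ R.length ∧ (k = 0 ∨ bnd R (i + 1 + k) + e ≤ bnd R (i + 1) + len) ∧
        t ≤ (D + 1) * 20 + k * 14 + 54 := by
  have hw := C.length_word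
  have hcap := C.cap_le
  have hp := C.pos_lt hi
  have hle := C.length_le
  have hle2 := C.leaves_le
  have h1w : 1 < 2 ^ w := by
    have := C.leaves_word
    have : 1 ≤ 2 ^ D := Nat.one_le_two_pow
    rw [pow_succ] at *; omega
  unfold rightCmd
  simp only [exec_rules, state_rules, Nat.zero_mod, Nat.reduceEqDiff, reduceIte, h30, h31, hS.m8, hS.r0, hS.r1, sub_mod_two_pow hp.le hw,
    sub_mod_two_pow (show 1 ≤ R.length - pos i by omega) (show R.length - pos i < 2 ^ w by omega)]
  refine ⟨by omega, (runs_treeFind (D := D) (x := R.length - 1 - pos i) (e := e)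
    (V := leafValRev R ord i)
    (by simp [hS.r1]) (by simp [hS.r2]) (by simp [hS.r20]) (by simp; omega) (by simp) (by omega)
    C.leaves_word h1w (by omega) (by simpa using hI.right) he1).mono ?_⟩
  rintro t₁ s₁ hF ⟨ht, h⟩
  have hS1 : Static R D ord pos cr s₁ := by
    refine Static.frame ?_ hF rfl
    exact ⟨by simp [hS.r0], by simp [hS.r1], by simp [hS.r2], by simp [hS.r20], by simp [hS.m0],
      by simp [hS.m3], by simp [hS.m5], by simp [hS.m8]⟩
  have g33 : s₁.reg 33 = b := by rw [hF.reg 33 rfl]; simp [h33]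
  have g30 : s₁.reg 30 = i := by rw [hF.reg 30 rfl]; simp [h30]
  have g31 : s₁.reg 31 = e := by rw [hF.reg 31 rfl]; simp [h31]
  have hval : ∀ j < i, leafValRev R ord i (R.length - 1 - pos j) = ex R j := fun j hj => by
    have := C.pos_lt (show j < R.length by omega)
    rw [leafValRev, if_pos (by omega), show R.length - 1 - (R.length - 1 - pos j) = pos j by omega,
      C.leafVal_pos (by omega), if_pos hj]
  rcases h with ⟨h26, hno⟩ | ⟨h26, hz, hez, hmax⟩
  · simp only [exec_rules, state_rules, Nat.zero_mod, Nat.reduceEqDiff, reduceIte, hS1.r1, h26]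
    refine ⟨fun h => by simp at h, fun _ => ⟨0, ⟨.inl rfl, ?_⟩, by simp [g33], 0, by omega, .inl rfl,
      by omega⟩⟩
    intro j hj hpj _ hej
    have := C.pos_lt (show j < R.length by omega)
    have := hno (R.length - 1 - pos j) (by omega)
    rw [hval j hj] at this
    omega
  · set z := s₁.reg 27 with hzdef
    simp only [exec_rules, state_rules, Nat.zero_mod, Nat.reduceEqDiff, reduceIte, hS1.r1, hS1.r0, h26, ← hzdef, sub_mod_two_pow (show z ≤ R.length by omega) hw,
      sub_mod_two_pow (show 1 ≤ R.length - z by omega) (show R.length - z < 2 ^ w by omega)]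
    refine ⟨fun _ => ?_, fun h => absurd trivial h⟩
    have hzn : z < R.length := by omega
    rw [leafValRev, if_pos hzn] at hez
    unfold leafVal at hez
    split_ifs at hez with hzc
    swap
    · omega
    set y := R.length - 1 - z with hy
    refine (runs_candCmd C (i := i) (e := e) (z := y) (b := b) ?_ (by simp [g30]) (by simp [g31])
      (by simp; omega) (by simp [g33]) hi hzc.1 hzc.2 he).mono ?_
    · exact ⟨by simp [hS1.r0], by simp [hS1.r1], by simp [hS1.r2], by simp [hS1.r20],
        by simp [hS1.m0], by simp [hS1.m3], by simp [hS1.m5], by simp [hS1.m8]⟩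
    rintro t₂ s₂ - ⟨len, hlen, hmx, k, hk1, hk2, ht2⟩
    refine ⟨len, ⟨?_, ?_⟩, hmx, k, hk1, hk2, by omega⟩
    · split_ifs at hlen with hc
      · exact .inr ⟨ord y, hzc.2, hc, hez, hlen⟩
      · exact .inl hlen
    · intro j hj hpj hc hej
      have hpj' := C.pos_lt (show j < R.length by omega)
      have hle' := hmax (R.length - 1 - pos j) (by omega) (by rw [hval j hj]; exact hej)
      have hb := C.lce_between (x := pos i) (y := y) (z := pos j) (by omega) (by omega) hpj'
        (by rw [C.ord_pos hi, C.ord_pos (by omega), hc])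
      rw [C.ord_pos hi, C.ord_pos (by omega)] at hb
      rw [if_pos (hb.1.trans hc)] at hlen
      rw [hlen]
      exact Nat.add_le_add_left hb.2.1 _

/-- Compute the length of the s-factor that begins `e` (register `31`) positions before the end of
run `i` (register `30`) in register `33`. -/
def factorCmd : Cmd :=
  .const 33 0 ;; leftCmd ;; rightCmd ;;
  .ite (.eq 33 2)
    (.load 37 0 30 ;; .ite (.lt 31 37) (.move 33 31)
      (.load 37 5 30 ;; .load 33 13 37 ;; .ite (.eq 33 2) (.const 33 1) .skip))
    .skip

/-- Every candidate gives at least `e ≥ 1`, so a maximum of `0` signals that there is none and leads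
to the remaining cases of `FactorLen`. -/
theorem runs_factorCmd (C : Ctx R w cap D ord pos cr) {s : State} {i e : ℕ}
    (hS : Static R D ord pos cr s) (hI : Inserted R D ord cr i s) (h30 : s.reg 30 = i)
    (h31 : s.reg 31 = e) (hi : i < R.length) (he1 : 1 ≤ e) (he : e ≤ ex R i) :
    Runs w T cap factorCmd s fun t s' => FactorLen R i e (s'.reg 33) ∧
      ∃ k, i + 1 + k ≤ R.length ∧ (k = 0 ∨ bnd R (i + 1 + k) + e ≤ bnd R (i + 1) + s'.reg 33) ∧
        t ≤ (D + 1) * 40 + k * 28 + 120 := by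
  have hw := C.length_word
  have hcap := C.cap_le
  have hcri := C.cr_lt hi
  have h1w : 1 < 2 ^ w := by have := C.one_le; omega
  unfold factorCmd
  simp only [exec_rules, state_rules, Nat.zero_mod, Nat.reduceEqDiff, reduceIte, ]
  have hS0 : Static R D ord pos cr (s.setReg 33 0) :=
    ⟨by simp [hS.r0], by simp [hS.r1], by simp [hS.r2], by simp [hS.r20], by simp [hS.m0],
      by simp [hS.m3], by simp [hS.m5], by simp [hS.m8]⟩
  have hI0 : Inserted R D ord cr i (s.setReg 33 0) :=
    ⟨by simpa using hI.left, by simpa using hI.right, by simpa using hI.le_max,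
      by simpa using hI.max_eq⟩
  refine (runs_leftCmd C hS0 hI0 (by simp [h30]) (by simp [h31]) (b := 0) (by simp)
    hi he1 he).mono ?_
  rintro t₁ s₁ hF1 ⟨l₁, hl1, hr1, k₁, hk1, hkl1, ht1⟩
  have hS1 := hS0.frame hF1 rfl
  have hI1 := hI0.frame hF1 rfl
  have e30 : s₁.reg 30 = i := by rw [hF1.reg 30 rfl]; simp [h30]
  have e31 : s₁.reg 31 = e := by rw [hF1.reg 31 rfl]; simp [h31]
  refine (runs_rightCmd C hS1 hI1 e30 e31 hr1 hi he1 he).mono ?_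
  rintro t₂ s₂ hF2 ⟨l₂, hl2, hr2, k₂, hk2, hkl2, ht2⟩
  have hS2 := hS1.frame hF2 rfl
  have hI2 := hI1.frame hF2 rfl
  have g30 : s₂.reg 30 = i := by rw [hF2.reg 30 rfl, e30]
  have g31 : s₂.reg 31 = e := by rw [hF2.reg 31 rfl, e31]
  rw [Nat.zero_max] at hr2
  have hall : ∀ j < i, chr R j = chr R i → e ≤ ex R j →
      e + lce R (i + 1) (j + 1) ≤ max l₁ l₂ := by
    intro j hj hc hej
    rcases lt_trichotomy (pos j) (pos i) with h | h | h
    · exact (hl1.2 j hj h hc hej).trans (le_max_left _ _)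
    · exact absurd (C.pos_inj (by omega) hi h) hj.ne
    · exact (hl2.2 j hj h hc hej).trans (le_max_right _ _)
  have hone : max l₁ l₂ = 0 ∨
      ∃ j < i, chr R j = chr R i ∧ e ≤ ex R j ∧ max l₁ l₂ = e + lce R (i + 1) (j + 1) := by
    rcases max_choice l₁ l₂ with h | h
    · rw [h]; exact hl1.1
    · rw [h]; exact hl2.1
  -- Both comparisons are charged to the larger count, which doubles its factor to `28`.
  have hk : ∃ k, i + 1 + k ≤ R.length ∧
      (k = 0 ∨ bnd R (i + 1 + k) + e ≤ bnd R (i + 1) + max l₁ l₂) ∧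
      t₁ + t₂ ≤ (D + 1) * 40 + k * 28 + 104 := by
    have h1 := le_max_left l₁ l₂
    have h2 := le_max_right l₁ l₂
    rcases le_total k₁ k₂ with h | h
    · exact ⟨k₂, hk2, by omega, by omega⟩
    · exact ⟨k₁, hk1, by omega, by omega⟩
  obtain ⟨k, hk1', hkl, ht⟩ := hk
  simp only [exec_rules, state_rules, Nat.zero_mod, Nat.reduceEqDiff, reduceIte, hr2, hS2.r2, g30, g31, hS2.m0, hS2.m5]
  constructor
  · intro hz
    rw [hz] at hkl hall
    have hk0 : k = 0 := by
      rcases hkl with h | h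
      · exact h
      · have := bnd_mono (R := R) (show i + 1 ≤ i + 1 + k by omega) hk1'
        omega
    subst hk0
    have hno : ∀ j < i, chr R j = chr R i → ex R j < e := by
      intro j hj hc
      by_contra hge
      have := hall j hj hc (by omega)
      omega
    refine ⟨by omega, fun hlt => ⟨.inr ⟨hno, .inl ⟨hlt, rfl⟩⟩, 0, by omega, .inl rfl, by omega⟩,
      fun hge => ⟨by omega, by omega, fun hz' => ⟨?_, 0, by omega, .inl rfl, by omega⟩,
        fun hnz => ⟨?_, 0, by omega, .inl rfl, by omega⟩⟩⟩
    · rw [Nat.mod_eq_of_lt h1w]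
      refine .inr ⟨hno, .inr ⟨by omega, .inr ⟨fun j hj hc => ?_, rfl⟩⟩⟩
      have := hI2.le_max i hi j hj hc
      have := C.normal.ex_pos (show j < R.length by omega)
      omega
    · obtain ⟨j, hj, hc, hm⟩ := hI2.max_eq i hi hnz
      exact .inr ⟨hno, .inr ⟨by omega, .inl ⟨j, hj, hc, hm, fun j' hj' hc' =>
        hI2.le_max i hi j' hj' hc'⟩⟩⟩
  · intro hnz
    refine ⟨.inl ?_, k, hk1', hkl, by omega⟩
    obtain ⟨j, hj, hc, hej, hm⟩ := hone.resolve_left hnz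
    refine ⟨j, hj, hc, hej, hm, fun j' hj' hc' hej' => ?_⟩
    have := hall j' hj' hc' hej'
    omega

end

/-! ### The factorization loop -/

section

variable {α : Type u} [LinearOrder α] {w cap D : ℕ} {T : List α} {R : List (α × ℕ)}
  {ord pos cr : ℕ → ℕ}

/-- The position `P` of the string is `e` positions before the end of run `i`; at the end of the
string, `i` is the number of runs and `e = 1`. -/
def IsPos (R : List (α × ℕ)) (i e P : ℕ) : Prop :=
  i < R.length ∧ 1 ≤ e ∧ e ≤ ex R i ∧ P + e = bnd R (i + 1) ∨
    i = R.length ∧ e = 1 ∧ P = (val R).length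

theorem IsPos.one_le {i e P : ℕ} (h : IsPos R i e P) : 1 ≤ e := by
  rcases h with h | h <;> omega

theorem IsPos.le_length {i e P : ℕ} (h : IsPos R i e P) : i ≤ R.length := by
  rcases h with h | h <;> omega

theorem IsPos.bnd_le {i e P : ℕ} (h : IsPos R i e P) : bnd R i ≤ P := by
  rcases h with ⟨hi, h1, h2, h3⟩ | ⟨rfl, -, rfl⟩
  · rw [bnd_succ hi] at h3; omega
  · rw [bnd_length]

theorem IsPos.le_val {i e P : ℕ} (h : IsPos R i e P) : P ≤ (val R).length := by
  rcases h with ⟨hi, h1, h2, h3⟩ | ⟨rfl, -, rfl⟩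
  · have := bnd_mono (R := R) (show i + 1 ≤ R.length by omega) le_rfl
    rw [bnd_length] at this; omega
  · rfl

theorem IsPos.le_of_bnd_le {i e P j : ℕ} (h : IsPos R i e P) (hj : j ≤ R.length)
    (hb : bnd R j ≤ P) : j ≤ i := by
  rcases h with ⟨hi, h1, h2, h3⟩ | ⟨rfl, -, rfl⟩
  · by_contra hc
    have := bnd_mono (R := R) (show i + 1 ≤ j by omega) hj
    omega
  · exact hj

/-- The first position of run `i`. -/
theorem isPos_bnd {i : ℕ} (hR : Normal R) (hi : i ≤ R.length) :
    IsPos R i (if i < R.length then ex R i else 1) (bnd R i) := by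
  split_ifs with h
  · exact .inl ⟨h, hR.ex_pos h, le_rfl, (bnd_succ h).symm⟩
  · obtain rfl : i = R.length := by omega
    exact .inr ⟨rfl, rfl, bnd_length⟩

/-- Advance the position in registers `30` and `31` by register `33`, and insert the runs that are
passed. -/
def walkCmd : Cmd :=
  .move 34 33 ;;
  .while (.le 31 34)
    (.op .sub 34 34 31 ;; insertCmd ;; .op .add 30 30 1 ;;
      .ite (.lt 30 0) (.load 31 0 30) (.move 31 1)) ;;
  .op .sub 31 31 34

/-- The walk ends in the last run `m` whose beginning is not beyond `P + len`, with `r` counting the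
characters still to go. Each run passed is inserted once, so the cost is proportional to `i' - i`.
-/
theorem runs_walkCmd (C : Ctx R w cap D ord pos cr) {s : State} {i e P len : ℕ}
    (hS : Static R D ord pos cr s) (hI : Inserted R D ord cr i s) (h30 : s.reg 30 = i)
    (h31 : s.reg 31 = e) (h33 : s.reg 33 = len) (hP : IsPos R i e P)
    (hlen : P + len ≤ (val R).length) :
    Runs w T cap walkCmd s fun t s' => ∃ i' e', i ≤ i' ∧ s'.reg 30 = i' ∧ s'.reg 31 = e' ∧
      IsPos R i' e' (P + len) ∧ Inserted R D ord cr i' s' ∧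
      t ≤ (i' - i) * ((D + 1) * 20 + 24) + 4 := by
  have hw := C.length_word
  have hcap := C.cap_le
  have hwS := C.word
  have h1w : 1 < 2 ^ w := by have := C.one_le; omega
  set K := (D + 1) * 20 + 24 with hK
  obtain ⟨m, hm1, hm2, hm3⟩ : ∃ m ≤ R.length, bnd R m ≤ P + len ∧
      ∀ j ≤ R.length, bnd R j ≤ P + len → j ≤ m :=
    ⟨Nat.findGreatest (fun k => bnd R k ≤ P + len) R.length, Nat.findGreatest_le _,
      Nat.findGreatest_spec (P := fun k => bnd R k ≤ P + len) (Nat.zero_le _) (by simp [bnd_zero]),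
      fun j h1 h2 => Nat.le_findGreatest h1 h2⟩
  unfold walkCmd
  simp only [exec_rules, state_rules, Nat.zero_mod, Nat.reduceEqDiff, reduceIte, h33]
  refine (runs_while (Q := fun s' => ∃ r, ∃ e', s'.reg 30 = m ∧ s'.reg 31 = e' ∧ s'.reg 34 = r ∧
      r < e' ∧ IsPos R m e' (P + len - r) ∧ r ≤ P + len ∧ Inserted R D ord cr m s')
    (fun q s' => ∃ i' e' r, i ≤ i' ∧ i' ≤ m ∧ s'.reg 30 = i' ∧ s'.reg 31 = e' ∧ s'.reg 34 = r ∧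
      IsPos R i' e' (P + len - r) ∧ r ≤ P + len ∧ Inserted R D ord cr i' s' ∧
      q = (m - i') * K + 1)
    (p := (m - i) * K + 1) ?_ ?_ ?_).mono ?_
  · refine ⟨i, e, len, le_rfl, hm3 i hP.le_length (hP.bnd_le.trans (by omega)), by simp [h30],
      by simp [h31], by simp, by simpa using hP, by omega, ?_, rfl⟩
    exact ⟨by simpa using hI.left, by simpa using hI.right, by simpa using hI.le_max,
      by simpa using hI.max_eq⟩
  · rintro q s₁ hF ⟨i₁, e₁, r, hi1, him, g30, g31, g34, hP1, hr, hI1, rfl⟩ hb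
    have hS1 : Static R D ord pos cr s₁ := by
      refine Static.frame ?_ hF rfl
      exact ⟨by simp [hS.r0], by simp [hS.r1], by simp [hS.r2], by simp [hS.r20], by simp [hS.m0],
        by simp [hS.m3], by simp [hS.m5], by simp [hS.m8]⟩
    simp only [Cond.holds_le, g31, g34] at hb
    have he1 := hP1.one_le
    -- At the end of the string `e = 1` while nothing remains to walk, so the loop condition cannot
    -- hold there.
    have hin : i₁ < R.length := by
      rcases hP1 with h | h <;> omega
    have hPe : P + len - r + e₁ = bnd R (i₁ + 1) := by
      rcases hP1 with h | h <;> omega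
    have him' : i₁ + 1 ≤ m := hm3 (i₁ + 1) hin (by omega)
    have hrw : r < 2 ^ w := by omega
    simp only [exec_rules, state_rules, Nat.zero_mod, Nat.reduceEqDiff, reduceIte, g31, g34, sub_mod_two_pow hb hrw]
    refine (runs_insertCmd C (i := i₁) ?_ ?_ (by simp [g30]) hin).mono ?_
    · exact ⟨by simp [hS1.r0], by simp [hS1.r1], by simp [hS1.r2], by simp [hS1.r20],
        by simp [hS1.m0], by simp [hS1.m3], by simp [hS1.m5], by simp [hS1.m8]⟩
    · exact ⟨by simpa using hI1.left, by simpa using hI1.right, by simpa using hI1.le_max,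
        by simpa using hI1.max_eq⟩
    rintro t₂ s₂ hF2 ⟨ht2, hI2⟩
    have k0 : s₂.reg 0 = R.length := by rw [hF2.reg 0 rfl]; simp [hS1.r0]
    have k1 : s₂.reg 1 = 1 := by rw [hF2.reg 1 rfl]; simp [hS1.r1]
    have k30 : s₂.reg 30 = i₁ := by rw [hF2.reg 30 rfl]; simp [g30]
    have k34 : s₂.reg 34 = r - e₁ := by rw [hF2.reg 34 rfl]; simp
    have k0' : s₂.mem 0 = ex R := by rw [hF2.mem 0 rfl]; simp [hS1.m0]
    have hpos := isPos_bnd (i := i₁ + 1) C.normal hin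
    have hpe : P + len - (r - e₁) = bnd R (i₁ + 1) := by omega
    have hmul : (m - i₁) * K = (m - (i₁ + 1)) * K + K := by
      rw [← Nat.succ_mul]; congr 1; omega
    simp only [exec_rules, state_rules, Nat.zero_mod, Nat.reduceEqDiff, reduceIte, k0, k1, k30, k34, k0', Nat.mod_eq_of_lt (show i₁ + 1 < 2 ^ w by omega)]
    refine ⟨fun hlt => ⟨by omega, (m - (i₁ + 1)) * K + 1, by omega, i₁ + 1, ex R (i₁ + 1), r - e₁,
      by omega, him', by simp, by simp, by simp [k34], ?_, by omega, ?_, rfl⟩,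
      fun hge => ⟨(m - (i₁ + 1)) * K + 1, by omega, i₁ + 1, 1, r - e₁,
      by omega, him', by simp, by simp, by simp [k34], ?_, by omega, ?_, rfl⟩⟩
    · rw [if_pos hlt] at hpos; rwa [hpe]
    · exact ⟨by simpa using hI2.left, by simpa using hI2.right, by simpa using hI2.le_max,
        by simpa using hI2.max_eq⟩
    · rw [if_neg hge] at hpos; rwa [hpe]
    · exact ⟨by simpa using hI2.left, by simpa using hI2.right, by simpa using hI2.le_max,
        by simpa using hI2.max_eq⟩
  · rintro q s₁ hF ⟨i₁, e₁, r, hi1, him, g30, g31, g34, hP1, hr, hI1, rfl⟩ hb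
    simp only [Cond.holds_le, g31, g34] at hb
    obtain rfl : i₁ = m := by
      refine le_antisymm him ?_
      rcases hP1 with ⟨h1, h2, h3, h4⟩ | ⟨h1, h2, h3⟩
      · by_contra hc
        have := bnd_mono (R := R) (show i₁ + 1 ≤ m by omega) hm1
        omega
      · omega
    exact ⟨by omega, r, e₁, g30, g31, g34, by omega, hP1, hr, hI1⟩
  · rintro t₁ s₁ hF ⟨ht, r, e₁, g30, g31, g34, hre, hP1, hr, hI1⟩
    have hew : e₁ < 2 ^ w := by
      rcases hP1 with ⟨h1, h2, h3, h4⟩ | ⟨h1, h2, h3⟩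
      · have := bnd_mono (R := R) (show m + 1 ≤ R.length by omega) le_rfl
        rw [bnd_length] at this
        omega
      · omega
    simp only [exec_rules, state_rules, Nat.zero_mod, Nat.reduceEqDiff, reduceIte, g31, g34, sub_mod_two_pow hre.le hew]
    refine ⟨m, e₁ - r, hm3 i hP.le_length (hP.bnd_le.trans (by omega)), by simp [g30], by simp, ?_, ?_,
      by omega⟩
    · rcases hP1 with ⟨h1, h2, h3, h4⟩ | ⟨h1, h2, h3⟩
      · exact .inl ⟨h1, by omega, by omega, by omega⟩
      · exact .inr ⟨h1, by omega, by omega⟩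
    · exact ⟨by simpa using hI1.left, by simpa using hI1.right, by simpa using hI1.le_max,
        by simpa using hI1.max_eq⟩

/-- `F` is an initial segment of the s-factorization of `S`, which covers the first `P` characters. -/
structure IsPartial (S : List α) (F : List (List α)) (P : ℕ) : Prop where
  flatten : F.flatten = S.take P
  factor : ∀ (i : ℕ) (h : i < F.length),
    IsSFactor (F.take i).flatten (S.drop (F.take i).flatten.length) F[i]

theorem IsPartial.append {S f : List α} {F : List (List α)} {P len : ℕ} (h : IsPartial S F P)
    (hP : P ≤ S.length) (hf : f = (S.drop P).take len) (hs : IsSFactor (S.take P) (S.drop P) f) :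
    IsPartial S (F ++ [f]) (P + len) := by
  refine ⟨by rw [List.flatten_append, h.flatten, List.take_add, hf]; simp, fun i hi => ?_⟩
  simp only [List.length_append, List.length_cons, List.length_nil] at hi
  rcases Nat.lt_or_ge i F.length with hlt | hge
  · rw [List.take_append_of_le_length hlt.le, List.getElem_append_left hlt]
    exact h.factor i hlt
  · obtain rfl : i = F.length := by omega
    rw [List.take_left, h.flatten, List.length_take, min_eq_left hP]
    simpa using hs

theorem IsPartial.isSFactorization {S : List α} {F : List (List α)} (h : IsPartial S F S.length) :
    IsSFactorization S F := by
  have hfl := h.flatten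
  rw [List.take_length] at hfl
  refine ⟨hfl, fun i hi => ?_⟩
  have h1 := h.factor i hi
  have h2 : S = (F.take i).flatten ++ (F.drop i).flatten := by
    rw [← List.flatten_append, List.take_append_drop, hfl]
  conv at h1 => 
    arg 2
    rw [h2]
  rwa [List.drop_left] at h1

/-- Inside a run the rest of the run always occurs earlier, so the factor reaches at least its end.
The bound of two factors per run rests on this. -/
theorem FactorLen.le {i e len : ℕ} (h : FactorLen R i e len) (he : e < ex R i) : e ≤ len := by
  rcases h with ⟨j, -, -, -, h, -⟩ | ⟨-, ⟨-, h⟩ | ⟨h, -⟩⟩ <;> omega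

/-- Compute the s-factors one after the other, and store their lengths in array `1`. -/
def mainLoop : Cmd :=
  .while (.lt 30 0) (factorCmd ;; .store 1 32 33 ;; .op .add 32 32 1 ;; walkCmd)

/-- The potential is twice the number of runs from `i` on, minus one strictly inside run `i`. Each
factor lowers it by at least one and by at least the number of runs passed, and each unit pays `K`
steps. The bound `F.length ≤ P` keeps the factor counter within a word, and the bound by `2 i` plus
the flag keeps the output within the array. -/
theorem runs_mainLoop (C : Ctx R w cap D ord pos cr) {s : State} (hS : Static R D ord pos cr s)
    (hI : Inserted R D ord cr 0 s) (h30 : s.reg 30 = 0) (h31 : s.reg 31 = ex R 0)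
    (h32 : s.reg 32 = 0) :
    Runs w T cap mainLoop s fun t s' => t ≤ 2 * R.length * ((D + 1) * 60 + 200) + 1 ∧
      ∃ F : List (List α), IsSFactorization (val R) F ∧ s'.reg 32 = F.length ∧
        ∀ (k : ℕ) (h : k < F.length), s'.mem 1 k = F[k].length := by
  have hw := C.length_word
  have hcap := C.cap_le
  have hwS := C.word
  have hone := C.one_le
  set K := (D + 1) * 60 + 200 with hK
  refine runs_while (fun q s' => ∃ i e P, ∃ F : List (List α), s'.reg 30 = i ∧ s'.reg 31 = e ∧
    IsPos R i e P ∧ Inserted R D ord cr i s' ∧ IsPartial (val R) F P ∧ s'.reg 32 = F.length ∧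
    (∀ (k : ℕ) (h : k < F.length), s'.mem 1 k = F[k].length) ∧
    F.length ≤ P ∧ F.length ≤ 2 * i + (if e < ex R i then 1 else 0) ∧
    q = (2 * (R.length - i) - (if e < ex R i then 1 else 0)) * K + 1) ?_ ?_ ?_
  · have := isPos_bnd (i := 0) C.normal (Nat.zero_le _)
    rw [if_pos (by omega), bnd_zero] at this
    exact ⟨0, ex R 0, 0, [], h30, h31, this, hI, ⟨by simp, by simp⟩, by simpa using h32, by simp,
      by simp, by simp, by simp⟩
  · rintro q s₁ hF ⟨i, e, P, F, g30, g31, hP, hI1, hpart, g32, gF, hFP, hFi, rfl⟩ hb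
    have hS1 := hS.frame hF rfl
    simp only [Cond.holds_lt, g30, hS1.r0] at hb
    obtain ⟨-, he1, he2, hPe⟩ := hP.resolve_right (by omega)
    have hbP : bnd R (i + 1) - e = P := by omega
    rw [runs_seq]
    refine (runs_factorCmd C hS1 hI1 g30 g31 hb he1 he2).mono ?_
    rintro t₂ s₂ hF2 ⟨hfl, k, hk1, hk2, ht2⟩
    set len := s₂.reg 33 with hlen
    obtain ⟨hsf, hlpos, hlle⟩ := hfl.isSFactor C.normal hb he1 he2
    rw [hbP] at hsf hlle
    have hS2 := hS1.frame hF2 rfl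
    have hI2 := hI1.frame hF2 rfl
    have k30 : s₂.reg 30 = i := by rw [hF2.reg 30 rfl, g30]
    have k31 : s₂.reg 31 = e := by rw [hF2.reg 31 rfl, g31]
    have k32 : s₂.reg 32 = F.length := by rw [hF2.reg 32 rfl, g32]
    have k1 : s₂.mem 1 = s₁.mem 1 := hF2.mem 1 rfl
    have hFc : F.length < cap := by split_ifs at hFi <;> omega
    simp only [exec_rules, state_rules, Nat.zero_mod, Nat.reduceEqDiff, reduceIte, k32, ← hlen, hS2.r1, Nat.mod_eq_of_lt (show F.length + 1 < 2 ^ w by omega)]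
    refine ⟨hFc, ?_⟩
    refine (runs_walkCmd C (i := i) (e := e) (P := P) (len := len) ?_ ?_ (by simp [k30])
      (by simp [k31]) (by simp [← hlen]) hP hlle).mono ?_
    · exact ⟨by simp [hS2.r0], by simp [hS2.r1], by simp [hS2.r2], by simp [hS2.r20],
        by simp [hS2.m0], by simp [hS2.m3], by simp [hS2.m5], by simp [hS2.m8]⟩
    · exact ⟨by simpa using hI2.left, by simpa using hI2.right, by simpa using hI2.le_max,
        by simpa using hI2.max_eq⟩
    rintro t₃ s₃ hF3 ⟨i', e', hii, l30, l31, hP', hI3, ht3⟩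
    have l32 : s₃.reg 32 = F.length + 1 := by rw [hF3.reg 32 rfl]; simp
    have l1 : s₃.mem 1 = Function.update (s₁.mem 1) F.length len := by
      rw [hF3.mem 1 rfl]; simp [k1]
    have hin := hP'.le_length
    have hflen : (((val R).drop P).take len).length = len := by
      rw [List.length_take, List.length_drop]; omega
    -- The runs charged for the comparison lie inside the factor, so the walk passes them.
    have hki : k ≤ i' - i := by
      rcases hk2 with h | h
      · omega
      · have := hP'.le_of_bnd_le hk1 (by omega)
        omega
    have hflag : i' = i → ¬ e < ex R i ∧ e' < ex R i' := by
      rintro rfl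
      rcases hP' with ⟨h1, h2, h3, h4⟩ | ⟨h1, h2, h3⟩
      · refine ⟨fun hlt => ?_, by omega⟩
        have := hfl.le hlt
        omega
      · omega
    have hx : ∃ x, 2 * (R.length - i) - (if e < ex R i then 1 else 0) =
        (2 * (R.length - i') - (if e' < ex R i' then 1 else 0)) + x ∧ i' - i ≤ x ∧ 1 ≤ x := by
      have h1 : (if e' < ex R i' then 1 else 0) ≤ 2 * (R.length - i') := by
        split_ifs with h
        · rcases hP' with h' | h'
          · omega
          · rw [ex_of_le (by omega)] at h; omega
        · omega
      refine ⟨(2 * (R.length - i) - (if e < ex R i then 1 else 0)) -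
        (2 * (R.length - i') - (if e' < ex R i' then 1 else 0)), ?_⟩
      by_cases hie : i' = i
      · obtain ⟨h2, h3⟩ := hflag hie
        subst hie
        rw [if_neg h2, if_pos h3]
        rw [if_pos h3] at h1
        omega
      -- Passing `i' - i ≥ 1` runs releases `2 (i' - i)` units, and the change of the flag takes
      -- back at most one.
      · split_ifs at h1 ⊢ <;> omega
    obtain ⟨x, hx1, hx2, hx3⟩ := hx
    refine ⟨(2 * (R.length - i') - (if e' < ex R i' then 1 else 0)) * K + 1, ?_, i', e', P + len,
      F ++ [((val R).drop P).take len], l30, l31, hP', hI3,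
      hpart.append hP.le_val rfl hsf, by simp [l32], ?_, ?_, ?_, rfl⟩
    · rw [hx1, Nat.add_mul]
      have e1 : (i' - i) * ((D + 1) * 20 + 24) ≤ x * ((D + 1) * 20 + 24) :=
        Nat.mul_le_mul_right _ hx2
      have e2 : 1 * ((D + 1) * 40 + 130) ≤ x * ((D + 1) * 40 + 130) := Nat.mul_le_mul_right _ hx3
      have e3 : x * K = x * ((D + 1) * 20 + 24) + x * ((D + 1) * 40 + 130) + x * 46 := by
        rw [hK]; ring
      omega
    · intro k' hk'
      rw [l1, Function.update_apply]
      simp only [List.length_append, List.length_cons, List.length_nil] at hk'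
      split_ifs with h
      · subst h; simp [hflen]
      · rw [gF k' (by omega), List.getElem_append_left (by omega)]
    · simp only [List.length_append, List.length_cons, List.length_nil]; omega
    · simp only [List.length_append, List.length_cons, List.length_nil]
      by_cases hie : i' = i
      · obtain ⟨h2, h3⟩ := hflag hie
        rw [if_neg h2] at hFi
        rw [if_pos h3]; omega
      · split_ifs at hFi ⊢ <;> omega
  · rintro q s₁ hF ⟨i, e, P, F, g30, g31, hP, hI1, hpart, g32, gF, hFP, hFi, rfl⟩ hb
    have hS1 := hS.frame hF rfl
    simp only [Cond.holds_lt, g30, hS1.r0] at hb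
    obtain ⟨-, -, rfl⟩ := hP.resolve_left (by omega)
    exact ⟨by omega, F, hpart.isSFactorization, g32, gF⟩

end

/-! ### The program -/

section

variable {α : Type u} [LinearOrder α] {w cap : ℕ} {T : List α} {R : List (α × ℕ)}

/-- Register `20` receives a power of two that is at most the number `n` of runs and at least
`n / 2`. -/
def halfCmd : Cmd :=
  .const 20 1 ;; .op .sub 10 0 20 ;; .while (.lt 20 10) (.op .add 20 20 20 ;; .op .sub 10 0 20)

theorem runs_halfCmd {s : State} {n : ℕ} (h0 : s.reg 0 = n) (hn : 1 ≤ n) (hw : n < 2 ^ w) :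
    Runs w T cap halfCmd s fun t s' => t ≤ Nat.log 2 n * 3 + 3 ∧
      ∃ D ≤ Nat.log 2 n, s'.reg 20 = 2 ^ D ∧ 2 ^ D ≤ n ∧ n ≤ 2 ^ (D + 1) := by
  unfold halfCmd
  simp only [exec_rules, state_rules, Nat.zero_mod, Nat.reduceEqDiff, reduceIte, h0, Nat.mod_eq_of_lt (show 1 < 2 ^ w by omega), sub_mod_two_pow hn hw]
  refine (runs_while (Q := fun s' => ∃ D ≤ Nat.log 2 n, s'.reg 20 = 2 ^ D ∧ 2 ^ D ≤ n ∧
      n ≤ 2 ^ (D + 1))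
    (fun q s' => ∃ d ≤ Nat.log 2 n, s'.reg 20 = 2 ^ d ∧ 2 ^ d ≤ n ∧ s'.reg 10 = n - 2 ^ d ∧
      q = (Nat.log 2 n - d) * 3 + 1) (p := Nat.log 2 n * 3 + 1)
    ⟨0, by omega, by simp, by simpa using hn, by simp, by simp⟩ ?_ ?_).mono ?_
  · rintro q s₁ hF ⟨d, hd, g20, hle, g10, rfl⟩ hb
    have g0 : s₁.reg 0 = n := by rw [hF.reg 0 rfl]; simp [h0]
    simp only [Cond.holds_lt, g20, g10] at hb
    have hp : 2 ^ (d + 1) = 2 ^ d + 2 ^ d := by rw [pow_succ]; ring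
    have hd' : d + 1 ≤ Nat.log 2 n := Nat.le_log_of_pow_le (by norm_num) (by omega)
    simp only [exec_rules, state_rules, Nat.zero_mod, Nat.reduceEqDiff, reduceIte, g20, g0, Nat.mod_eq_of_lt (show 2 ^ d + 2 ^ d < 2 ^ w by omega),
      sub_mod_two_pow (show 2 ^ d + 2 ^ d ≤ n by omega) hw]
    exact ⟨(Nat.log 2 n - (d + 1)) * 3 + 1, by omega, d + 1, hd', hp.symm, by omega, by omega, rfl⟩
  · rintro q s₁ hF ⟨d, hd, g20, hle, g10, rfl⟩ hb
    simp only [Cond.holds_lt, g20, g10] at hb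
    exact ⟨by omega, d, hd, g20, hle, by rw [pow_succ]; omega⟩
  · rintro t s₁ - ⟨ht, h⟩
    exact ⟨by omega, h⟩

/-- The factorization of a non-empty string. -/
def factorize : Cmd :=
  .const 1 1 ;; suffixSort ;; halfCmd ;; .const 30 0 ;; .load 31 0 30 ;; .const 32 0 ;;
  mainLoop ;; .move 0 32

theorem runs_factorize (hR : Normal R) (hn : 1 ≤ R.length) (hw : (val R).length < 2 ^ w) :
    Runs w (R.map Prod.fst) (2 * R.length + 1) factorize (initState R) fun t s =>
      t + 1 ≤ 2000 * (R.length * Nat.log 2 R.length + 1) ∧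
        ∃ F, IsSFactorization (val R) F ∧ s.Outputs (F.map List.length) := by
  have hwn : R.length < 2 ^ w := by
    have := hR.le_bnd le_rfl
    rw [bnd_length] at this
    omega
  have i0 : (initState R).reg 0 = R.length := by simp [initState]
  have ir : ∀ r, r ≠ 0 → (initState R).reg r = 0 := fun r hr => by simp [initState, hr]
  have im0 : (initState R).mem 0 = ex R := rfl
  have im : ∀ a, a ≠ 0 → (initState R).mem a = fun _ => 0 := fun a ha => by
    funext x; simp [initState, ha]
  unfold factorize
  simp only [exec_rules, state_rules, Nat.zero_mod, Nat.reduceEqDiff, reduceIte, Nat.mod_eq_of_lt (show 1 < 2 ^ w by omega)]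
  refine (runs_suffixSort (R := R) (by simp [i0]) (by simp) hwn (by simp [im0]) (by omega) hn).mono ?_
  rintro t₁ s₁ hF1 ⟨ht1, hsort, hpos, hcr⟩
  have e0 : s₁.reg 0 = R.length := by rw [hF1.reg 0 rfl]; simp [i0]
  have e1 : s₁.reg 1 = 1 := by rw [hF1.reg 1 rfl]; simp
  have e2 : s₁.reg 2 = 0 := by rw [hF1.reg 2 rfl]; simp [ir]
  have m0 : s₁.mem 0 = ex R := by rw [hF1.mem 0 rfl]; simp [im0]
  have m9 : s₁.mem 9 = fun _ => 0 := by rw [hF1.mem 9 rfl]; simp [im]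
  have m10 : s₁.mem 10 = fun _ => 0 := by rw [hF1.mem 10 rfl]; simp [im]
  have m11 : s₁.mem 11 = fun _ => 0 := by rw [hF1.mem 11 rfl]; simp [im]
  have m12 : s₁.mem 12 = fun _ => 0 := by rw [hF1.mem 12 rfl]; simp [im]
  have m13 : s₁.mem 13 = fun _ => 0 := by rw [hF1.mem 13 rfl]; simp [im]
  refine (runs_halfCmd e0 hn hwn).mono ?_
  rintro t₂ s₂ hF2 ⟨ht2, D, hD, g20, hD1, hD2⟩
  -- This yields only `2 ^ (D + 1) ≤ 2 ^ w`, with equality possible; the tree routines are written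
  -- for this bound.
  have hDw : D < w := (Nat.pow_lt_pow_iff_right (by norm_num)).1 (hD1.trans_lt hwn)
  have hC : Ctx R w (2 * R.length + 1) D (s₁.mem 3) (s₁.mem 8) (s₁.mem 5) :=
    { normal := hR, one_le := hn, word := hw, cap_le := le_rfl, length_le := hD2
      leaves_le := by rw [pow_succ]; omega
      leaves_word := Nat.pow_le_pow_right (by norm_num) hDw
      sorted := hsort, pos_ord := hpos, cr_eq := hcr }
  have k0 : s₂.mem 0 = ex R := by rw [hF2.mem 0 rfl, m0]
  have z1 : leafVal R (s₁.mem 3) 0 = fun _ => 0 := by funext x; simp [leafVal]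
  have z2 : leafValRev R (s₁.mem 3) 0 = fun _ => 0 := by funext x; simp [leafValRev, z1]
  simp only [exec_rules, state_rules, Nat.zero_mod, Nat.reduceEqDiff, reduceIte, k0]
  refine ⟨by omega, ?_⟩
  refine (runs_mainLoop hC ?_ ?_ (by simp) (by simp) (by simp)).mono ?_
  · exact ⟨by simp [hF2.reg 0 rfl, e0], by simp [hF2.reg 1 rfl, e1], by simp [hF2.reg 2 rfl, e2],
      by simp [g20], by simp [k0], by simp [hF2.mem 3 rfl], by simp [hF2.mem 5 rfl],
      by simp [hF2.mem 8 rfl]⟩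
  · refine ⟨?_, ?_, ?_, ?_⟩
    · simpa [hF2.mem 9 rfl, hF2.mem 10 rfl, m9, m10, z1] using TreeInv.zero D
    · simpa [hF2.mem 11 rfl, hF2.mem 12 rfl, m11, m12, z2] using TreeInv.zero D
    · simp
    · simp [hF2.mem 13 rfl, m13]
  rintro t₃ s₃ - ⟨ht3, F, hfac, g32, hout⟩
  refine ⟨?_, F, hfac, by simp [g32], fun k hk => ?_⟩
  -- Terms linear in `n` are absorbed: for `n ≥ 2` the logarithm is at least `1`, and for `n = 1`
  -- the summand `1` suffices.
  · have h0 : R.length ≤ R.length * Nat.log 2 R.length + 1 := by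
      rcases Nat.lt_or_ge R.length 2 with h | h
      · omega
      · exact (Nat.le_mul_of_pos_right _ (Nat.log_pos (by norm_num) h)).trans (Nat.le_succ _)
    generalize Nat.log 2 R.length = L at *
    have h1 : 2 * R.length * ((D + 1) * 60 + 200) ≤ 2 * R.length * ((L + 1) * 60 + 200) :=
      Nat.mul_le_mul_left _ (by omega)
    have h2 : L ≤ R.length * L := Nat.le_mul_of_pos_left _ hn
    have h3 : 2 * R.length * ((L + 1) * 60 + 200) = 120 * (R.length * L) + 520 * R.length := by ring
    have h4 : (L + 1) * R.length * 300 = 300 * (R.length * L) + 300 * R.length := by ring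
    omega
  · simp only [List.length_map] at hk
    simp [hout k hk]

end

end RLELZ

theorem theorem3 :
    ∃ (P : Cmd) (C : ℕ),
      ∀ (α : Type u) [LinearOrder α] (S : List α) (R : List (α × ℕ)) (w : ℕ),
        IsRLE S R → S.length < 2 ^ w →
          ∃ (cap t : ℕ) (s : State) (F : List (List α)),
            R.length ≤ cap ∧
            Exec w (R.map Prod.fst) cap P (initState R) t s ∧
            t ≤ C * (R.length * Nat.log 2 R.length + 1) ∧
            P.space R.length cap ≤ C * (R.length + 1) ∧
            IsSFactorization S F ∧
            s.Outputs (F.map List.length) := by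
  -- Register `2` is initially `0` and remains so. For the empty string, register `0` already holds
  -- the length `0` of the output; otherwise the test costs the unit reserved as `t + 1` in
  -- `runs_factorize`.
  let P : Cmd := .ite (.ne 0 2) factorize .skip
  -- The summand `2000` covers the time and the character table; the others cover the registers and
  -- the arrays of `2 n + 1 ≤ 2 (n + 1)` cells.
  refine ⟨P, 2000 + P.regs.card + 2 * P.arrays.card, fun α _ S R w hRLE hw => ?_⟩
  have hR := hRLE.normal
  obtain rfl : val R = S := hRLE.1
  suffices H : Runs w (R.map Prod.fst) (2 * R.length + 1) P (initState R) fun t s =>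
      t ≤ 2000 * (R.length * Nat.log 2 R.length + 1) ∧
        ∃ F, IsSFactorization (val R) F ∧ s.Outputs (F.map List.length) by
    obtain ⟨t, s, hx, ht, F, hF, ho⟩ := H
    refine ⟨2 * R.length + 1, t, s, F, by omega, hx, ht.trans (Nat.mul_le_mul_right _ (by omega)), ?_,
      hF, ho⟩
    unfold Cmd.space
    nlinarith [Nat.zero_le (P.regs.card * R.length)]
  rw [runs_ite]
  constructor
  · intro h
    have hn : 1 ≤ R.length := by
      rw [Cond.holds_ne] at h
      simp only [initState, if_true] at h
      simp at h
      exact List.length_pos_iff.2 h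
    exact runs_factorize hR hn hw
  · intro h
    obtain rfl : R = [] := by
      rw [Cond.holds_ne] at h
      simpa [initState] using h
    rw [runs_skip]
    exact ⟨by simp, [], ⟨rfl, by simp⟩, by simp [initState], by simp⟩
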